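/- Let $\mathcal O=\mathbf C\{x,y\}$ be the ring of convergent power series in two variables, and let $\mathcal D$ be the ring of linear differential operators with coefficients in $\mathcal O$, that is, the subalgebra of $\mathrm{End}_{\mathbf C}(\mathcal O)$ generated by the multiplications by elements of $\mathcal O$ and by $\partial_x,\partial_y$; it acts on $\mathcal O$ from the left. Let $f\in\mathcal O$ be reduced (that is, square-free, in particular nonzero) with $f(0,0)=0$. Let $\widetilde I^{\log}$ be the left ideal of $\mathcal D$ generated by all operators $\delta+a$, where $\delta$ is a $\mathbf C$-derivation of $\mathcal O$ and $a\in\mathcal O$ is such that $\delta(f)=af$, and let $\widetilde M^{\log}=\mathcal D/\widetilde I^{\log}$, a left $\mathcal D$-module. Call $f$ quasi-homogeneous if there are local coordinates $u,v\in\mathcal O$ at the origin (that is, $u(0)=v(0)=0$ and the Jacobian determinant of $(u,v)$ is nonzero at $0$) and a polynomial $P\in\mathbf C[X,Y]$, weighted homogeneous for some strictly positive integer weights of $X$ and $Y$, such that $f=P(u,v)$. If $f$ is not quasi-homogeneous, then $$\mathrm{Ext}^2_{\mathcal D}(\widetilde M^{\log},\mathcal O)\neq 0 .$$ -/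

import Mathlib

namespace PlaneCurve

/-- A formal power series `∑ aₙ xⁿ⁰ yⁿ¹` over `ℂ` is convergent if it converges absolutely on
some polydisc around the origin. -/
def IsConvergent (f : MvPowerSeries (Fin 2) ℂ) : Prop :=
  ∃ r : ℝ, 0 < r ∧ Summable fun n : Fin 2 →₀ ℕ => ‖MvPowerSeries.coeff n f‖ * r ^ n.degree

theorem IsConvergent.mono {f : MvPowerSeries (Fin 2) ℂ} {r s : ℝ} (hs : 0 < s) (hsr : s ≤ r)
    (h : Summable fun n : Fin 2 →₀ ℕ => ‖MvPowerSeries.coeff n f‖ * r ^ n.degree) :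
    Summable fun n : Fin 2 →₀ ℕ => ‖MvPowerSeries.coeff n f‖ * s ^ n.degree := by
  refine Summable.of_nonneg_of_le (fun n => by positivity) (fun n => ?_) h
  gcongr

theorem IsConvergent.add {f g : MvPowerSeries (Fin 2) ℂ} (hf : IsConvergent f)
    (hg : IsConvergent g) : IsConvergent (f + g) := by
  obtain ⟨r, hr, hf⟩ := hf
  obtain ⟨s, hs, hg⟩ := hg
  have ht : 0 < min r s := lt_min hr hs
  refine ⟨min r s, ht, ?_⟩
  refine Summable.of_nonneg_of_le (fun n => by positivity) (fun n => ?_)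
    ((mono ht (min_le_left r s) hf).add (mono ht (min_le_right r s) hg))
  rw [map_add, ← add_mul]
  gcongr
  exact norm_add_le _ _

theorem IsConvergent.mul {f g : MvPowerSeries (Fin 2) ℂ} (hf : IsConvergent f)
    (hg : IsConvergent g) : IsConvergent (f * g) := by
  obtain ⟨r, hr, hf⟩ := hf
  obtain ⟨s, hs, hg⟩ := hg
  have ht : 0 < min r s := lt_min hr hs
  refine ⟨min r s, ht, ?_⟩
  have h := summable_sum_mul_antidiagonal_of_summable_mul
    (Summable.mul_of_nonneg (mono ht (min_le_left r s) hf) (mono ht (min_le_right r s) hg)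
      (fun n => by positivity) (fun n => by positivity))
  refine Summable.of_nonneg_of_le (fun n => by positivity) (fun n => ?_) h
  rw [MvPowerSeries.coeff_mul]
  refine (mul_le_mul_of_nonneg_right (norm_sum_le _ _) (by positivity)).trans ?_
  rw [Finset.sum_mul]
  refine Finset.sum_le_sum fun p hp => ?_
  rw [← Finset.HasAntidiagonal.mem_antidiagonal.mp hp, map_add, pow_add, norm_mul]
  apply le_of_eq
  ring

theorem IsConvergent.const (c : ℂ) :
    IsConvergent (algebraMap ℂ (MvPowerSeries (Fin 2) ℂ) c) := by
  refine ⟨1, one_pos, summable_of_ne_finset_zero (s := {0}) fun n hn => ?_⟩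
  have hn' : n ≠ 0 := by simpa using hn
  simp [MvPowerSeries.algebraMap_apply, MvPowerSeries.coeff_C, hn']

theorem IsConvergent.X (i : Fin 2) :
    IsConvergent (MvPowerSeries.X i : MvPowerSeries (Fin 2) ℂ) := by
  classical
  refine ⟨1, one_pos, summable_of_ne_finset_zero (s := {Finsupp.single i 1}) fun n hn => ?_⟩
  have hn' : n ≠ Finsupp.single i 1 := by simpa using hn
  simp [MvPowerSeries.coeff_X, hn']

theorem IsConvergent.pderiv {f : MvPowerSeries (Fin 2) ℂ} (hf : IsConvergent f) (i : Fin 2) :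
    IsConvergent (MvPowerSeries.pderiv ℂ i f) := by
  obtain ⟨r, hr, hf⟩ := hf
  refine ⟨r / 2, by positivity, ?_⟩
  have hinj : Function.Injective fun n : Fin 2 →₀ ℕ => n + Finsupp.single i 1 :=
    add_left_injective _
  refine Summable.of_nonneg_of_le (fun n => by positivity) (fun n => ?_)
    ((hf.comp_injective hinj).mul_left r⁻¹)
  have h1 : (n i : ℝ) + 1 ≤ 2 ^ n.degree := by
    have h2 : n i ≤ n.degree := Finsupp.le_degree i n
    have h3 : n.degree < 2 ^ n.degree := Nat.lt_two_pow_self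
    exact_mod_cast (by omega : n i + 1 ≤ 2 ^ n.degree)
  have h4 : ‖((n i : ℂ) + 1)‖ = (n i : ℝ) + 1 := by
    have := Complex.norm_natCast (n i + 1)
    push_cast at this
    exact this
  simp only [Function.comp_apply, MvPowerSeries.coeff_pderiv, norm_mul, h4, map_add,
    Finsupp.degree_single, pow_add, pow_one, div_pow]
  calc _ ≤ ‖MvPowerSeries.coeff (n + Finsupp.single i 1) f‖ * 2 ^ n.degree
        * (r ^ n.degree / 2 ^ n.degree) := by gcongr
    _ = _ := by field_simp

/-- `𝒪 = ℂ{x, y}`, the ring of convergent power series in two variables. -/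
def convergentSubalgebra : Subalgebra ℂ (MvPowerSeries (Fin 2) ℂ) where
  carrier := {f | IsConvergent f}
  add_mem' := IsConvergent.add
  mul_mem' := IsConvergent.mul
  algebraMap_mem' := IsConvergent.const

/-- The ring `𝒪 = ℂ{x, y}` as a type. -/
def 𝒪 : Type := convergentSubalgebra

noncomputable instance : CommRing 𝒪 := inferInstanceAs (CommRing convergentSubalgebra)

noncomputable instance : Algebra ℂ 𝒪 := inferInstanceAs (Algebra ℂ convergentSubalgebra)

/-- The inclusion of the convergent power series in the formal power series. -/
noncomputable def toSeries : 𝒪 →ₐ[ℂ] MvPowerSeries (Fin 2) ℂ := convergentSubalgebra.val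

theorem toSeries_injective : Function.Injective toSeries := Subtype.val_injective

theorem isConvergent_toSeries (f : 𝒪) : IsConvergent (toSeries f) := f.2

/-- A convergent formal power series, as an element of `𝒪`. -/
def mk (f : MvPowerSeries (Fin 2) ℂ) (hf : IsConvergent f) : 𝒪 := ⟨f, hf⟩

@[simp]
theorem toSeries_mk (f : MvPowerSeries (Fin 2) ℂ) (hf : IsConvergent f) :
    toSeries (mk f hf) = f := rfl

/-- The value at the origin of a convergent power series. -/
noncomputable def eval₀ (f : 𝒪) : ℂ := MvPowerSeries.constantCoeff (toSeries f)

/-- The partial derivatives `∂/∂x` (for `i = 0`) and `∂/∂y` (for `i = 1`) on `𝒪`. -/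
noncomputable def partialD (i : Fin 2) : Derivation ℂ 𝒪 𝒪 where
  toFun f := mk (MvPowerSeries.pderiv ℂ i (toSeries f)) (isConvergent_toSeries f |>.pderiv i)
  map_add' f g := toSeries_injective (by simp)
  map_smul' c f := toSeries_injective (by simp)
  map_one_eq_zero' := toSeries_injective (by simp)
  leibniz' f g := toSeries_injective (by simp)

@[simp]
theorem toSeries_partialD (i : Fin 2) (f : 𝒪) :
    toSeries (partialD i f) = MvPowerSeries.pderiv ℂ i (toSeries f) := rfl

/-- The ring `𝒟` of linear differential operators with coefficients in `𝒪`: the subalgebra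
of `End_ℂ(𝒪)` generated by the multiplications by elements of `𝒪` and by `∂/∂x`, `∂/∂y`. -/
noncomputable def diffOpSubalgebra : Subalgebra ℂ (Module.End ℂ 𝒪) :=
  Algebra.adjoin ℂ
    (Set.range (fun a : 𝒪 => LinearMap.mulLeft ℂ a) ∪
      Set.range (fun i : Fin 2 => (partialD i : 𝒪 →ₗ[ℂ] 𝒪)))

/-- The ring `𝒟` as a type. -/
def 𝒟 : Type := diffOpSubalgebra

noncomputable instance : Ring 𝒟 := inferInstanceAs (Ring diffOpSubalgebra)

noncomputable instance : Algebra ℂ 𝒟 := inferInstanceAs (Algebra ℂ diffOpSubalgebra)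

/-- The inclusion of `𝒟` in `End_ℂ(𝒪)`. -/
noncomputable def toEnd : 𝒟 →ₐ[ℂ] Module.End ℂ 𝒪 := diffOpSubalgebra.val

/-- `𝒪` is a left `𝒟`-module: differential operators act on functions by evaluation. -/
noncomputable instance : Module 𝒟 𝒪 := Module.compHom 𝒪 toEnd.toRingHom

/-- The coordinate functions `x = X 0` and `y = X 1` in `𝒪`. -/
noncomputable def coord (i : Fin 2) : 𝒪 := mk (MvPowerSeries.X i) (IsConvergent.X i)

theorem IsConvergent.shift {f g : MvPowerSeries (Fin 2) ℂ} (hf : IsConvergent f) (i : Fin 2)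
    (h : ∀ n, MvPowerSeries.coeff n g = MvPowerSeries.coeff (n + Finsupp.single i 1) f ∨
      MvPowerSeries.coeff n g = 0) : IsConvergent g := by
  obtain ⟨r, hr, hf⟩ := hf
  refine ⟨r, hr, ?_⟩
  have hinj : Function.Injective fun n : Fin 2 →₀ ℕ => n + Finsupp.single i 1 :=
    add_left_injective _
  refine Summable.of_nonneg_of_le (fun n => by positivity) (fun n => ?_)
    ((hf.comp_injective hinj).mul_left r⁻¹)
  simp only [Function.comp_apply, map_add, Finsupp.degree_single, pow_add, pow_one]
  rcases h n with h | h
  · rw [h]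
    apply le_of_eq
    field_simp
  · rw [h, norm_zero, zero_mul]
    positivity

theorem coeff_coord_mul (i : Fin 2) (g : 𝒪) (n : Fin 2 →₀ ℕ) :
    MvPowerSeries.coeff n (toSeries (coord i * g)) =
      if 1 ≤ n i then MvPowerSeries.coeff (n - Finsupp.single i 1)
        (toSeries g) else 0 := by
  classical
  change MvPowerSeries.coeff n (MvPowerSeries.monomial (Finsupp.single i 1) 1 * toSeries g) = _
  rw [MvPowerSeries.coeff_monomial_mul]
  simp only [one_mul, Finsupp.single_le_iff]

/-- Every `f ∈ 𝒪` is of the form `c + x f₁ + y f₂`. -/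
theorem exists_decomp (f : 𝒪) :
    ∃ (c : ℂ) (f₁ f₂ : 𝒪), f = algebraMap ℂ 𝒪 c + coord 0 * f₁ + coord 1 * f₂ := by
  classical
  let g₁ : MvPowerSeries (Fin 2) ℂ := fun n =>
    MvPowerSeries.coeff (n + Finsupp.single 0 1) (toSeries f)
  let g₂ : MvPowerSeries (Fin 2) ℂ := fun n => if n 0 = 0 then
    MvPowerSeries.coeff (n + Finsupp.single 1 1) (toSeries f) else 0
  have e₁ : ∀ n, MvPowerSeries.coeff n g₁ =
    MvPowerSeries.coeff (n + Finsupp.single 0 1) (toSeries f) := fun n => rfl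
  have e₂ : ∀ n, MvPowerSeries.coeff n g₂ = if n 0 = 0 then
    MvPowerSeries.coeff (n + Finsupp.single 1 1) (toSeries f) else 0 :=
    fun n => rfl
  refine ⟨eval₀ f, mk g₁ (IsConvergent.shift (isConvergent_toSeries f) 0 fun n => Or.inl rfl),
    mk g₂ (IsConvergent.shift (isConvergent_toSeries f) 1 fun n => ?_), ?_⟩
  · rw [e₂]
    split_ifs
    · exact Or.inl rfl
    · exact Or.inr rfl
  · apply toSeries_injective
    ext n
    have hc : toSeries (algebraMap ℂ 𝒪 (eval₀ f)) = MvPowerSeries.C (eval₀ f) := rfl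
    simp only [toSeries_mk, map_add, coeff_coord_mul, e₁, e₂, hc, MvPowerSeries.coeff_C]
    by_cases h0 : 1 ≤ n 0
    · have hn : n ≠ 0 := by rintro rfl; simp at h0
      have h0' : n 0 ≠ 0 := by omega
      have h : n - Finsupp.single 0 1 + Finsupp.single 0 1 = n :=
        tsub_add_cancel_of_le (Finsupp.single_le_iff.mpr h0)
      simp [h0, hn, h0', h]
    · by_cases h1 : 1 ≤ n 1
      · have hn : n ≠ 0 := by rintro rfl; simp at h1
        have h0' : n 0 = 0 := by omega
        have h : n - Finsupp.single 1 1 + Finsupp.single 1 1 = n :=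
          tsub_add_cancel_of_le (Finsupp.single_le_iff.mpr h1)
        simp [hn, h0', h1, h]
      · have hn : n = 0 := by
          ext i
          fin_cases i <;> simp <;> omega
        subst hn
        simp [eval₀]

theorem derivation_eq_zero (δ : Derivation ℂ 𝒪 𝒪) (h : ∀ i, δ (coord i) = 0) (f : 𝒪) :
    δ f = 0 := by
  have key : ∀ (k : ℕ) (f : 𝒪) (n : Fin 2 →₀ ℕ), n.degree < k →
      MvPowerSeries.coeff n (toSeries (δ f)) = 0 := by
    intro k
    induction k with
    | zero => intro f n hn; omega
    | succ k ih =>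
      intro f n hn
      have aux : ∀ (i : Fin 2) (g : 𝒪), MvPowerSeries.coeff n
          (toSeries (coord i * δ g)) = 0 := by
        intro i g
        rw [coeff_coord_mul]
        split_ifs with hi
        · apply ih
          have hd := congrArg Finsupp.degree
            (tsub_add_cancel_of_le (Finsupp.single_le_iff.mpr hi) :
              n - Finsupp.single i 1 + Finsupp.single i 1 = n)
          rw [map_add, Finsupp.degree_single] at hd
          omega
        · rfl
      obtain ⟨c, f₁, f₂, rfl⟩ := exists_decomp f
      have e : δ (algebraMap ℂ 𝒪 c + coord 0 * f₁ + coord 1 * f₂) =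
          coord 0 * δ f₁ + coord 1 * δ f₂ := by
        simp [h]
      rw [e, map_add, map_add, aux, aux, add_zero]
  apply toSeries_injective
  ext n
  simpa using key (n.degree + 1) f n (Nat.lt_succ_self _)

/-- Every derivation of `𝒪` is of the form `b ∂/∂x + c ∂/∂y`. -/
theorem derivation_eq (δ : Derivation ℂ 𝒪 𝒪) :
    δ = δ (coord 0) • partialD 0 + δ (coord 1) • partialD 1 := by
  have hp : ∀ i j : Fin 2, partialD i (coord j) = if i = j then 1 else 0 := by
    intro i j
    apply toSeries_injective
    change MvPowerSeries.pderiv ℂ i (MvPowerSeries.X j) = _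
    split_ifs with hij
    · subst hij
      simp
    · simp [MvPowerSeries.pderiv_X_of_ne (Ne.symm hij)]
  rw [← sub_eq_zero]
  ext1 f
  refine derivation_eq_zero _ (fun i => ?_) f
  fin_cases i <;> simp [hp]

/-- The multiplication by `a ∈ 𝒪`, as a differential operator. -/
noncomputable def mulOp (a : 𝒪) : 𝒟 :=
  ⟨LinearMap.mulLeft ℂ a, Algebra.subset_adjoin (Or.inl ⟨a, rfl⟩)⟩

/-- A derivation of `𝒪`, as a differential operator. -/
noncomputable def derOp (δ : Derivation ℂ 𝒪 𝒪) : 𝒟 :=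
  ⟨(δ : 𝒪 →ₗ[ℂ] 𝒪), by
    have hp : ∀ (a : 𝒪) (i : Fin 2), LinearMap.mulLeft ℂ a * (partialD i : 𝒪 →ₗ[ℂ] 𝒪) ∈
        diffOpSubalgebra := fun a i =>
      mul_mem (Algebra.subset_adjoin (Or.inl ⟨a, rfl⟩)) (Algebra.subset_adjoin (Or.inr ⟨i, rfl⟩))
    have h : (δ : 𝒪 →ₗ[ℂ] 𝒪) =
        LinearMap.mulLeft ℂ (δ (coord 0)) * (partialD 0 : 𝒪 →ₗ[ℂ] 𝒪) +
          LinearMap.mulLeft ℂ (δ (coord 1)) * (partialD 1 : 𝒪 →ₗ[ℂ] 𝒪) :=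
      LinearMap.ext fun g => DFunLike.congr_fun (derivation_eq δ) g
    rw [h]
    exact add_mem (hp _ _) (hp _ _)⟩

/-- `Ĩ^log`, the left ideal of `𝒟` generated by the operators `δ + a`, where `δ` is a derivation
of `𝒪` and `δ(f) = a f`. (`Ideal` means left ideal over a noncommutative ring.) -/
noncomputable def tildeILog (f : 𝒪) : Ideal 𝒟 :=
  Ideal.span {P | ∃ (δ : Derivation ℂ 𝒪 𝒪) (a : 𝒪), δ f = a * f ∧ P = derOp δ + mulOp a}

/-- The left `𝒟`-module `M̃^log = 𝒟 / Ĩ^log`. -/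
abbrev TildeMLog (f : 𝒪) : Type := 𝒟 ⧸ tildeILog f

/-- `u, v ∈ 𝒪` form a system of local coordinates at the origin: both vanish at the origin and
their Jacobian determinant does not. -/
def IsCoordinateSystem (u v : 𝒪) : Prop :=
  eval₀ u = 0 ∧ eval₀ v = 0 ∧
    eval₀ (partialD 0 u * partialD 1 v - partialD 1 u * partialD 0 v) ≠ 0

/-- `f` is quasi-homogeneous: in some system `u, v` of local coordinates at the origin it is a
weighted homogeneous polynomial, for some strictly positive integer weights of `u` and `v`. -/
def IsQuasiHomogeneous (f : 𝒪) : Prop :=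
  ∃ (u v : 𝒪) (w : Fin 2 → ℕ) (d : ℕ) (p : MvPolynomial (Fin 2) ℂ),
    IsCoordinateSystem u v ∧ (∀ i, 0 < w i) ∧ p.IsWeightedHomogeneous w d ∧
      f = MvPolynomial.aeval ![u, v] p

end PlaneCurve

/-! Assume that the `Ext²` vanishes. Let `I` be the logarithmic left ideal and `𝒦` the field of
fractions of `𝒪`, with its natural `𝒟`-action. As `𝒟` is projective over itself, `Ext¹(I, 𝒪) = 0`,
so every `𝒟`-linear map `I → 𝒦 / 𝒪` lifts to `𝒦` (`exists_lift_of_subsingleton_ext`). The map that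
gets lifted sends `δ + a` to the class of `x δ(y) / f`, the contraction of `δ` with the form `x dy /
f`.

This map is well defined (`linearCombination_logFrac_mem_range`): a relation `∑ Pᵢ (δᵢ + aᵢ) = 0`
must make `z = ∑ Pᵢ (x δᵢ(y) / f)` regular. Clearly `z ∈ 𝒪[1/f]`. Where `∂ⱼ f` is invertible, `f` is
part of a coordinate system and `x dy` has a formal primitive `G₀` along the level curves of `f`. Up
to terms without a pole along `f`, `δ + a` sends `G₀ / f` to `x δ(y) / f`, so the relation forces `z
∈ 𝒪[1/∂ⱼ f]`. Hence the denominators of `z` form an ideal whose radical contains the Tjurina ideal.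
For square-free `f` that ideal contains a power of the maximal ideal (Weierstrass preparation and
Gauss's lemma), and a fraction without poles outside the origin is regular.

A lift changes each `x δ(y) / f` by some element of `𝒪`. Evaluated on the relations between `f ∂x +
f_x`, `f ∂y + f_y` and `f_y ∂x - f_x ∂y`, it yields a logarithmic vector field of divergence `1`
(`exists_divergence_eq_one`); the `1` is `∂x x`.

It remains to see that such a field makes `f` quasi-homogeneous
(`isQuasiHomogeneous_of_divergence`). Order one is immediate. In higher order, logarithmic fields
vanish at the origin, and the linear part here has trace `1`. Equal eigenvalues can be scaled to
`1`. If they are distinct and the Hessian is degenerate, the action of the field on the Tjurina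
ideal, restricted to nearly invariant smooth curves, gives integral linear relations that make the
ratio of the eigenvalues a positive rational (`exists_eigenvalue_relation`,
`isQuasiHomogeneous_of_diagonal`). A nondegenerate Hessian is treated directly.

After scaling, the eigenvalues are positive integers `p ≤ q`. Then there are no small divisors, and
the field has convergent eigencoordinates up to one resonant term (`exists_eigen_coords`). A unit
multiple of `f` is an eigenfunction, hence a weighted homogeneous polynomial in these coordinates,
and the unit is absorbed by rescaling them (`isQuasiHomogeneous_of_poincare`). All convergence
statements rest on one contraction principle for weighted `ℓ¹` norms (`exists_fixed_point`). -/

open scoped ENNReal NNReal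

namespace PlaneCurve

/-! ### Weighted `ℓ¹` norms of formal power series -/

/-- The weight `ρ₀ ^ n₀ ρ₁ ^ n₁` of the monomial with exponent `n`. -/
noncomputable def wt (ρ : Fin 2 → ℝ≥0) (n : Fin 2 →₀ ℕ) : ℝ≥0∞ :=
  (ρ 0 : ℝ≥0∞) ^ n 0 * (ρ 1 : ℝ≥0∞) ^ n 1

theorem wt_add (ρ : Fin 2 → ℝ≥0) (m n : Fin 2 →₀ ℕ) : wt ρ (m + n) = wt ρ m * wt ρ n := by
  simp only [wt, Finsupp.add_apply, pow_add]
  ring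

theorem wt_single (ρ : Fin 2 → ℝ≥0) (i : Fin 2) : wt ρ (Finsupp.single i 1) = ρ i := by
  fin_cases i <;> simp [wt]

theorem wt_ne_zero {ρ : Fin 2 → ℝ≥0} (hρ : ∀ i, 0 < ρ i) (n : Fin 2 →₀ ℕ) : wt ρ n ≠ 0 := by
  have h0 := (hρ 0).ne'
  have h1 := (hρ 1).ne'
  simp [wt, h0, h1]

theorem wt_mono {ρ σ : Fin 2 → ℝ≥0} (h : ∀ i, ρ i ≤ σ i) (n : Fin 2 →₀ ℕ) : wt ρ n ≤ wt σ n := by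
  unfold wt
  gcongr <;> exact h _

theorem degree_eq (n : Fin 2 →₀ ℕ) : n.degree = n 0 + n 1 := by
  simp [Finsupp.degree_eq_sum, Fin.sum_univ_two]

theorem wt_smul (t : ℝ≥0) (ρ : Fin 2 → ℝ≥0) (n : Fin 2 →₀ ℕ) :
    wt (fun i => t * ρ i) n = (t : ℝ≥0∞) ^ n.degree * wt ρ n := by
  simp only [wt, ENNReal.coe_mul, mul_pow, degree_eq, pow_add]
  ring

/-- The weighted `ℓ¹` norm of a formal power series, with values in `[0, ∞]`. -/
noncomputable def wnorm (ρ : Fin 2 → ℝ≥0) (f : MvPowerSeries (Fin 2) ℂ) : ℝ≥0∞ :=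
  ∑' n, ‖MvPowerSeries.coeff n f‖ₑ * wt ρ n

theorem le_wnorm (ρ : Fin 2 → ℝ≥0) (f : MvPowerSeries (Fin 2) ℂ) (n : Fin 2 →₀ ℕ) :
    ‖MvPowerSeries.coeff n f‖ₑ * wt ρ n ≤ wnorm ρ f :=
  ENNReal.le_tsum n

theorem wnorm_le_of_coeff_le (ρ : Fin 2 → ℝ≥0) {f g : MvPowerSeries (Fin 2) ℂ} (C : ℝ≥0∞)
    (h : ∀ n, ‖MvPowerSeries.coeff n f‖ₑ ≤ C * ‖MvPowerSeries.coeff n g‖ₑ) :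
    wnorm ρ f ≤ C * wnorm ρ g := by
  rw [wnorm, wnorm, ← ENNReal.tsum_mul_left]
  refine ENNReal.tsum_le_tsum fun n => ?_
  rw [← mul_assoc]
  gcongr
  exact h n

theorem wnorm_mono {ρ σ : Fin 2 → ℝ≥0} (h : ∀ i, ρ i ≤ σ i) (f : MvPowerSeries (Fin 2) ℂ) :
    wnorm ρ f ≤ wnorm σ f :=
  ENNReal.tsum_le_tsum fun n => by gcongr; exact wt_mono h n

theorem wnorm_add_le (ρ : Fin 2 → ℝ≥0) (f g : MvPowerSeries (Fin 2) ℂ) :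
    wnorm ρ (f + g) ≤ wnorm ρ f + wnorm ρ g := by
  rw [wnorm, wnorm, wnorm, ← ENNReal.tsum_add]
  refine ENNReal.tsum_le_tsum fun n => ?_
  rw [map_add, ← add_mul]
  gcongr
  exact enorm_add_le _ _

theorem wnorm_neg (ρ : Fin 2 → ℝ≥0) (f : MvPowerSeries (Fin 2) ℂ) :
    wnorm ρ (-f) = wnorm ρ f := by
  simp [wnorm]

theorem wnorm_sub_le (ρ : Fin 2 → ℝ≥0) (f g : MvPowerSeries (Fin 2) ℂ) :
    wnorm ρ (f - g) ≤ wnorm ρ f + wnorm ρ g := by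
  rw [sub_eq_add_neg, ← wnorm_neg ρ g]
  exact wnorm_add_le ρ f (-g)

theorem eq_zero_of_wnorm_eq_zero {ρ : Fin 2 → ℝ≥0} (hρ : ∀ i, 0 < ρ i)
    {f : MvPowerSeries (Fin 2) ℂ} (h : wnorm ρ f = 0) : f = 0 := by
  ext n
  have h1 := le_wnorm ρ f n
  rw [h, nonpos_iff_eq_zero, mul_eq_zero, or_iff_left (wt_ne_zero hρ n), enorm_eq_zero] at h1
  simpa using h1

/-- The weight is multiplicative in the exponent, so regrouping the product of two sums along
antidiagonals gives the Cauchy product. With values in `[0, ∞]` no summability is needed. -/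
theorem wnorm_le_of_antidiagonal (ρ : Fin 2 → ℝ≥0) {f g h : MvPowerSeries (Fin 2) ℂ} (C : ℝ≥0∞)
    (H : ∀ n, ‖MvPowerSeries.coeff n f‖ₑ ≤ C * ∑ p ∈ Finset.HasAntidiagonal.antidiagonal n,
      ‖MvPowerSeries.coeff p.1 g‖ₑ * ‖MvPowerSeries.coeff p.2 h‖ₑ) :
    wnorm ρ f ≤ C * (wnorm ρ g * wnorm ρ h) := by
  have e : wnorm ρ g * wnorm ρ h = ∑' n, ∑ p ∈ Finset.HasAntidiagonal.antidiagonal n,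
      (‖MvPowerSeries.coeff p.1 g‖ₑ * wt ρ p.1) * (‖MvPowerSeries.coeff p.2 h‖ₑ * wt ρ p.2) := by
    rw [wnorm, wnorm, ← ENNReal.tsum_mul_right]
    simp_rw [← ENNReal.tsum_mul_left]
    rw [← ENNReal.tsum_prod, ← Finset.HasAntidiagonal.sigmaAntidiagonalEquivProd.tsum_eq, ENNReal.tsum_sigma']
    refine tsum_congr fun n => ?_
    rw [tsum_fintype, ← Finset.sum_coe_sort (Finset.HasAntidiagonal.antidiagonal n)]
    rfl
  rw [e, wnorm, ← ENNReal.tsum_mul_left]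
  refine ENNReal.tsum_le_tsum fun n => ?_
  calc _ ≤ (C * ∑ p ∈ Finset.HasAntidiagonal.antidiagonal n,
      ‖MvPowerSeries.coeff p.1 g‖ₑ * ‖MvPowerSeries.coeff p.2 h‖ₑ) * wt ρ n := by
        gcongr; exact H n
    _ = _ := by
      rw [mul_assoc, Finset.sum_mul]
      congr 1
      refine Finset.sum_congr rfl fun p hp => ?_
      rw [← Finset.HasAntidiagonal.mem_antidiagonal.mp hp, wt_add]
      ring

theorem wnorm_mul_le (ρ : Fin 2 → ℝ≥0) (f g : MvPowerSeries (Fin 2) ℂ) :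
    wnorm ρ (f * g) ≤ wnorm ρ f * wnorm ρ g := by
  classical
  rw [← one_mul (wnorm ρ f * wnorm ρ g)]
  refine wnorm_le_of_antidiagonal ρ 1 fun n => ?_
  rw [one_mul, MvPowerSeries.coeff_mul]
  refine (enorm_sum_le _ _).trans (le_of_eq ?_)
  simp

theorem wnorm_pow_le (ρ : Fin 2 → ℝ≥0) (f : MvPowerSeries (Fin 2) ℂ) (k : ℕ) :
    wnorm ρ (f ^ (k + 1)) ≤ wnorm ρ f ^ (k + 1) := by
  induction k with
  | zero => simp
  | succ k ih =>
    rw [pow_succ f, pow_succ (wnorm ρ f)]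
    refine (wnorm_mul_le _ _ _).trans ?_
    gcongr

/-- Drop the terms not divisible by `Xᵢ` and divide by `Xᵢ`. -/
noncomputable def shift (i : Fin 2) :
    MvPowerSeries (Fin 2) ℂ →ₗ[ℂ] MvPowerSeries (Fin 2) ℂ where
  toFun f := fun n => MvPowerSeries.coeff (n + Finsupp.single i 1) f
  map_add' f g := by ext n; simp only [map_add]; rfl
  map_smul' c f := by ext n; simp only [map_smul]; rfl

@[simp]
theorem coeff_shift (i : Fin 2) (f : MvPowerSeries (Fin 2) ℂ) (n : Fin 2 →₀ ℕ) :
    MvPowerSeries.coeff n (shift i f) = MvPowerSeries.coeff (n + Finsupp.single i 1) f := rfl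

theorem wnorm_shift_le (ρ : Fin 2 → ℝ≥0) (i : Fin 2) (f : MvPowerSeries (Fin 2) ℂ) :
    wnorm ρ (shift i f) * ρ i ≤ wnorm ρ f := by
  rw [wnorm, ← ENNReal.tsum_mul_right]
  have hinj : Function.Injective fun n : Fin 2 →₀ ℕ => n + Finsupp.single i 1 :=
    add_left_injective _
  refine le_trans (le_of_eq (tsum_congr fun n => ?_)) (ENNReal.tsum_comp_le_tsum_of_injective hinj
    fun n => ‖MvPowerSeries.coeff n f‖ₑ * wt ρ n)
  rw [coeff_shift, wt_add, wt_single, mul_assoc]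

theorem wnorm_scale_le {t : ℝ≥0} (ht : t ≤ 1) (ρ : Fin 2 → ℝ≥0) {f : MvPowerSeries (Fin 2) ℂ}
    {k : ℕ} (hf : ∀ n : Fin 2 →₀ ℕ, n.degree < k → MvPowerSeries.coeff n f = 0) :
    wnorm (fun i => t * ρ i) f ≤ (t : ℝ≥0∞) ^ k * wnorm ρ f := by
  rw [wnorm, wnorm, ← ENNReal.tsum_mul_left]
  refine ENNReal.tsum_le_tsum fun n => ?_
  by_cases hn : n.degree < k
  · simp [hf n hn]
  · rw [wt_smul, mul_left_comm]
    gcongr ?_ * _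
    exact pow_le_pow_right_of_le_one' (by exact_mod_cast ht) (not_lt.mp hn)

theorem isConvergent_iff (f : MvPowerSeries (Fin 2) ℂ) :
    IsConvergent f ↔ ∃ r : ℝ≥0, 0 < r ∧ wnorm (fun _ => r) f ≠ ⊤ := by
  have key : ∀ r : ℝ≥0, wnorm (fun _ => r) f =
      ∑' n, ((‖MvPowerSeries.coeff n f‖₊ * r ^ n.degree : ℝ≥0) : ℝ≥0∞) := fun r =>
    tsum_congr fun n => by
      simp only [wt, degree_eq, pow_add, ENNReal.coe_mul, ENNReal.coe_pow]
      rfl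
  constructor
  · rintro ⟨r, hr, h⟩
    lift r to ℝ≥0 using hr.le
    refine ⟨r, by exact_mod_cast hr, ?_⟩
    rw [key, ENNReal.tsum_coe_ne_top_iff_summable, ← NNReal.summable_coe]
    exact h
  · rintro ⟨r, hr, h⟩
    refine ⟨r, hr, ?_⟩
    rw [key, ENNReal.tsum_coe_ne_top_iff_summable, ← NNReal.summable_coe] at h
    simpa using h

theorem IsConvergent.of_wnorm {f : MvPowerSeries (Fin 2) ℂ} {ρ : Fin 2 → ℝ≥0} (hρ : ∀ i, 0 < ρ i)
    (h : wnorm ρ f ≠ ⊤) : IsConvergent f := by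
  refine (isConvergent_iff f).mpr ⟨min (ρ 0) (ρ 1), lt_min (hρ 0) (hρ 1), ?_⟩
  refine ne_top_of_le_ne_top h (wnorm_mono (fun i => ?_) f)
  fin_cases i
  · exact min_le_left _ _
  · exact min_le_right _ _

/-- A linear operator that halves the weighted norm is a contraction, so that `q = h + Λ q` has
a solution of finite norm. -/
theorem exists_fixed_point {ρ : Fin 2 → ℝ≥0} (hρ : ∀ i, 0 < ρ i)
    (Λ : MvPowerSeries (Fin 2) ℂ →ₗ[ℂ] MvPowerSeries (Fin 2) ℂ)
    (hΛ : ∀ h, wnorm ρ (Λ h) ≤ 2⁻¹ * wnorm ρ h) {h : MvPowerSeries (Fin 2) ℂ}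
    (hh : wnorm ρ h ≠ ⊤) : ∃ q, wnorm ρ q ≠ ⊤ ∧ q = h + Λ q := by
  have hk : ∀ k, wnorm ρ ((Λ ^ k) h) ≤ 2⁻¹ ^ k * wnorm ρ h := by
    intro k
    induction k with
    | zero => simp
    | succ k ih =>
      rw [pow_succ', Module.End.mul_apply, pow_succ', mul_assoc]
      exact (hΛ _).trans (by gcongr)
  have hgeo : ∀ K : ℕ, ∑' k, wnorm ρ ((Λ ^ (K + k)) h) ≤ 2⁻¹ ^ K * (2 * wnorm ρ h) := by
    intro K
    calc _ ≤ ∑' k, 2⁻¹ ^ K * (2⁻¹ ^ k * wnorm ρ h) := by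
          refine ENNReal.tsum_le_tsum fun k => (hk _).trans (le_of_eq ?_)
          rw [pow_add, mul_assoc]
      _ = _ := by
          rw [ENNReal.tsum_mul_left, ENNReal.tsum_mul_right, ENNReal.tsum_geometric,
            ENNReal.one_sub_inv_two, inv_inv]
  have hsum : ∀ n, Summable fun k => MvPowerSeries.coeff n ((Λ ^ k) h) := by
    intro n
    refine Summable.of_enorm ?_
    have h1 : (∑' k, ‖MvPowerSeries.coeff n ((Λ ^ k) h)‖ₑ) * wt ρ n ≤ 2⁻¹ ^ 0 * (2 * wnorm ρ h) := by
      rw [← ENNReal.tsum_mul_right]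
      refine le_trans (ENNReal.tsum_le_tsum fun k => ?_) (hgeo 0)
      rw [zero_add]
      exact le_wnorm ρ _ n
    intro h2
    rw [h2, ENNReal.top_mul (wt_ne_zero hρ n), top_le_iff] at h1
    exact ENNReal.mul_ne_top (by simp) (ENNReal.mul_ne_top (by simp) hh) h1
  -- The Neumann series `∑ Λᵏ h`, summed coefficient by coefficient.
  let q : MvPowerSeries (Fin 2) ℂ := fun n => ∑' k, MvPowerSeries.coeff n ((Λ ^ k) h)
  have hq : ∀ n, MvPowerSeries.coeff n q = ∑' k, MvPowerSeries.coeff n ((Λ ^ k) h) := fun n => rfl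
  have htail : ∀ K, wnorm ρ (q - ∑ k ∈ Finset.range K, (Λ ^ k) h) ≤ 2⁻¹ ^ K * (2 * wnorm ρ h) := by
    intro K
    refine le_trans ?_ (hgeo K)
    simp only [wnorm]
    rw [ENNReal.tsum_comm]
    refine ENNReal.tsum_le_tsum fun n => ?_
    rw [ENNReal.tsum_mul_right]
    gcongr
    have h3 : MvPowerSeries.coeff n (q - ∑ k ∈ Finset.range K, (Λ ^ k) h) =
        ∑' k, MvPowerSeries.coeff n ((Λ ^ (K + k)) h) := by
      rw [map_sub, map_sum, hq, ← (hsum n).sum_add_tsum_nat_add K, add_sub_cancel_left]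
      simp_rw [add_comm]
    rw [h3]
    exact enorm_tsum_le_tsum_enorm
  have hfin : 2 * wnorm ρ h ≠ ⊤ := ENNReal.mul_ne_top (by simp) hh
  refine ⟨q, ne_top_of_le_ne_top hfin (by simpa using htail 0), ?_⟩
  rw [← sub_eq_zero]
  refine eq_zero_of_wnorm_eq_zero hρ ?_
  have hb : ∀ K : ℕ, wnorm ρ (q - (h + Λ q)) ≤ 2⁻¹ ^ K * (2 * (2 * wnorm ρ h)) := by
    intro K
    -- Comparison with partial sums applies `Λ` to finite sums and to a remainder of small norm
    -- only, so no termwise application of `Λ` to the infinite series is needed.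
    have h4 : q - (h + Λ q) = (q - ∑ k ∈ Finset.range (K + 1), (Λ ^ k) h) -
        Λ (q - ∑ k ∈ Finset.range K, (Λ ^ k) h) := by
      rw [Finset.sum_range_succ', map_sub, map_sum]
      simp only [pow_succ', Module.End.mul_apply, pow_zero, Module.End.one_apply]
      abel
    rw [h4]
    refine (wnorm_sub_le _ _ _).trans ?_
    calc _ ≤ 2⁻¹ ^ (K + 1) * (2 * wnorm ρ h) + 2⁻¹ * (2⁻¹ ^ K * (2 * wnorm ρ h)) :=
          add_le_add (htail _) ((hΛ _).trans (by gcongr; exact htail K))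
      _ ≤ 2⁻¹ ^ K * (2 * wnorm ρ h) + 2⁻¹ ^ K * (2 * wnorm ρ h) := by
          gcongr ?_ + ?_
          · gcongr ?_ * _
            exact pow_le_pow_right_of_le_one' (by simp) (Nat.le_succ K)
          · exact mul_le_of_le_one_left' (by simp)
      _ = _ := by ring
  have hlim : Filter.Tendsto (fun K : ℕ => (2⁻¹ : ℝ≥0∞) ^ K * (2 * (2 * wnorm ρ h))) Filter.atTop
      (nhds 0) := by
    have := ENNReal.Tendsto.mul_const (b := 2 * (2 * wnorm ρ h))
      (ENNReal.tendsto_pow_atTop_nhds_zero_of_lt_one (r := 2⁻¹) (by simp))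
      (Or.inr (ENNReal.mul_ne_top (by simp) hfin))
    simpa using this
  exact nonpos_iff_eq_zero.mp (ge_of_tendsto' hlim hb)

/-! ### The local ring `𝒪` and its maximal ideal -/

instance : IsDomain 𝒪 :=
  have : IsDomain (MvPowerSeries (Fin 2) ℂ) := NoZeroDivisors.to_isDomain _
  Function.Injective.isDomain toSeries.toRingHom toSeries_injective

/-- The coefficients of a convergent power series, as linear forms. -/
noncomputable def cf (n : Fin 2 →₀ ℕ) : 𝒪 →ₗ[ℂ] ℂ :=
  (MvPowerSeries.coeff n).comp toSeries.toLinearMap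

theorem cf_apply (n : Fin 2 →₀ ℕ) (f : 𝒪) : cf n f = MvPowerSeries.coeff n (toSeries f) := rfl

theorem ext_cf {f g : 𝒪} (h : ∀ n, cf n f = cf n g) : f = g :=
  toSeries_injective (MvPowerSeries.ext h)

theorem cf_coord_mul (i : Fin 2) (g : 𝒪) (n : Fin 2 →₀ ℕ) :
    cf n (coord i * g) = if 1 ≤ n i then cf (n - Finsupp.single i 1) g else 0 :=
  coeff_coord_mul i g n

theorem cf_add_single_coord_mul (i : Fin 2) (g : 𝒪) (n : Fin 2 →₀ ℕ) :
    cf (n + Finsupp.single i 1) (coord i * g) = cf n g := by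
  rw [cf_coord_mul]
  simp

theorem cf_partialD (i : Fin 2) (g : 𝒪) (n : Fin 2 →₀ ℕ) :
    cf n (partialD i g) = cf (n + Finsupp.single i 1) g * (n i + 1) := by
  rw [cf_apply, toSeries_partialD, MvPowerSeries.coeff_pderiv]
  rfl

/-- Evaluation at the origin, as an algebra homomorphism. -/
noncomputable def evalHom : 𝒪 →ₐ[ℂ] ℂ where
  toRingHom := MvPowerSeries.constantCoeff.comp toSeries.toRingHom
  commutes' c := by
    change MvPowerSeries.constantCoeff (toSeries (algebraMap ℂ 𝒪 c)) = c
    rw [AlgHom.commutes, MvPowerSeries.algebraMap_apply]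
    simp

theorem evalHom_apply (f : 𝒪) : evalHom f = eval₀ f := rfl

theorem cf_zero (f : 𝒪) : cf 0 f = evalHom f := rfl

@[simp]
theorem evalHom_coord (i : Fin 2) : evalHom (coord i) = 0 :=
  MvPowerSeries.constantCoeff_X i

theorem partialD_coord (i j : Fin 2) : partialD i (coord j) = if i = j then 1 else 0 := by
  apply toSeries_injective
  change MvPowerSeries.pderiv ℂ i (MvPowerSeries.X j) = _
  split_ifs with hij
  · subst hij
    simp
  · simp [MvPowerSeries.pderiv_X_of_ne (Ne.symm hij)]

@[simp]
theorem partialD_coord_self (i : Fin 2) : partialD i (coord i) = 1 := by simp [partialD_coord]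

theorem partialD_coord_ne {i j : Fin 2} (h : i ≠ j) : partialD i (coord j) = 0 := by
  simp [partialD_coord, h]

theorem partialD_comm (f : 𝒪) : partialD 0 (partialD 1 f) = partialD 1 (partialD 0 f) := by
  refine ext_cf fun n => ?_
  simp only [cf_partialD, Finsupp.add_apply]
  rw [add_right_comm]
  simp
  ring

theorem derivation_apply (δ : Derivation ℂ 𝒪 𝒪) (f : 𝒪) :
    δ f = δ (coord 0) * partialD 0 f + δ (coord 1) * partialD 1 f := by
  conv_lhs => rw [derivation_eq δ]
  simp

theorem coord_ne_zero (i : Fin 2) : coord i ≠ 0 := by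
  intro h
  have := partialD_coord_self i
  rw [h, map_zero] at this
  exact zero_ne_one this

/-- The maximal ideal of `𝒪`. -/
noncomputable def 𝔪 : Ideal 𝒪 := RingHom.ker evalHom

theorem mem_𝔪 {f : 𝒪} : f ∈ 𝔪 ↔ evalHom f = 0 := Iff.rfl

theorem coord_mem (i : Fin 2) : coord i ∈ 𝔪 := evalHom_coord i

theorem sub_algebraMap_mem (f : 𝒪) : f - algebraMap ℂ 𝒪 (evalHom f) ∈ 𝔪 := by
  rw [mem_𝔪, map_sub, AlgHom.commutes]
  exact sub_self _

theorem 𝔪_eq_span : 𝔪 = Ideal.span {coord 0, coord 1} := by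
  apply le_antisymm
  · intro f hf
    obtain ⟨c, f₁, f₂, rfl⟩ := exists_decomp f
    have hc : c = 0 := by simpa [mem_𝔪] using hf
    subst hc
    rw [Ideal.mem_span_pair]
    exact ⟨f₁, f₂, by rw [map_zero]; ring⟩
  · rw [Ideal.span_le]
    rintro _ (rfl | rfl)
    · exact coord_mem 0
    · exact coord_mem 1

/-- The ideal of the series without terms of degree less than `k`. -/
noncomputable def ordIdeal (k : ℕ) : Ideal 𝒪 where
  carrier := {f | ∀ n : Fin 2 →₀ ℕ, n.degree < k → cf n f = 0}
  add_mem' hf hg n hn := by rw [map_add, hf n hn, hg n hn, add_zero]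
  zero_mem' n _ := map_zero _
  smul_mem' a f hf n hn := by
    classical
    rw [smul_eq_mul, cf_apply, map_mul, MvPowerSeries.coeff_mul]
    refine Finset.sum_eq_zero fun p hp => ?_
    rw [← cf_apply p.2, hf p.2, mul_zero]
    have := congrArg Finsupp.degree (Finset.HasAntidiagonal.mem_antidiagonal.mp hp)
    rw [map_add] at this
    omega

theorem mem_ordIdeal {k : ℕ} {f : 𝒪} :
    f ∈ ordIdeal k ↔ ∀ n : Fin 2 →₀ ℕ, n.degree < k → cf n f = 0 := Iff.rfl

theorem coord_mul_mem_ordIdeal {k : ℕ} {f : 𝒪} (hf : f ∈ ordIdeal k) (i : Fin 2) :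
    coord i * f ∈ ordIdeal (k + 1) := by
  intro n hn
  rw [cf_coord_mul]
  split_ifs with h
  · apply hf
    have hd := congrArg Finsupp.degree
      (tsub_add_cancel_of_le (Finsupp.single_le_iff.mpr h) :
        n - Finsupp.single i 1 + Finsupp.single i 1 = n)
    rw [map_add, Finsupp.degree_single] at hd
    omega
  · rfl

theorem 𝔪_pow_le_ordIdeal (k : ℕ) : 𝔪 ^ k ≤ ordIdeal k := by
  induction k with
  | zero => intro f _ n hn; omega
  | succ k ih =>
    rw [pow_succ', 𝔪_eq_span, ← 𝔪_eq_span, Ideal.mul_le]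
    intro a ha b hb
    rw [𝔪_eq_span, Ideal.mem_span_pair] at ha
    obtain ⟨c, d, rfl⟩ := ha
    have e : (c * coord 0 + d * coord 1) * b = coord 0 * (c * b) + coord 1 * (d * b) := by ring
    rw [e]
    exact add_mem (coord_mul_mem_ordIdeal (Ideal.mul_mem_left _ _ (ih hb)) 0)
      (coord_mul_mem_ordIdeal (Ideal.mul_mem_left _ _ (ih hb)) 1)

/-- Taylor expansion in arbitrary generators of the maximal ideal: remove the constant term, write
the rest as `a u + b v`, and expand `a` and `b` to one order less. -/
theorem exists_aeval_sub_mem_of_eq_span {u v : 𝒪} (h : 𝔪 = Ideal.span {u, v}) (k : ℕ) (f : 𝒪) :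
    ∃ p : MvPolynomial (Fin 2) ℂ, f - MvPolynomial.aeval ![u, v] p ∈ 𝔪 ^ k := by
  induction k generalizing f with
  | zero => exact ⟨0, by simp⟩
  | succ k ih =>
    have h1 := sub_algebraMap_mem f
    rw [h, Ideal.mem_span_pair] at h1
    obtain ⟨a, b, hab⟩ := h1
    obtain ⟨p, hp⟩ := ih a
    obtain ⟨q, hq⟩ := ih b
    refine ⟨MvPolynomial.C (evalHom f) + p * MvPolynomial.X 0 + q * MvPolynomial.X 1, ?_⟩
    have hu : u ∈ 𝔪 := by rw [h]; exact Ideal.subset_span (by simp)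
    have hv : v ∈ 𝔪 := by rw [h]; exact Ideal.subset_span (by simp)
    have e : f - MvPolynomial.aeval ![u, v]
        (MvPolynomial.C (evalHom f) + p * MvPolynomial.X 0 + q * MvPolynomial.X 1) =
        (a - MvPolynomial.aeval ![u, v] p) * u + (b - MvPolynomial.aeval ![u, v] q) * v := by
      simp only [map_add, map_mul, MvPolynomial.aeval_X, MvPolynomial.aeval_C, Matrix.cons_val_zero,
        Matrix.cons_val_one]
      linear_combination -hab
    rw [e, pow_succ]
    exact add_mem (Ideal.mul_mem_mul hp hu) (Ideal.mul_mem_mul hq hv)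

theorem toSeries_aeval_coord (p : MvPolynomial (Fin 2) ℂ) :
    toSeries (MvPolynomial.aeval ![coord 0, coord 1] p) = (p : MvPowerSeries (Fin 2) ℂ) := by
  induction p using MvPolynomial.induction_on with
  | C a => rw [MvPolynomial.aeval_C]; simp [MvPowerSeries.algebraMap_apply]
  | add p q hp hq => rw [map_add, map_add, hp, hq]; simp
  | mul_X p i hp =>
    rw [map_mul, map_mul, hp, MvPolynomial.aeval_X]
    fin_cases i
    · simp only [MvPolynomial.coe_mul, MvPolynomial.coe_X]; rfl
    · simp only [MvPolynomial.coe_mul, MvPolynomial.coe_X]; rfl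

theorem cf_aeval_coord (n : Fin 2 →₀ ℕ) (p : MvPolynomial (Fin 2) ℂ) :
    cf n (MvPolynomial.aeval ![coord 0, coord 1] p) = p.coeff n := by
  rw [cf_apply, toSeries_aeval_coord, MvPolynomial.coeff_coe]

/-- Modulo `𝔪 ^ k` a series is a polynomial in the coordinates, and the vanishing of its low
coefficients leaves only monomials of degree at least `k`. -/
theorem ordIdeal_eq (k : ℕ) : ordIdeal k = 𝔪 ^ k := by
  refine le_antisymm (fun f hf => ?_) (𝔪_pow_le_ordIdeal k)
  obtain ⟨p, hp⟩ := exists_aeval_sub_mem_of_eq_span 𝔪_eq_span k f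
  rw [← sub_add_cancel f (MvPolynomial.aeval ![coord 0, coord 1] p)]
  refine add_mem hp ?_
  rw [p.as_sum, map_sum]
  refine sum_mem fun n hn => ?_
  rw [MvPolynomial.aeval_monomial]
  refine Ideal.mul_mem_left _ _ ?_
  have hnk : k ≤ n.degree := by
    by_contra hlt
    have h1 := 𝔪_pow_le_ordIdeal k hp n (not_le.mp hlt)
    rw [map_sub, hf n (not_le.mp hlt), cf_aeval_coord, zero_sub, neg_eq_zero] at h1
    exact (MvPolynomial.mem_support_iff.mp hn) h1
  refine Ideal.pow_le_pow_right hnk ?_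
  rw [Finsupp.prod_fintype _ _ (by simp), Fin.prod_univ_two, degree_eq, pow_add]
  exact Ideal.mul_mem_mul (Ideal.pow_mem_pow (coord_mem 0) _) (Ideal.pow_mem_pow (coord_mem 1) _)

theorem mem_𝔪_pow {k : ℕ} {f : 𝒪} :
    f ∈ 𝔪 ^ k ↔ ∀ n : Fin 2 →₀ ℕ, n.degree < k → cf n f = 0 := by
  rw [← ordIdeal_eq, mem_ordIdeal]

theorem eq_zero_of_forall_mem {f : 𝒪} (K : ℕ) (h : ∀ k, K ≤ k → f ∈ 𝔪 ^ k) : f = 0 := by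
  refine ext_cf fun n => ?_
  rw [map_zero]
  exact mem_𝔪_pow.mp (h (max K (n.degree + 1)) (le_max_left _ _)) n
    (lt_of_lt_of_le (Nat.lt_succ_self _) (le_max_right _ _))

theorem partialD_mem {k : ℕ} {f : 𝒪} (hf : f ∈ 𝔪 ^ (k + 1)) (i : Fin 2) :
    partialD i f ∈ 𝔪 ^ k := by
  rw [mem_𝔪_pow] at hf ⊢
  intro n hn
  rw [cf_partialD, hf _ (by rw [map_add, Finsupp.degree_single]; omega), zero_mul]

theorem derivation_mem {k l : ℕ} {δ : Derivation ℂ 𝒪 𝒪} (hδ : ∀ i, δ (coord i) ∈ 𝔪 ^ l) {f : 𝒪}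
    (hf : f ∈ 𝔪 ^ (k + 1)) : δ f ∈ 𝔪 ^ (l + k) := by
  rw [derivation_apply, pow_add]
  exact add_mem (Ideal.mul_mem_mul (hδ 0) (partialD_mem hf 0))
    (Ideal.mul_mem_mul (hδ 1) (partialD_mem hf 1))

theorem derivation_mem_pow {k : ℕ} {δ : Derivation ℂ 𝒪 𝒪} (hδ : ∀ i, δ (coord i) ∈ 𝔪) {f : 𝒪}
    (hf : f ∈ 𝔪 ^ k) : δ f ∈ 𝔪 ^ k := by
  cases k with
  | zero => simp
  | succ k =>
    rw [add_comm]
    exact derivation_mem (l := 1) (by simpa using hδ) hf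

/-- Shrinking the polydisc by a factor `t ≤ 1` scales each term of degree at least `k` by at most `t
^ k`. This makes terms of higher order small compared with the radius. -/
theorem exists_wnorm_le {f : 𝒪} {k : ℕ} (hf : f ∈ 𝔪 ^ k) : ∃ C r₀ : ℝ≥0, 0 < r₀ ∧
    ∀ r : ℝ≥0, r ≤ r₀ → wnorm (fun _ => r) (toSeries f) ≤ C * (r : ℝ≥0∞) ^ k := by
  obtain ⟨r₀, hr₀, h⟩ := (isConvergent_iff _).mp (isConvergent_toSeries f)
  refine ⟨(wnorm (fun _ => r₀) (toSeries f)).toNNReal * r₀⁻¹ ^ k, r₀, hr₀, fun r hr => ?_⟩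
  have h1 := wnorm_scale_le (f := toSeries f) (t := r * r₀⁻¹) (by
    rw [← div_eq_mul_inv]; exact div_le_one_of_le₀ hr (zero_le)) (fun _ => r₀)
    (mem_𝔪_pow.mp hf)
  rw [inv_mul_cancel_right₀ hr₀.ne'] at h1
  refine h1.trans (le_of_eq ?_)
  rw [ENNReal.coe_mul, ENNReal.coe_mul, ENNReal.coe_toNNReal h, ENNReal.coe_pow, mul_pow]
  ring

/-- After scaling, `f` is `1 - v` with `v ∈ 𝔪`. On a small polydisc multiplication by `v` halves the
norm, so the geometric series of `v` converges. -/
theorem isUnit_iff {f : 𝒪} : IsUnit f ↔ evalHom f ≠ 0 := by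
  refine ⟨fun h => (h.map evalHom).ne_zero, fun h => ?_⟩
  set c := evalHom f with hc
  set v : 𝒪 := 1 - c⁻¹ • f with hv
  have hv𝔪 : v ∈ 𝔪 ^ 1 := by
    rw [pow_one, mem_𝔪, hv, map_sub, map_one, map_smul, ← hc, smul_eq_mul, inv_mul_cancel₀ h,
      sub_self]
  obtain ⟨C, r₀, hr₀, hC⟩ := exists_wnorm_le hv𝔪
  set r := min r₀ ((2 * (C + 1))⁻¹) with hr
  have hrpos : 0 < r := lt_min hr₀ (by positivity)
  have hle : wnorm (fun _ => r) (toSeries v) ≤ 2⁻¹ := by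
    refine (hC r (min_le_left _ _)).trans ?_
    rw [pow_one, ← ENNReal.coe_mul, ← ENNReal.coe_two, ← ENNReal.coe_inv two_ne_zero,
      ENNReal.coe_le_coe]
    calc C * r ≤ (C + 1) * (2 * (C + 1))⁻¹ := by
          gcongr
          · exact le_add_of_nonneg_right zero_le_one
          · exact min_le_right _ _
      _ = 2⁻¹ := by field_simp
  obtain ⟨q, hq, hq'⟩ := exists_fixed_point (ρ := fun _ => r) (fun _ => hrpos)
    (LinearMap.mulLeft ℂ (toSeries v)) (fun g => by
      refine (wnorm_mul_le _ _ _).trans ?_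
      gcongr) (h := 1) (by
        obtain ⟨s, hs⟩ : ∃ s : ℝ≥0∞, s = wnorm (fun _ => r) 1 := ⟨_, rfl⟩
        rw [wnorm, tsum_eq_single 0 (fun n hn => by simp [MvPowerSeries.coeff_one, hn])]
        simp [wt])
  have h1 : v * mk q (.of_wnorm (fun _ => hrpos) hq) + 1 = mk q (.of_wnorm (fun _ => hrpos) hq) :=
    toSeries_injective (by
      rw [map_add, map_mul, map_one, toSeries_mk, add_comm]
      exact hq'.symm)
  refine IsUnit.of_mul_eq_one (c⁻¹ • mk q (.of_wnorm (fun _ => hrpos) hq)) ?_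
  have h2 : f = c • (1 - v) := by rw [hv, sub_sub_cancel, smul_smul, mul_inv_cancel₀ h, one_smul]
  rw [h2, smul_mul_smul_comm, mul_inv_cancel₀ h, one_smul, sub_mul, one_mul, sub_eq_iff_eq_add,
    add_comm]
  exact h1.symm

instance : IsLocalRing 𝒪 := by
  refine IsLocalRing.of_nonunits_add fun a b ha hb => ?_
  rw [mem_nonunits_iff, isUnit_iff, not_not] at *
  rw [map_add, ha, hb, add_zero]

theorem maximalIdeal_eq : IsLocalRing.maximalIdeal 𝒪 = 𝔪 := by
  ext f
  rw [IsLocalRing.mem_maximalIdeal, mem_nonunits_iff, isUnit_iff, not_not, mem_𝔪]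

theorem 𝔪_pow_fg (k : ℕ) : (𝔪 ^ k).FG := by
  refine Ideal.FG.pow ?_
  rw [𝔪_eq_span]
  exact Submodule.fg_span (Set.toFinite _)

/-- Nakayama's lemma for the powers of the maximal ideal. -/
theorem 𝔪_pow_le_of_le_sup {k : ℕ} {J : Ideal 𝒪} (h : 𝔪 ^ k ≤ J ⊔ 𝔪 ^ (k + 1)) : 𝔪 ^ k ≤ J := by
  refine Submodule.le_of_le_smul_of_le_jacobson_bot (I := 𝔪) (𝔪_pow_fg k) ?_ ?_
  · rw [IsLocalRing.jacobson_eq_maximalIdeal ⊥ bot_ne_top, maximalIdeal_eq]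
  · rwa [smul_eq_mul, ← pow_succ']

/-! ### Weierstrass preparation -/

/-- Drop the terms not divisible by the coordinate `i` and divide by it. -/
noncomputable def shiftO (i : Fin 2) (f : 𝒪) : 𝒪 :=
  mk (shift i (toSeries f)) ((isConvergent_toSeries f).shift i fun _ => Or.inl rfl)

@[simp]
theorem cf_shiftO (i : Fin 2) (f : 𝒪) (n : Fin 2 →₀ ℕ) :
    cf n (shiftO i f) = cf (n + Finsupp.single i 1) f := rfl

theorem cf_sub_coord_mul_shiftO (i : Fin 2) (f : 𝒪) (n : Fin 2 →₀ ℕ) :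
    cf n (f - coord i * shiftO i f) = if n i = 0 then cf n f else 0 := by
  rw [map_sub, cf_coord_mul]
  split_ifs with h1 h2
  · omega
  · rw [cf_shiftO, tsub_add_cancel_of_le (Finsupp.single_le_iff.mpr h1), sub_self]
  · rw [sub_zero]
  · omega

theorem coord_dvd_iff (i : Fin 2) (f : 𝒪) :
    coord i ∣ f ↔ ∀ n : Fin 2 →₀ ℕ, n i = 0 → cf n f = 0 := by
  constructor
  · rintro ⟨g, rfl⟩ n hn
    rw [cf_coord_mul, if_neg (by omega)]
  · intro h
    refine ⟨shiftO i f, sub_eq_zero.mp (ext_cf fun n => ?_)⟩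
    rw [cf_sub_coord_mul_shiftO, map_zero]
    split_ifs with hn
    · exact h n hn
    · rfl

theorem wnorm_X (ρ : Fin 2 → ℝ≥0) (i : Fin 2) :
    wnorm ρ (MvPowerSeries.X i) = ρ i := by
  classical
  rw [wnorm, tsum_eq_single (Finsupp.single i 1) (fun n hn => by simp [MvPowerSeries.coeff_X, hn])]
  simp [MvPowerSeries.coeff_X, wt_single]

theorem wnorm_one (ρ : Fin 2 → ℝ≥0) : wnorm ρ 1 = 1 := by
  classical
  rw [wnorm, tsum_eq_single 0 (fun n hn => by simp [MvPowerSeries.coeff_one, hn])]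
  simp [wt]

theorem wnorm_shift_pow_le (ρ : Fin 2 → ℝ≥0) (i : Fin 2) (d : ℕ) (f : MvPowerSeries (Fin 2) ℂ) :
    wnorm ρ ((shift i ^ d) f) * (ρ i : ℝ≥0∞) ^ d ≤ wnorm ρ f := by
  induction d generalizing f with
  | zero => simp
  | succ d ih =>
    rw [pow_succ (shift i), Module.End.mul_apply, pow_succ, ← mul_assoc]
    exact (mul_le_mul_left (ih _) _).trans (wnorm_shift_le ρ i f)

theorem coeff_shift_pow (i : Fin 2) (d : ℕ) (f : MvPowerSeries (Fin 2) ℂ) (n : Fin 2 →₀ ℕ) :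
    MvPowerSeries.coeff n ((shift i ^ d) f) = MvPowerSeries.coeff (n + Finsupp.single i d) f := by
  induction d generalizing n with
  | zero => simp
  | succ d ih =>
    rw [pow_succ', Module.End.mul_apply, coeff_shift, ih, add_assoc, ← Finsupp.single_add,
      add_comm 1 d]

theorem coeff_X_pow_mul_add (i : Fin 2) (d : ℕ) (f : MvPowerSeries (Fin 2) ℂ) (n : Fin 2 →₀ ℕ) :
    MvPowerSeries.coeff (n + Finsupp.single i d) (MvPowerSeries.X i ^ d * f) =
      MvPowerSeries.coeff n f := by
  rw [MvPowerSeries.X_pow_eq, add_comm n, MvPowerSeries.coeff_add_monomial_mul, one_mul]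

theorem iterate_shiftO (i : Fin 2) (d : ℕ) (f : 𝒪) :
    toSeries ((shiftO i)^[d] f) = (shift i ^ d) (toSeries f) := by
  induction d with
  | zero => rfl
  | succ d ih =>
    rw [Function.iterate_succ_apply', pow_succ', Module.End.mul_apply, ← ih]
    rfl

theorem cf_iterate_shiftO (i : Fin 2) (d : ℕ) (f : 𝒪) (n : Fin 2 →₀ ℕ) :
    cf n ((shiftO i)^[d] f) = cf (n + Finsupp.single i d) f := by
  rw [cf_apply, iterate_shiftO, coeff_shift_pow, cf_apply]

theorem toSeries_coord (i : Fin 2) : toSeries (coord i) = MvPowerSeries.X i := rfl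

theorem cf_coord_pow_mul_add (i : Fin 2) (d : ℕ) (f : 𝒪) (n : Fin 2 →₀ ℕ) :
    cf (n + Finsupp.single i d) (coord i ^ d * f) = cf n f := by
  rw [cf_apply, map_mul, map_pow, toSeries_coord, coeff_X_pow_mul_add, cf_apply]

theorem cf_coord_pow_mul (i : Fin 2) (d : ℕ) (f : 𝒪) (n : Fin 2 →₀ ℕ) (hn : n i < d) :
    cf n (coord i ^ d * f) = 0 := by
  induction d generalizing n with
  | zero => omega
  | succ d ih =>
    rw [pow_succ', mul_assoc, cf_coord_mul]
    split_ifs with h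
    · exact ih _ (by simp; omega)
    · rfl

/-- A series `g` with `g(0, y)` of order `d`: it is `x L + y ^ d U` with `U` a unit, and
`q g = y ^ d - r` for a unit `q` and some `r` divisible by `x`, of degree less than `d` in `y`. -/
theorem weierstrass {g : 𝒪} {d : ℕ} (h0 : ∀ j < d, cf (Finsupp.single 1 j) g = 0)
    (hd : cf (Finsupp.single 1 d) g ≠ 0) :
    (∃ L U : 𝒪, IsUnit U ∧ g = coord 0 * L + coord 1 ^ d * U) ∧
    ∃ q r : 𝒪, IsUnit q ∧ q * g = coord 1 ^ d - r ∧ coord 0 ∣ r ∧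
      ∀ n : Fin 2 →₀ ℕ, d ≤ n 1 → cf n r = 0 := by
  set U := (shiftO 1)^[d] g with hU
  have hUu : IsUnit U := by
    rw [isUnit_iff, ← cf_zero, hU, cf_iterate_shiftO, zero_add]
    exact hd
  have hlow : coord 0 ∣ g - coord 1 ^ d * U := by
    rw [coord_dvd_iff]
    intro n hn
    rw [map_sub]
    by_cases hnd : n 1 < d
    · rw [cf_coord_pow_mul _ _ _ _ hnd, sub_zero]
      have : n = Finsupp.single 1 (n 1) := by
        ext i
        fin_cases i <;> simp [hn]
      rw [this]
      exact h0 _ hnd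
    · have : n = (n - Finsupp.single 1 d) + Finsupp.single 1 d :=
        (tsub_add_cancel_of_le (Finsupp.single_le_iff.mpr (not_lt.mp hnd))).symm
      rw [this, cf_coord_pow_mul_add, hU, cf_iterate_shiftO, sub_self]
  obtain ⟨L, hL⟩ := hlow
  have hg : g = coord 0 * L + coord 1 ^ d * U := by rw [← hL]; ring
  refine ⟨⟨L, U, hUu, hg⟩, ?_⟩
  obtain ⟨V, hV⟩ := hUu.exists_right_inv
  obtain ⟨s₁, hs₁, hL₁⟩ := (isConvergent_iff _).mp (isConvergent_toSeries L)
  obtain ⟨s₂, hs₂, hV₂⟩ := (isConvergent_iff _).mp (isConvergent_toSeries V)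
  set s := min s₁ s₂ with hs
  have hspos : 0 < s := lt_min hs₁ hs₂
  set N₁ := (wnorm (fun _ => s₁) (toSeries L)).toNNReal with hN₁
  set N₂ := (wnorm (fun _ => s₂) (toSeries V)).toNNReal with hN₂
  set c : ℝ≥0 := N₂ * (s ^ d)⁻¹ * N₁ with hc
  set r := min s ((2 * (c + 1))⁻¹) with hr
  have hrpos : 0 < r := lt_min hspos (by positivity)
  -- Removing `y ^ d` costs the factor `s⁻ᵈ`, which is fixed once `s` is. The factor `x` in `x L`
  -- compensates for it if the radius `r` of `x` is small enough.
  set ρ : Fin 2 → ℝ≥0 := ![r, s] with hρ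
  have hρpos : ∀ i, 0 < ρ i := by
    intro i
    fin_cases i
    · exact hrpos
    · exact hspos
  have hρs : ∀ i, ρ i ≤ s := by
    intro i
    fin_cases i
    · exact min_le_left _ _
    · exact le_rfl
  have hLρ : wnorm ρ (toSeries L) ≤ N₁ := by
    rw [hN₁, ENNReal.coe_toNNReal hL₁]
    exact wnorm_mono (fun i => (hρs i).trans (min_le_left _ _)) _
  have hVρ : wnorm ρ (toSeries V) ≤ N₂ := by
    rw [hN₂, ENNReal.coe_toNNReal hV₂]
    exact wnorm_mono (fun i => (hρs i).trans (min_le_right _ _)) _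
  -- The requirement is that the quotient of `q g` by `y ^ d`, after dropping the terms of lower
  -- degree in `y`, equals `1`. With `V` the inverse of `U` this reads `q = V - V T(x L q)`, where
  -- `T` is the `d`-fold shift.
  let Λ : MvPowerSeries (Fin 2) ℂ →ₗ[ℂ] MvPowerSeries (Fin 2) ℂ :=
    -(LinearMap.mulLeft ℂ (toSeries V) ∘ₗ (shift 1 ^ d) ∘ₗ
      LinearMap.mulLeft ℂ (toSeries (coord 0 * L)))
  have hΛ : ∀ h, wnorm ρ (Λ h) ≤ 2⁻¹ * wnorm ρ h := by
    intro h
    have e : Λ h = -(toSeries V * (shift 1 ^ d) (toSeries (coord 0 * L) * h)) := rfl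
    rw [e, wnorm_neg]
    refine (wnorm_mul_le _ _ _).trans ?_
    have h1 : wnorm ρ ((shift 1 ^ d) (toSeries (coord 0 * L) * h)) ≤
        ((s ^ d)⁻¹ : ℝ≥0) * (r * N₁ * wnorm ρ h) := by
      have h2 := (wnorm_shift_pow_le ρ 1 d (toSeries (coord 0 * L) * h)).trans
        (wnorm_mul_le _ _ _)
      have h3 : wnorm ρ (toSeries (coord 0 * L)) ≤ r * N₁ := by
        rw [map_mul, toSeries_coord]
        refine (wnorm_mul_le _ _ _).trans ?_
        rw [wnorm_X]
        gcongr
        exact le_rfl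
      rw [ENNReal.coe_inv (by positivity), ← ENNReal.mul_le_iff_le_inv (by simp [hspos.ne'])
        (by simp), mul_comm, ENNReal.coe_pow]
      exact h2.trans (by gcongr)
    calc _ ≤ (N₂ : ℝ≥0∞) * (((s ^ d)⁻¹ : ℝ≥0) * (r * N₁ * wnorm ρ h)) := by gcongr
      _ = ((r * c : ℝ≥0) : ℝ≥0∞) * wnorm ρ h := by
        rw [hc]; push_cast; ring
      _ ≤ 2⁻¹ * wnorm ρ h := by
        gcongr
        rw [← ENNReal.coe_two, ← ENNReal.coe_inv two_ne_zero, ENNReal.coe_le_coe]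
        calc r * c ≤ (2 * (c + 1))⁻¹ * (c + 1) := by
              gcongr
              · exact min_le_right _ _
              · exact le_add_of_nonneg_right zero_le_one
          _ = 2⁻¹ := by field_simp
  obtain ⟨q₀, hq₀, hq⟩ := exists_fixed_point hρpos Λ hΛ
    (ne_top_of_le_ne_top ENNReal.coe_ne_top hVρ)
  set q := mk q₀ (.of_wnorm hρpos hq₀) with hqdef
  have hq1 : q = V - V * (shiftO 1)^[d] (coord 0 * L * q) := by
    apply toSeries_injective
    rw [map_sub, map_mul, iterate_shiftO, map_mul _ (coord 0 * L) q, hqdef, toSeries_mk,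
      sub_eq_add_neg]
    exact hq
  have hq2 : U * q = 1 - (shiftO 1)^[d] (coord 0 * L * q) := by
    conv_lhs => rw [hq1]
    rw [mul_sub, ← mul_assoc, hV, one_mul]
  have hcf : ∀ n, cf (n + Finsupp.single 1 d) (q * g) = cf n 1 := by
    intro n
    have e : q * g = coord 0 * L * q + coord 1 ^ d * (U * q) := by rw [hg]; ring
    rw [e, map_add, cf_coord_pow_mul_add, hq2, map_sub, cf_iterate_shiftO]
    ring
  refine ⟨q, coord 1 ^ d - q * g, ?_, by ring, ?_, ?_⟩
  · have h5 : IsUnit (U * q) := by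
      rw [isUnit_iff, hq2, map_sub, map_one, ← cf_zero, cf_iterate_shiftO, zero_add,
        mul_assoc, cf_coord_mul, if_neg (by simp), sub_zero]
      exact one_ne_zero
    exact isUnit_of_mul_isUnit_right h5
  · have h6 : coord 1 ^ d - q * g = coord 0 * (-(L * q)) + coord 1 ^ d * (1 - U * q) := by
      rw [hg]; ring
    rw [h6]
    refine dvd_add (dvd_mul_right _ _) (Dvd.dvd.mul_left ?_ _)
    rw [hq2, sub_sub_cancel, coord_dvd_iff]
    intro n hn
    rw [cf_iterate_shiftO, mul_assoc, cf_coord_mul, if_neg (by simp [hn])]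
  · intro n hn
    have : n = (n - Finsupp.single 1 d) + Finsupp.single 1 d :=
      (tsub_add_cancel_of_le (Finsupp.single_le_iff.mpr hn)).symm
    rw [this, map_sub, hcf]
    nth_rewrite 1 [← mul_one (coord 1 ^ d)]
    rw [cf_coord_pow_mul_add, sub_self]

/-! ### The subring of the series in `x` -/

/-- The ring of convergent power series that do not depend on `y`. -/
noncomputable def seriesX : Subalgebra ℂ 𝒪 where
  carrier := {f | partialD 1 f = 0}
  add_mem' {a b} ha hb := by
    rw [Set.mem_ofPred_eq] at *
    rw [map_add, ha, hb, add_zero]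
  mul_mem' {a b} ha hb := by
    rw [Set.mem_ofPred_eq] at *
    rw [Derivation.leibniz, ha, hb, smul_zero, smul_zero, add_zero]
  algebraMap_mem' c := Derivation.map_algebraMap _ c

theorem mem_seriesX {f : 𝒪} : f ∈ seriesX ↔ partialD 1 f = 0 := Iff.rfl

theorem mem_seriesX_iff {f : 𝒪} : f ∈ seriesX ↔ ∀ n : Fin 2 →₀ ℕ, n 1 ≠ 0 → cf n f = 0 := by
  rw [mem_seriesX]
  constructor
  · intro h n hn
    have h1 : n - Finsupp.single 1 1 + Finsupp.single 1 1 = n :=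
      tsub_add_cancel_of_le (Finsupp.single_le_iff.mpr (Nat.one_le_iff_ne_zero.mpr hn))
    have h2 := cf_partialD 1 f (n - Finsupp.single 1 1)
    rw [h, h1, map_zero] at h2
    refine (mul_eq_zero.mp h2.symm).resolve_right ?_
    exact Nat.cast_add_one_ne_zero _
  · intro h
    refine ext_cf fun n => ?_
    rw [cf_partialD, h _ (by simp), zero_mul, map_zero]

theorem coord_zero_mem_seriesX : coord 0 ∈ seriesX := partialD_coord_ne (by decide)

/-- The coordinate `x`, as an element of the ring of series in `x`. -/
noncomputable def xX : seriesX := ⟨coord 0, coord_zero_mem_seriesX⟩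

theorem seriesX_isUnit {f : seriesX} (hf : evalHom (f : 𝒪) ≠ 0) : IsUnit f := by
  obtain ⟨g, hg⟩ := (isUnit_iff.mpr hf).exists_right_inv
  have h1 := congrArg (partialD 1) hg
  rw [Derivation.leibniz, mem_seriesX.mp f.2, smul_zero, add_zero, Derivation.map_one_eq_zero,
    smul_eq_mul] at h1
  have hf0 : (f : 𝒪) ≠ 0 := fun h => hf (by rw [h, map_zero])
  exact IsUnit.of_mul_eq_one ⟨g, (mul_eq_zero.mp h1).resolve_left hf0⟩ (Subtype.ext hg)

theorem xX_dvd {f : seriesX} (hf : evalHom (f : 𝒪) = 0) : xX ∣ f := by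
  have h1 : coord 0 ∣ (f : 𝒪) := by
    rw [coord_dvd_iff]
    intro n hn
    by_cases h : n 1 = 0
    · have : n = 0 := by ext i; fin_cases i <;> simp [hn, h]
      rw [this, cf_zero, hf]
    · exact mem_seriesX_iff.mp f.2 n h
  obtain ⟨g, hg⟩ := h1
  have h2 := mem_seriesX.mp f.2
  rw [hg, Derivation.leibniz, mem_seriesX.mp coord_zero_mem_seriesX, smul_zero, add_zero,
    smul_eq_mul] at h2
  exact ⟨⟨g, (mul_eq_zero.mp h2).resolve_left (coord_ne_zero 0)⟩, Subtype.ext hg⟩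

theorem xX_irreducible : Irreducible xX := by
  have hcf : cf (Finsupp.single 0 1) (coord 0) = 1 := by
    have := cf_add_single_coord_mul 0 1 0
    rw [zero_add, mul_one, cf_zero, map_one] at this
    exact this
  constructor
  · intro h
    exact isUnit_iff.mp (h.map seriesX.val) (evalHom_coord 0)
  · intro a b hab
    by_contra! h
    have ha : (a : 𝒪) ∈ 𝔪 := by
      by_contra h'
      exact h.1 (seriesX_isUnit h')
    have hb : (b : 𝒪) ∈ 𝔪 := by
      by_contra h'
      exact h.2 (seriesX_isUnit h')
    have h1 : coord 0 ∈ 𝔪 ^ 2 := by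
      have := congrArg Subtype.val hab
      change coord 0 = (a : 𝒪) * b at this
      rw [this, pow_two]
      exact Ideal.mul_mem_mul ha hb
    have := mem_𝔪_pow.mp h1 (Finsupp.single 0 1) (by simp)
    rw [hcf] at this
    exact one_ne_zero this

theorem exists_eq_xX_pow_mul {f : seriesX} (hf : f ≠ 0) : ∃ n, Associated (xX ^ n) f := by
  have hfin : FiniteMultiplicity xX f := by
    obtain ⟨n, hn⟩ : ∃ n, cf n (f : 𝒪) ≠ 0 := by
      by_contra! h
      exact hf (Subtype.ext (ext_cf fun n => by rw [h n]; simp))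
    refine ⟨n 0, ?_⟩
    rintro ⟨g, hg⟩
    have := congrArg Subtype.val hg
    change (f : 𝒪) = coord 0 ^ (n 0 + 1) * g at this
    rw [this, cf_coord_pow_mul _ _ _ _ (Nat.lt_succ_self _)] at hn
    exact hn rfl
  obtain ⟨c, hc, hxc⟩ := hfin.exists_eq_pow_mul_and_not_dvd
  have hu : IsUnit c := seriesX_isUnit fun h => hxc (xX_dvd h)
  exact ⟨_, hu.unit, hc.symm⟩

instance : IsDiscreteValuationRing seriesX :=
  IsDiscreteValuationRing.ofHasUnitMulPowIrreducibleFactorization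
    ⟨xX, xX_irreducible, exists_eq_xX_pow_mul⟩

/-- A series of degree less than `d` in `y` is a polynomial in `y` over the series in `x`. -/
theorem exists_polynomial {d : ℕ} {f : 𝒪} (hf : ∀ n : Fin 2 →₀ ℕ, d ≤ n 1 → cf n f = 0) :
    ∃ p : Polynomial seriesX, p.degree < d ∧ Polynomial.aeval (coord 1) p = f ∧
      ∀ j, evalHom (p.coeff j : 𝒪) = cf (Finsupp.single 1 j) f := by
  induction d generalizing f with
  | zero =>
    have : f = 0 := ext_cf fun n => by rw [hf n (Nat.zero_le _), map_zero]
    subst this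
    exact ⟨0, by simp, by simp, by simp⟩
  | succ d ih =>
    obtain ⟨p, hp, hp1, hp2⟩ := ih (f := shiftO 1 f) fun n hn => by
      rw [cf_shiftO]
      exact hf _ (by simpa using hn)
    have h0 : f - coord 1 * shiftO 1 f ∈ seriesX := by
      rw [mem_seriesX_iff]
      intro n hn
      rw [cf_sub_coord_mul_shiftO, if_neg hn]
    refine ⟨Polynomial.C ⟨_, h0⟩ + Polynomial.X * p, ?_, ?_, ?_⟩
    · rw [← Polynomial.mem_degreeLT] at hp ⊢
      rw [Polynomial.mem_degreeLT, Polynomial.degree_lt_iff_coeff_zero] at hp ⊢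
      intro m hm
      obtain ⟨m, rfl⟩ : ∃ m', m = m' + 1 := ⟨m - 1, by omega⟩
      rw [Polynomial.coeff_add, Polynomial.coeff_X_mul, hp m (by omega), Polynomial.coeff_C_succ,
        add_zero]
    · rw [map_add, map_mul, Polynomial.aeval_C, Polynomial.aeval_X, hp1]
      change f - coord 1 * shiftO 1 f + coord 1 * shiftO 1 f = f
      ring
    · intro j
      cases j with
      | zero =>
        simp only [Polynomial.coeff_add, Polynomial.coeff_C_zero, Polynomial.mul_coeff_zero,
          Polynomial.coeff_X_zero, zero_mul, add_zero, Finsupp.single_zero, cf_zero]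
        rw [map_sub, map_mul, evalHom_coord, zero_mul, sub_zero]
      | succ j =>
        rw [Polynomial.coeff_add, Polynomial.coeff_X_mul, Polynomial.coeff_C_succ, zero_add, hp2,
          cf_shiftO, ← Finsupp.single_add]

theorem partialD_aeval (p : Polynomial seriesX) :
    partialD 1 (Polynomial.aeval (coord 1) p) =
      Polynomial.aeval (coord 1) (Polynomial.derivative p) := by
  induction p using Polynomial.induction_on' with
  | add p q hp hq => simp only [map_add, hp, hq]
  | monomial n a =>
    rw [Polynomial.aeval_monomial, Polynomial.derivative_monomial, Polynomial.aeval_monomial,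
      Derivation.leibniz, Derivation.leibniz_pow]
    have : partialD 1 (algebraMap seriesX 𝒪 a) = 0 := a.2
    rw [this, smul_zero, add_zero, partialD_coord_self, map_mul, map_natCast]
    simp only [smul_eq_mul, nsmul_eq_mul, mul_one]
    ring

/-- Gauss's lemma: the ring of series in `x` is integrally closed, so a factor over the fraction
field of the monic `W` is a constant times a monic polynomial over the ring. Square-freeness
therefore passes to the fraction field, where it is separability in characteristic zero. -/
theorem separable_map {W : Polynomial seriesX} (hW : W.Monic)
    (hsq : ∀ A : Polynomial seriesX, A.Monic → A * A ∣ W → A = 1) :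
    (W.map (algebraMap seriesX (FractionRing seriesX))).Separable := by
  have : CharZero (FractionRing seriesX) := by
    have : CharZero seriesX :=
      charZero_of_injective_algebraMap (algebraMap ℂ seriesX).injective
    exact charZero_of_injective_algebraMap (IsFractionRing.injective seriesX (FractionRing seriesX))
  rw [PerfectField.separable_iff_squarefree]
  intro a ha
  obtain ⟨A, hA⟩ := IsIntegrallyClosed.eq_map_mul_C_of_dvd (FractionRing seriesX) hW
    ((dvd_mul_right a a).trans ha)
  have ha0 : a ≠ 0 := by
    rintro rfl
    rw [zero_mul, zero_dvd_iff] at ha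
    exact (hW.map _).ne_zero ha
  have hinj := IsFractionRing.injective seriesX (FractionRing seriesX)
  have hlc : a.leadingCoeff ≠ 0 := Polynomial.leadingCoeff_ne_zero.mpr ha0
  have hAm : A.Monic := by
    have h1 := congrArg Polynomial.leadingCoeff hA
    rw [Polynomial.leadingCoeff_mul, Polynomial.leadingCoeff_C,
      Polynomial.leadingCoeff_map_of_injective hinj] at h1
    have h2 := mul_right_cancel₀ hlc (h1.trans (one_mul _).symm)
    exact hinj (h2.trans (map_one _).symm)
  have hdvd : A * A ∣ W := by
    rw [← Polynomial.map_dvd_map _ hinj (hAm.mul hAm), Polynomial.map_mul]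
    refine (mul_dvd_mul ?_ ?_).trans ha <;> exact ⟨_, hA.symm⟩
  rw [hsq A hAm hdvd, Polynomial.map_one, one_mul] at hA
  rw [← hA]
  exact Polynomial.isUnit_C.mpr (isUnit_iff_ne_zero.mpr hlc)

/-- A square-free series which is regular in `y` and its derivative generate an ideal that
contains a power of `x`. -/
theorem exists_coord_pow_mem {g : 𝒪} (hg : Squarefree g) {d : ℕ}
    (h0 : ∀ j < d, cf (Finsupp.single 1 j) g = 0) (hd : cf (Finsupp.single 1 d) g ≠ 0) :
    ∃ k, coord 0 ^ k ∈ Ideal.span {g, partialD 1 g} := by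
  obtain ⟨-, q, r, hq, hqg, hr, hrd⟩ := weierstrass h0 hd
  obtain ⟨p, hp, hpr, hpe⟩ := exists_polynomial hrd
  set W : Polynomial seriesX := Polynomial.X ^ d + -p with hWdef
  have hW : W.Monic := Polynomial.monic_X_pow_add (by rwa [Polynomial.degree_neg])
  have hWg : Polynomial.aeval (coord 1) W = q * g := by
    rw [hWdef, map_add, map_pow, map_neg, Polynomial.aeval_X, hpr, hqg, sub_eq_add_neg]
  let ε : seriesX →+* ℂ := (evalHom.comp seriesX.val).toRingHom
  have hWε : W.map ε = Polynomial.X ^ d := by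
    have hp0 : p.map ε = 0 := by
      ext j
      rw [Polynomial.coeff_map, Polynomial.coeff_zero]
      refine (hpe j).trans ?_
      exact (coord_dvd_iff 0 r).mp hr _ (by simp)
    rw [hWdef, Polynomial.map_add, Polynomial.map_neg, hp0, Polynomial.map_pow, Polynomial.map_X,
      neg_zero, add_zero]
  -- At `x = 0` the polynomial `W` becomes `y ^ d`, so every nontrivial monic factor has the root
  -- `0` there and is a nonunit of `𝒪`. Its square cannot divide the square-free `g`.
  have hsq : ∀ A : Polynomial seriesX, A.Monic → A * A ∣ W → A = 1 := by
    intro A hA hAW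
    by_contra hA1
    have hdeg : (A.map ε).degree ≠ 0 := by
      rw [hA.degree_map]
      intro h
      exact hA1 (hA.degree_le_zero_iff_eq_one.mp h.le)
    obtain ⟨z, hz⟩ := IsAlgClosed.exists_root _ hdeg
    have hz0 : z = 0 := by
      have h1 : (W.map ε).IsRoot z :=
        hz.dvd (Polynomial.map_dvd ε ((dvd_mul_right A A).trans hAW))
      rw [hWε, Polynomial.IsRoot, Polynomial.eval_pow, Polynomial.eval_X] at h1
      exact eq_zero_of_pow_eq_zero h1
    subst hz0
    have hA0 : evalHom (Polynomial.aeval (coord 1) A) = 0 := by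
      rw [Polynomial.IsRoot, ← Polynomial.coeff_zero_eq_eval_zero, Polynomial.coeff_map] at hz
      have h2 := Polynomial.X_mul_divX_add A
      rw [← h2, map_add, map_mul, Polynomial.aeval_X, Polynomial.aeval_C, map_add, map_mul,
        evalHom_coord, zero_mul, zero_add]
      exact hz
    have h3 : Polynomial.aeval (coord 1) A * Polynomial.aeval (coord 1) A ∣ g := by
      rw [← map_mul]
      have h4 := map_dvd (Polynomial.aeval (coord 1)) hAW
      rw [hWg] at h4
      exact (hq.dvd_mul_left).mp h4
    exact isUnit_iff.mp (hg _ h3) hA0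
  obtain ⟨a, b, hab⟩ := separable_map hW hsq
  obtain ⟨s, hs, hsa⟩ := IsLocalization.integerNormalization_spec (nonZeroDivisors seriesX) a
  obtain ⟨t, ht, htb⟩ := IsLocalization.integerNormalization_spec (nonZeroDivisors seriesX) b
  set a' := IsLocalization.integerNormalization (nonZeroDivisors seriesX) a
  set b' := IsLocalization.integerNormalization (nonZeroDivisors seriesX) b
  have hinj := IsFractionRing.injective seriesX (FractionRing seriesX)
  -- The Bézout relation between `W` and its derivative after clearing denominators. Its right side
  -- is a nonzero series in `x`, hence a unit times a power of `x`.
  have key : t • a' * W + s • b' * Polynomial.derivative W = Polynomial.C (s * t) := by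
    apply Polynomial.map_injective _ hinj
    rw [Polynomial.map_add, Polynomial.map_mul, Polynomial.map_mul, Polynomial.map_smul,
      Polynomial.map_smul, hsa, htb, Polynomial.map_C, ← Polynomial.derivative_map]
    rw [← algebraMap_smul (FractionRing seriesX) s a, ← algebraMap_smul (FractionRing seriesX) t b,
      Polynomial.smul_eq_C_mul, Polynomial.smul_eq_C_mul, Polynomial.smul_eq_C_mul,
      Polynomial.smul_eq_C_mul, map_mul, Polynomial.C_mul]
    linear_combination (Polynomial.C (algebraMap seriesX (FractionRing seriesX) s) *
      Polynomial.C (algebraMap seriesX (FractionRing seriesX) t)) * hab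
  have hst : s * t ≠ 0 := mul_ne_zero (nonZeroDivisors.ne_zero hs) (nonZeroDivisors.ne_zero ht)
  obtain ⟨k, u, hu⟩ := exists_eq_xX_pow_mul hst
  refine ⟨k, ?_⟩
  have h5 := congrArg (Polynomial.aeval (coord 1)) key
  rw [map_add, map_mul, map_mul, ← partialD_aeval, hWg, Polynomial.aeval_C, ← hu,
    map_mul (algebraMap seriesX 𝒪), map_pow, Derivation.leibniz] at h5
  change _ = coord 0 ^ k * _ at h5
  rw [← Ideal.unit_mul_mem_iff_mem _ (u.isUnit.map (algebraMap seriesX 𝒪)), mul_comm, ← h5,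
    Ideal.mem_span_pair]
  refine ⟨Polynomial.aeval (coord 1) (t • a') * q + Polynomial.aeval (coord 1) (s • b') *
    partialD 1 q, Polynomial.aeval (coord 1) (s • b') * q, ?_⟩
  simp only [smul_eq_mul]
  ring

/-- The Tjurina ideal `(f, ∂f/∂x, ∂f/∂y)`. -/
noncomputable def tjurina (f : 𝒪) : Ideal 𝒪 := Ideal.span {f, partialD 0 f, partialD 1 f}

theorem self_mem_tjurina (f : 𝒪) : f ∈ tjurina f := Ideal.subset_span (by simp)

theorem partialD_mem_tjurina (f : 𝒪) (i : Fin 2) : partialD i f ∈ tjurina f := by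
  fin_cases i <;> exact Ideal.subset_span (by simp)

/-! ### Finite colength of the Tjurina ideal -/

theorem exists_regular {g : 𝒪} (hg : ¬ coord 0 ∣ g) : ∃ d, (∀ j < d, cf (Finsupp.single 1 j) g = 0) ∧
    cf (Finsupp.single 1 d) g ≠ 0 := by
  classical
  have h : ∃ d, cf (Finsupp.single 1 d) g ≠ 0 := by
    rw [coord_dvd_iff] at hg
    push Not at hg
    obtain ⟨n, hn, hng⟩ := hg
    refine ⟨n 1, ?_⟩
    have : n = Finsupp.single 1 (n 1) := by
      ext i
      fin_cases i <;> simp [hn]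
    rwa [← this]
  exact ⟨Nat.find h, fun j hj => not_not.mp (Nat.find_min h hj), Nat.find_spec h⟩

/-- If `x` does not divide `f`, then `f` is regular in `y`, and Weierstrass preparation makes `y ^
d` a multiple of `x` modulo `f`. Otherwise `f = x g` with `g` regular in `y`: `f` and `∂f/∂y = x
∂g/∂y` provide a power of `x`, while `∂f/∂x = g + x ∂g/∂x` relates `y ^ d` to multiples of `x`. -/
theorem exists_coord_pow_mem_tjurina {f : 𝒪} (hf : Squarefree f) :
    (∃ k, coord 0 ^ k ∈ tjurina f) ∧ ∃ k, coord 1 ^ k ∈ tjurina f := by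
  have aux : ∀ k d : ℕ, coord 0 ^ k ∈ tjurina f → (∃ h, coord 1 ^ d - coord 0 * h ∈ tjurina f) →
      coord 1 ^ (d * k) ∈ tjurina f := by
    rintro k d hk ⟨h, hh⟩
    have h1 := Ideal.mem_of_dvd _ (sub_dvd_pow_sub_pow (coord 1 ^ d) (coord 0 * h) k) hh
    rw [← pow_mul, mul_pow] at h1
    exact (Submodule.sub_mem_iff_left _ (Ideal.mul_mem_right _ _ hk)).mp h1
  by_cases hx : coord 0 ∣ f
  · obtain ⟨g, rfl⟩ := hx
    have hxg : ¬ coord 0 ∣ g := by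
      rintro ⟨h, rfl⟩
      have := hf (coord 0) ⟨h, by ring⟩
      exact isUnit_iff.mp this (evalHom_coord 0)
    obtain ⟨d, h0, hd⟩ := exists_regular hxg
    obtain ⟨k, hk⟩ := exists_coord_pow_mem (hf.squarefree_of_dvd (dvd_mul_left g _)) h0 hd
    obtain ⟨⟨L, U, hU, hg⟩, -⟩ := weierstrass h0 hd
    have hk1 : coord 0 ^ (k + 1) ∈ tjurina (coord 0 * g) := by
      rw [Ideal.mem_span_pair] at hk
      obtain ⟨a, b, hab⟩ := hk
      have e : coord 0 ^ (k + 1) = a * (coord 0 * g) + b * partialD 1 (coord 0 * g) := by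
        rw [pow_succ, ← hab, Derivation.leibniz, partialD_coord_ne (by decide), smul_zero, add_zero,
          smul_eq_mul]
        ring
      rw [e]
      exact add_mem (Ideal.mul_mem_left _ _ (self_mem_tjurina _))
        (Ideal.mul_mem_left _ _ (partialD_mem_tjurina _ 1))
    refine ⟨⟨_, hk1⟩, _, aux (k + 1) d hk1 ?_⟩
    obtain ⟨V, hV⟩ := hU.exists_right_inv
    refine ⟨-(V * (L + partialD 0 g)), ?_⟩
    have e : coord 1 ^ d - coord 0 * -(V * (L + partialD 0 g)) = V * partialD 0 (coord 0 * g) := by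
      rw [Derivation.leibniz, partialD_coord_self, smul_eq_mul, smul_eq_mul]
      linear_combination (-V) * hg - coord 1 ^ d * hV
    rw [e]
    exact Ideal.mul_mem_left _ _ (partialD_mem_tjurina _ 0)
  · obtain ⟨d, h0, hd⟩ := exists_regular hx
    obtain ⟨k, hk⟩ := exists_coord_pow_mem hf h0 hd
    obtain ⟨⟨L, U, hU, hg⟩, -⟩ := weierstrass h0 hd
    have hk1 : coord 0 ^ k ∈ tjurina f := by
      refine Ideal.span_mono ?_ hk
      intro a ha
      rcases ha with rfl | rfl <;> simp
    refine ⟨⟨_, hk1⟩, _, aux k d hk1 ?_⟩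
    obtain ⟨V, hV⟩ := hU.exists_right_inv
    refine ⟨-(V * L), ?_⟩
    have e : coord 1 ^ d - coord 0 * -(V * L) = V * f := by
      linear_combination (-V) * hg - coord 1 ^ d * hV
    rw [e]
    exact Ideal.mul_mem_left _ _ (self_mem_tjurina _)

/-- Geometrically, a reduced plane curve germ has at most an isolated singularity. -/
theorem exists_𝔪_pow_le_tjurina {f : 𝒪} (hf : Squarefree f) : ∃ M, 𝔪 ^ M ≤ tjurina f := by
  obtain ⟨⟨k, hk⟩, l, hl⟩ := exists_coord_pow_mem_tjurina hf
  refine ⟨k + l, ?_⟩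
  rw [𝔪_eq_span]
  have h1 := Ideal.sup_pow_add_le_pow_sup_pow (I := Ideal.span {coord 0})
    (J := Ideal.span {coord 1}) (n := k) (m := l)
  rw [← Ideal.span_union] at h1
  refine h1.trans (sup_le ?_ ?_)
  · rw [Ideal.span_singleton_pow, Ideal.span_singleton_le_iff_mem]
    exact hk
  · rw [Ideal.span_singleton_pow, Ideal.span_singleton_le_iff_mem]
    exact hl

/-! ### Modules with a flat connection are `𝒟`-modules -/

theorem partialD_pow_coord_pow_mul (i : Fin 2) {g : 𝒪} (hg : partialD i g = 0) (j l : ℕ) :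
    ((partialD i : 𝒪 →ₗ[ℂ] 𝒪) ^ l) (coord i ^ j * g) =
      (j.descFactorial l : 𝒪) * (coord i ^ (j - l) * g) := by
  induction l with
  | zero => simp
  | succ l ih =>
    rw [pow_succ', Module.End.mul_apply, ih]
    change partialD i _ = _
    rw [Derivation.leibniz, Derivation.map_natCast, smul_zero, add_zero, Derivation.leibniz, hg,
      smul_zero, zero_add, Derivation.leibniz_pow, partialD_coord_self, Nat.descFactorial_succ]
    simp only [smul_eq_mul, nsmul_eq_mul, mul_one, Nat.sub_sub]
    push_cast
    ring

/-- The result vanishes if `k > i` or `l > j`, and is `i! j!` for `(k, l) = (i, j)`. This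
triangularity makes the coefficients of a differential operator unique. -/
theorem partialD_pow_pow_monomial (i j k l : ℕ) :
    ((partialD 0 : 𝒪 →ₗ[ℂ] 𝒪) ^ k) (((partialD 1 : 𝒪 →ₗ[ℂ] 𝒪) ^ l)
      (coord 1 ^ j * coord 0 ^ i)) = (i.descFactorial k : 𝒪) * ((j.descFactorial l : 𝒪) *
        (coord 0 ^ (i - k) * coord 1 ^ (j - l))) := by
  rw [partialD_pow_coord_pow_mul 1 (by
    rw [Derivation.leibniz_pow, partialD_coord_ne (by decide)]; simp)]
  have e : (j.descFactorial l : 𝒪) * (coord 1 ^ (j - l) * coord 0 ^ i) =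
      coord 0 ^ i * ((j.descFactorial l : 𝒪) * coord 1 ^ (j - l)) := by ring
  rw [e, partialD_pow_coord_pow_mul 0 (by
    rw [Derivation.leibniz, Derivation.leibniz_pow, partialD_coord_ne (by decide)]; simp)]
  ring

section Connection

variable {N : Type*} [AddCommGroup N] [Module ℂ N] [Module 𝒪 N] [IsScalarTower ℂ 𝒪 N]

/-- The pair of the multiplications by `a` on `𝒪` and on `N`. -/
noncomputable def mulPair (N : Type*) [AddCommGroup N] [Module ℂ N] [Module 𝒪 N]
    [IsScalarTower ℂ 𝒪 N] (a : 𝒪) : Module.End ℂ 𝒪 × Module.End ℂ N :=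
  (LinearMap.mulLeft ℂ a, Algebra.lsmul ℂ ℂ N a)

/-- The pair of the partial derivative on `𝒪` and of an operator on `N`. -/
noncomputable def derPair (d : Fin 2 → Module.End ℂ N) (i : Fin 2) :
    Module.End ℂ 𝒪 × Module.End ℂ N :=
  ((partialD i : 𝒪 →ₗ[ℂ] 𝒪), d i)

theorem mulPair_mul (a b : 𝒪) : mulPair N a * mulPair N b = mulPair N (a * b) := by
  refine Prod.ext (LinearMap.ext fun f => ?_) (LinearMap.ext fun n => ?_)
  · simp [mulPair]
  · simp [mulPair]

theorem mulPair_one : mulPair N 1 = 1 := by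
  refine Prod.ext (LinearMap.ext fun f => ?_) (LinearMap.ext fun n => ?_) <;> simp [mulPair]

theorem mulPair_add (a b : 𝒪) : mulPair N (a + b) = mulPair N a + mulPair N b := by
  refine Prod.ext (LinearMap.ext fun f => ?_) (LinearMap.ext fun n => ?_) <;>
    simp [mulPair, add_mul]

theorem mulPair_smul (c : ℂ) (a : 𝒪) : mulPair N (c • a) = c • mulPair N a := by
  refine Prod.ext (LinearMap.ext fun f => ?_) (LinearMap.ext fun n => ?_) <;>
    simp [mulPair]

/-- The pairs of operators generated by the multiplications and the derivatives. -/
noncomputable def pairSubalgebra (d : Fin 2 → Module.End ℂ N) :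
    Subalgebra ℂ (Module.End ℂ 𝒪 × Module.End ℂ N) :=
  Algebra.adjoin ℂ (Set.range (mulPair N) ∪ Set.range (derPair d))

/-- The pair of operators `∑ cᵢⱼ ∂₀ⁱ ∂₁ʲ`. -/
noncomputable def normalForm (d : Fin 2 → Module.End ℂ N) :
    (ℕ × ℕ →₀ 𝒪) →ₗ[ℂ] Module.End ℂ 𝒪 × Module.End ℂ N :=
  Finsupp.lsum ℂ fun k =>
    { toFun := fun a => mulPair N a * (derPair d 0 ^ k.1 * derPair d 1 ^ k.2)
      map_add' := fun a b => by rw [mulPair_add, add_mul]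
      map_smul' := fun c a => by rw [mulPair_smul, smul_mul_assoc, RingHom.id_apply] }

theorem normalForm_single (d : Fin 2 → Module.End ℂ N) (k : ℕ × ℕ) (a : 𝒪) :
    normalForm d (Finsupp.single k a) = mulPair N a * (derPair d 0 ^ k.1 * derPair d 1 ^ k.2) := by
  exact Finsupp.sum_single_index (LinearMap.map_zero _)

theorem derPair_mul_mulPair {d : Fin 2 → Module.End ℂ N}
    (hd : ∀ i (a : 𝒪) n, d i (a • n) = partialD i a • n + a • d i n) (i : Fin 2) (a : 𝒪) :
    derPair d i * mulPair N a = mulPair N (partialD i a) + mulPair N a * derPair d i := by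
  refine Prod.ext (LinearMap.ext fun f => ?_) (LinearMap.ext fun n => ?_)
  · simp [mulPair, derPair]
    ring
  · simp [mulPair, derPair, hd]

/-- The Leibniz rule moves multiplications to the left of derivatives and commutation sorts the
derivatives. Hence left multiplication by the generators preserves the set of normal forms, which
contains `1`. -/
theorem mem_range_normalForm {d : Fin 2 → Module.End ℂ N}
    (hd : ∀ i (a : 𝒪) n, d i (a • n) = partialD i a • n + a • d i n)
    (hc : ∀ n, d 0 (d 1 n) = d 1 (d 0 n)) {t : Module.End ℂ 𝒪 × Module.End ℂ N}
    (ht : t ∈ pairSubalgebra d) : t ∈ LinearMap.range (normalForm d) := by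
  have hcomm : Commute (derPair d 0) (derPair d 1) :=
    Prod.ext (LinearMap.ext partialD_comm) (LinearMap.ext hc)
  have key : ∀ s ∈ LinearMap.range (normalForm d), t * s ∈ LinearMap.range (normalForm d) := by
    induction ht using Algebra.adjoin_induction with
    | mem t ht =>
      rintro _ ⟨c, rfl⟩
      induction c using Finsupp.induction_linear with
      | zero => rw [map_zero, mul_zero]; exact zero_mem _
      | add c c' hc hc' => rw [map_add, mul_add]; exact add_mem hc hc'
      | single k a =>
        rw [normalForm_single]
        rcases ht with ⟨b, rfl⟩ | ⟨i, rfl⟩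
        · rw [← mul_assoc, mulPair_mul, ← normalForm_single]
          exact LinearMap.mem_range_self _ _
        · rw [← mul_assoc, derPair_mul_mulPair hd, add_mul, ← normalForm_single, mul_assoc]
          refine add_mem (LinearMap.mem_range_self _ _) ?_
          fin_cases i
          · change mulPair N a * (derPair d 0 * _) ∈ _
            rw [← mul_assoc (derPair d 0), ← pow_succ', ← normalForm_single d (k.1 + 1, k.2)]
            exact LinearMap.mem_range_self _ _
          · change mulPair N a * (derPair d 1 * _) ∈ _
            rw [← mul_assoc (derPair d 1), (hcomm.pow_left k.1).symm.eq, mul_assoc, ← pow_succ',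
              ← normalForm_single d (k.1, k.2 + 1)]
            exact LinearMap.mem_range_self _ _
    | algebraMap c =>
      intro s hs
      rw [Algebra.algebraMap_eq_smul_one, smul_mul_assoc, one_mul]
      exact Submodule.smul_mem _ _ hs
    | add t t' _ _ h h' =>
      intro s hs
      rw [add_mul]
      exact add_mem (h s hs) (h' s hs)
    | mul t t' _ _ h h' =>
      intro s hs
      rw [mul_assoc]
      exact h _ (h' s hs)
  have h1 : (1 : Module.End ℂ 𝒪 × Module.End ℂ N) ∈ LinearMap.range (normalForm d) :=
    ⟨Finsupp.single (0, 0) 1, by rw [normalForm_single, mulPair_one]; simp⟩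
  simpa using key 1 h1

/-- Evaluate on the monomial whose exponent is an index of minimal total degree in the support.
Every other term of the operator kills it. -/
theorem eq_zero_of_normalForm_fst {d : Fin 2 → Module.End ℂ N} {c : ℕ × ℕ →₀ 𝒪}
    (h : (normalForm d c).1 = 0) : c = 0 := by
  classical
  by_contra hc
  obtain ⟨p, hp, hmin⟩ := Finset.exists_min_image c.support (fun k => k.1 + k.2)
    (Finsupp.support_nonempty_iff.mpr hc)
  have h1 := congrArg (fun L : Module.End ℂ 𝒪 => L (coord 1 ^ p.2 * coord 0 ^ p.1)) h
  have h2 : ∀ c : ℕ × ℕ →₀ 𝒪, ∀ f, (normalForm d c).1 f =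
      c.sum fun k a => a * ((partialD 0 : 𝒪 →ₗ[ℂ] 𝒪) ^ k.1)
        (((partialD 1 : 𝒪 →ₗ[ℂ] 𝒪) ^ k.2) f) := by
    intro c f
    induction c using Finsupp.induction_linear with
    | zero => simp
    | add c c' hc hc' =>
      rw [map_add, Prod.fst_add, LinearMap.add_apply, hc, hc', Finsupp.sum_add_index']
      · simp
      · intros; ring
    | single k a =>
      rw [normalForm_single, Finsupp.sum_single_index (by simp)]
      rfl
  simp only [h2, partialD_pow_pow_monomial, LinearMap.zero_apply] at h1
  rw [Finsupp.sum, Finset.sum_eq_single p] at h1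
  · rw [Nat.descFactorial_self, Nat.descFactorial_self, Nat.sub_self, Nat.sub_self, pow_zero,
      pow_zero, mul_one, mul_one, mul_eq_zero, or_iff_right (Finsupp.mem_support_iff.mp hp),
      mul_eq_zero] at h1
    have : CharZero 𝒪 := charZero_of_injective_algebraMap (algebraMap ℂ 𝒪).injective
    rcases h1 with h1 | h1 <;> exact Nat.factorial_ne_zero _ (Nat.cast_eq_zero.mp h1)
  · intro k hk hkp
    have h3 := hmin k hk
    by_cases h4 : p.1 < k.1
    · rw [Nat.descFactorial_eq_zero_iff_lt.mpr h4]
      simp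
    · by_cases h5 : p.2 < k.2
      · rw [Nat.descFactorial_eq_zero_iff_lt.mpr h5]
        simp
      · exact absurd (Prod.ext (by omega) (by omega)) hkp
  · intro h3
    exact absurd hp h3

/-- The first component of the pairs of operators. -/
noncomputable def pairFst (d : Fin 2 → Module.End ℂ N) : pairSubalgebra d →ₐ[ℂ] 𝒟 :=
  AlgHom.codRestrict ((AlgHom.fst ℂ _ _).comp (pairSubalgebra d).val) diffOpSubalgebra fun t => by
    obtain ⟨t, ht⟩ := t
    change t.1 ∈ diffOpSubalgebra
    induction ht using Algebra.adjoin_induction with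
    | mem t ht =>
      rcases ht with ⟨b, rfl⟩ | ⟨i, rfl⟩
      · exact Algebra.subset_adjoin (Or.inl ⟨b, rfl⟩)
      · exact Algebra.subset_adjoin (Or.inr ⟨i, rfl⟩)
    | algebraMap c => exact Subalgebra.algebraMap_mem _ c
    | add t t' _ _ h h' => exact add_mem h h'
    | mul t t' _ _ h h' => exact mul_mem h h'

/-- The operator on `𝒪` determines the coefficients of the normal form, and these determine the
operator on `N`. Projecting the inverse to `N` gives the `𝒟`-action on `N` without a presentation of
`𝒟`. -/
theorem pairFst_bijective {d : Fin 2 → Module.End ℂ N}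
    (hd : ∀ i (a : 𝒪) n, d i (a • n) = partialD i a • n + a • d i n)
    (hc : ∀ n, d 0 (d 1 n) = d 1 (d 0 n)) : Function.Bijective (pairFst d) := by
  constructor
  · rw [injective_iff_map_eq_zero]
    rintro ⟨t, ht⟩ h
    obtain ⟨c, rfl⟩ := mem_range_normalForm hd hc ht
    have h1 : (normalForm d c).1 = 0 := congrArg Subtype.val h
    have h2 := eq_zero_of_normalForm_fst h1
    apply Subtype.ext
    change normalForm d c = 0
    rw [h2, map_zero]
  · rintro ⟨P, hP⟩
    suffices h : ∃ t ∈ pairSubalgebra d, t.1 = P by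
      obtain ⟨t, ht, rfl⟩ := h
      exact ⟨⟨t, ht⟩, rfl⟩
    induction hP using Algebra.adjoin_induction with
    | mem P hP =>
      rcases hP with ⟨b, rfl⟩ | ⟨i, rfl⟩
      · exact ⟨mulPair N b, Algebra.subset_adjoin (Or.inl ⟨b, rfl⟩), rfl⟩
      · exact ⟨derPair d i, Algebra.subset_adjoin (Or.inr ⟨i, rfl⟩), rfl⟩
    | algebraMap c => exact ⟨algebraMap ℂ _ c, Subalgebra.algebraMap_mem _ c, rfl⟩
    | add P P' _ _ h h' =>
      obtain ⟨t, ht, rfl⟩ := h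
      obtain ⟨t', ht', rfl⟩ := h'
      exact ⟨t + t', add_mem ht ht', rfl⟩
    | mul P P' _ _ h h' =>
      obtain ⟨t, ht, rfl⟩ := h
      obtain ⟨t', ht', rfl⟩ := h'
      exact ⟨t * t', mul_mem ht ht', rfl⟩

/-- The action of the differential operators on an `𝒪`-module with two commuting operators that
satisfy the Leibniz rules of `∂/∂x` and `∂/∂y`. -/
noncomputable def opAction {d : Fin 2 → Module.End ℂ N}
    (hd : ∀ i (a : 𝒪) n, d i (a • n) = partialD i a • n + a • d i n)
    (hc : ∀ n, d 0 (d 1 n) = d 1 (d 0 n)) : 𝒟 →ₐ[ℂ] Module.End ℂ N :=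
  ((AlgHom.snd ℂ _ _).comp (pairSubalgebra d).val).comp
    (AlgEquiv.ofBijective (pairFst d) (pairFst_bijective hd hc)).symm.toAlgHom

theorem opAction_eq {d : Fin 2 → Module.End ℂ N}
    (hd : ∀ i (a : 𝒪) n, d i (a • n) = partialD i a • n + a • d i n)
    (hc : ∀ n, d 0 (d 1 n) = d 1 (d 0 n)) {P : 𝒟} {t : Module.End ℂ 𝒪 × Module.End ℂ N}
    (ht : t ∈ pairSubalgebra d) (hP : toEnd P = t.1) : opAction hd hc P = t.2 := by
  have h : (AlgEquiv.ofBijective (pairFst d) (pairFst_bijective hd hc)).symm P = ⟨t, ht⟩ := by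
    rw [AlgEquiv.symm_apply_eq]
    exact Subtype.ext hP
  change ((AlgEquiv.ofBijective (pairFst d) (pairFst_bijective hd hc)).symm P).1.2 = t.2
  rw [h]

theorem opAction_mulOp {d : Fin 2 → Module.End ℂ N}
    (hd : ∀ i (a : 𝒪) n, d i (a • n) = partialD i a • n + a • d i n)
    (hc : ∀ n, d 0 (d 1 n) = d 1 (d 0 n)) (a : 𝒪) (n : N) :
    opAction hd hc (mulOp a) n = a • n := by
  rw [opAction_eq hd hc (t := mulPair N a) (Algebra.subset_adjoin (Or.inl ⟨a, rfl⟩)) rfl]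
  rfl

theorem opAction_derOp {d : Fin 2 → Module.End ℂ N}
    (hd : ∀ i (a : 𝒪) n, d i (a • n) = partialD i a • n + a • d i n)
    (hc : ∀ n, d 0 (d 1 n) = d 1 (d 0 n)) (δ : Derivation ℂ 𝒪 𝒪) (n : N) :
    opAction hd hc (derOp δ) n = δ (coord 0) • d 0 n + δ (coord 1) • d 1 n := by
  rw [opAction_eq hd hc (t := mulPair N (δ (coord 0)) * derPair d 0 +
    mulPair N (δ (coord 1)) * derPair d 1)]
  · rfl
  · exact add_mem (mul_mem (Algebra.subset_adjoin (Or.inl ⟨_, rfl⟩))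
      (Algebra.subset_adjoin (Or.inr ⟨_, rfl⟩))) (mul_mem (Algebra.subset_adjoin (Or.inl ⟨_, rfl⟩))
      (Algebra.subset_adjoin (Or.inr ⟨_, rfl⟩)))
  · exact LinearMap.ext fun g => derivation_apply δ g

end Connection

theorem 𝒟_induction {p : 𝒟 → Prop} (hmul : ∀ a, p (mulOp a)) (hder : ∀ i, p (derOp (partialD i)))
    (hadd : ∀ P Q, p P → p Q → p (P + Q)) (hmul' : ∀ P Q, p P → p Q → p (P * Q)) (P : 𝒟) : p P := by
  obtain ⟨P, hP⟩ := P
  induction hP using Algebra.adjoin_induction with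
  | mem P hP =>
    rcases hP with ⟨b, rfl⟩ | ⟨i, rfl⟩
    · exact hmul b
    · exact hder i
  | algebraMap c =>
    have h : algebraMap ℂ (Module.End ℂ 𝒪) c = LinearMap.mulLeft ℂ (algebraMap ℂ 𝒪 c) :=
      LinearMap.ext fun f => by
        rw [Module.algebraMap_end_apply, Algebra.smul_def, LinearMap.mulLeft_apply]
    have h' : (⟨algebraMap ℂ (Module.End ℂ 𝒪) c, Subalgebra.algebraMap_mem _ c⟩ : 𝒟) =
        mulOp (algebraMap ℂ 𝒪 c) := Subtype.ext h
    exact h' ▸ hmul _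
  | add P P' h₁ h₂ h h' => exact hadd ⟨P, h₁⟩ ⟨P', h₂⟩ h h'
  | mul P P' h₁ h₂ h h' => exact hmul' ⟨P, h₁⟩ ⟨P', h₂⟩ h h'

/-! ### The field of fractions of `𝒪` as a `𝒟`-module -/

/-- The field of fractions of `𝒪`. -/
def 𝒦 : Type := FractionRing 𝒪

noncomputable instance : Field 𝒦 := inferInstanceAs (Field (FractionRing 𝒪))

noncomputable instance : Algebra 𝒪 𝒦 := inferInstanceAs (Algebra 𝒪 (FractionRing 𝒪))

instance : IsFractionRing 𝒪 𝒦 := inferInstanceAs (IsFractionRing 𝒪 (FractionRing 𝒪))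

noncomputable instance : Algebra ℂ 𝒦 := inferInstanceAs (Algebra ℂ (FractionRing 𝒪))

instance : IsScalarTower ℂ 𝒪 𝒦 := inferInstanceAs (IsScalarTower ℂ 𝒪 (FractionRing 𝒪))

/-- The map sending `a` to the dual number with components `a` and `δ a` is a ring homomorphism. It
takes nonzero elements to units, so it extends to the field of fractions; the infinitesimal
component of the extension is the derivation. -/
theorem exists_derivation_extension (δ : Derivation ℂ 𝒪 𝒪) :
    ∃ D : Derivation ℂ 𝒦 𝒦, ∀ a, D (algebraMap 𝒪 𝒦 a) = algebraMap 𝒪 𝒦 (δ a) := by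
  let φ : 𝒪 →+* DualNumber 𝒦 :=
    { toFun := fun a => TrivSqZeroExt.inl (algebraMap 𝒪 𝒦 a) +
        TrivSqZeroExt.inr (algebraMap 𝒪 𝒦 (δ a))
      map_one' := by ext <;> simp
      map_mul' := fun a b => by
        refine TrivSqZeroExt.ext ?_ ?_
        · simp only [TrivSqZeroExt.fst_add, TrivSqZeroExt.fst_inl, TrivSqZeroExt.fst_inr,
            TrivSqZeroExt.fst_mul, add_zero, map_mul]
        · simp only [TrivSqZeroExt.fst_add, TrivSqZeroExt.fst_inl, TrivSqZeroExt.fst_inr,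
            TrivSqZeroExt.snd_add, TrivSqZeroExt.snd_inl, TrivSqZeroExt.snd_inr,
            TrivSqZeroExt.snd_mul, add_zero, zero_add, map_mul, map_add, Derivation.leibniz,
            smul_eq_mul, MulOpposite.smul_eq_mul_unop, MulOpposite.unop_op]
          exact congrArg _ (mul_comm _ _)
      map_zero' := by ext <;> simp
      map_add' := fun a b => by
        rw [map_add, map_add, map_add, TrivSqZeroExt.inl_add, TrivSqZeroExt.inr_add]
        abel }
  have hφ : ∀ s : nonZeroDivisors 𝒪, IsUnit (φ s) := by
    intro s
    rw [TrivSqZeroExt.isUnit_iff_isUnit_fst]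
    have : (φ s).fst = algebraMap 𝒪 𝒦 s := by simp [φ]
    rw [this]
    exact IsLocalization.map_units 𝒦 s
  let ψ : 𝒦 →+* DualNumber 𝒦 := IsLocalization.lift hφ
  have hψ : ∀ a, ψ (algebraMap 𝒪 𝒦 a) = φ a := fun a => IsLocalization.lift_eq hφ a
  have hfst : ∀ z, (ψ z).fst = z := by
    intro z
    have h : ((TrivSqZeroExt.fstHom ℂ 𝒦 𝒦 : DualNumber 𝒦 →+* 𝒦).comp ψ) = RingHom.id 𝒦 := by
      apply IsLocalization.ringHom_ext (nonZeroDivisors 𝒪)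
      ext a
      change (ψ (algebraMap 𝒪 𝒦 a)).fst = algebraMap 𝒪 𝒦 a
      rw [hψ]
      simp [φ]
    exact congrArg (fun g : 𝒦 →+* 𝒦 => g z) h
  have hsnd : ∀ a, (ψ (algebraMap 𝒪 𝒦 a)).snd = algebraMap 𝒪 𝒦 (δ a) := by
    intro a
    rw [hψ]
    exact zero_add _
  have hmul : ∀ a b, (ψ (a * b)).snd = a * (ψ b).snd + b * (ψ a).snd := by
    intro a b
    rw [map_mul, TrivSqZeroExt.snd_mul, hfst, hfst]
    simp [mul_comm]
  refine ⟨Derivation.mk' { toFun := fun z => (ψ z).snd, map_add' := ?_, map_smul' := ?_ } ?_, ?_⟩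
  · intro a b
    rw [map_add, TrivSqZeroExt.snd_add]
  · intro c z
    rw [Algebra.smul_def, hmul, IsScalarTower.algebraMap_apply ℂ 𝒪 𝒦, hsnd,
      Derivation.map_algebraMap, map_zero, mul_zero, add_zero, RingHom.id_apply,
      ← IsScalarTower.algebraMap_apply, ← Algebra.smul_def]
  · intro a b
    exact hmul a b
  · exact hsnd

theorem derivation_𝒦_eq_zero {D : Derivation ℂ 𝒦 𝒦} (h : ∀ a, D (algebraMap 𝒪 𝒦 a) = 0) (z : 𝒦) :
    D z = 0 := by
  obtain ⟨a, b, hb, rfl⟩ := IsFractionRing.div_surjective (A := 𝒪) z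
  rw [Derivation.leibniz_div, h, h]
  simp

/-- The partial derivatives on the field of fractions. -/
noncomputable def derK (i : Fin 2) : Derivation ℂ 𝒦 𝒦 :=
  (exists_derivation_extension (partialD i)).choose

theorem derK_algebraMap (i : Fin 2) (a : 𝒪) :
    derK i (algebraMap 𝒪 𝒦 a) = algebraMap 𝒪 𝒦 (partialD i a) :=
  (exists_derivation_extension (partialD i)).choose_spec a

theorem derK_comm (z : 𝒦) : derK 0 (derK 1 z) = derK 1 (derK 0 z) := by
  have h := derivation_𝒦_eq_zero (D := ⁅derK 0, derK 1⁆) (fun a => by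
    rw [Derivation.commutator_apply, derK_algebraMap, derK_algebraMap, derK_algebraMap,
      derK_algebraMap, partialD_comm, sub_self]) z
  rwa [Derivation.commutator_apply, sub_eq_zero] at h

/-- The partial derivatives on the field of fractions, as linear maps. -/
noncomputable def derKLin (i : Fin 2) : Module.End ℂ 𝒦 := (derK i : 𝒦 →ₗ[ℂ] 𝒦)

theorem derKLin_leibniz (i : Fin 2) (a : 𝒪) (z : 𝒦) :
    derKLin i (a • z) = partialD i a • z + a • derKLin i z := by
  change derK i (a • z) = partialD i a • z + a • derK i z
  rw [Algebra.smul_def, Algebra.smul_def, Algebra.smul_def, Derivation.leibniz, derK_algebraMap,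
    smul_eq_mul, smul_eq_mul]
  ring

noncomputable instance : Module 𝒟 𝒦 :=
  Module.compHom 𝒦 (opAction derKLin_leibniz derK_comm).toRingHom

theorem mulOp_smul_𝒦 (a : 𝒪) (z : 𝒦) : mulOp a • z = a • z :=
  opAction_mulOp derKLin_leibniz derK_comm a z

theorem derOp_smul_𝒦 (δ : Derivation ℂ 𝒪 𝒪) (z : 𝒦) :
    derOp δ • z = δ (coord 0) • derK 0 z + δ (coord 1) • derK 1 z :=
  opAction_derOp derKLin_leibniz derK_comm δ z

theorem derOp_partialD_smul_𝒦 (i : Fin 2) (z : 𝒦) : derOp (partialD i) • z = derK i z := by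
  rw [derOp_smul_𝒦]
  fin_cases i <;> simp [partialD_coord_ne]

theorem mulOp_smul_𝒪 (a b : 𝒪) : mulOp a • b = a * b := rfl

theorem derOp_smul_𝒪 (δ : Derivation ℂ 𝒪 𝒪) (b : 𝒪) : derOp δ • b = δ b := rfl

/-- The embedding of `𝒪` in its field of fractions is `𝒟`-linear. -/
noncomputable def inclK : 𝒪 →ₗ[𝒟] 𝒦 where
  toFun := algebraMap 𝒪 𝒦
  map_add' := map_add _
  map_smul' P := by
    induction P using 𝒟_induction with
    | hmul a => intro b; rw [RingHom.id_apply, mulOp_smul_𝒦, mulOp_smul_𝒪, map_mul, Algebra.smul_def]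
    | hder i => intro b; rw [RingHom.id_apply, derOp_partialD_smul_𝒦, derOp_smul_𝒪, derK_algebraMap]
    | hadd P Q hP hQ => intro b; rw [RingHom.id_apply, add_smul, map_add, add_smul, hP, hQ]; rfl
    | hmul' P Q hP hQ => intro b; rw [RingHom.id_apply, mul_smul, hP, hQ, mul_smul]; rfl

theorem inclK_apply (a : 𝒪) : inclK a = algebraMap 𝒪 𝒦 a := rfl

theorem inclK_injective : Function.Injective inclK := IsFractionRing.injective 𝒪 𝒦

/-- The subring `𝒪[1/g]` of the field of fractions. -/
noncomputable def awayK (g : 𝒪) : Subalgebra 𝒪 𝒦 := Algebra.adjoin 𝒪 {(algebraMap 𝒪 𝒦 g)⁻¹}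

theorem inv_mem_awayK (g : 𝒪) : (algebraMap 𝒪 𝒦 g)⁻¹ ∈ awayK g := Algebra.subset_adjoin rfl

theorem exists_pow_mul_eq {g : 𝒪} {z : 𝒦} (hz : z ∈ awayK g) :
    ∃ (k : ℕ) (a : 𝒪), algebraMap 𝒪 𝒦 (g ^ k) * z = algebraMap 𝒪 𝒦 a := by
  induction hz using Algebra.adjoin_induction with
  | mem z hz =>
    rw [Set.mem_singleton_iff.mp hz]
    -- For `g = 0` the adjoined inverse is `0` by convention, and nothing has to be cleared.
    by_cases hg : g = 0
    · exact ⟨0, 0, by simp [hg]⟩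
    · refine ⟨1, 1, ?_⟩
      rw [pow_one, map_one, mul_inv_cancel₀]
      exact (map_ne_zero_iff _ (IsFractionRing.injective 𝒪 𝒦)).mpr hg
  | algebraMap a => exact ⟨0, a, by simp⟩
  | add z w _ _ hz hw =>
    obtain ⟨k, a, h⟩ := hz
    obtain ⟨l, b, h'⟩ := hw
    refine ⟨k + l, g ^ l * a + g ^ k * b, ?_⟩
    rw [map_add, map_mul, map_mul, ← h, ← h', pow_add, map_mul]
    ring
  | mul z w _ _ hz hw =>
    obtain ⟨k, a, h⟩ := hz
    obtain ⟨l, b, h'⟩ := hw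
    refine ⟨k + l, a * b, ?_⟩
    rw [map_mul, ← h, ← h', pow_add, map_mul]
    ring

theorem derK_mem_awayK {g : 𝒪} (i : Fin 2) {z : 𝒦} (hz : z ∈ awayK g) : derK i z ∈ awayK g := by
  induction hz using Algebra.adjoin_induction with
  | mem z hz =>
    rw [Set.mem_singleton_iff.mp hz, Derivation.leibniz_inv, derK_algebraMap]
    exact mul_mem (neg_mem (pow_mem (inv_mem_awayK g) 2)) (Subalgebra.algebraMap_mem _ _)
  | algebraMap a => rw [derK_algebraMap]; exact Subalgebra.algebraMap_mem _ _
  | add z w _ _ hz hw => rw [map_add]; exact add_mem hz hw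
  | mul z w hz' hw' hz hw =>
    rw [Derivation.leibniz]
    exact add_mem (mul_mem hz' hw) (mul_mem hw' hz)

theorem smul_mem_awayK {g : 𝒪} (P : 𝒟) : ∀ {z : 𝒦}, z ∈ awayK g → P • z ∈ awayK g := by
  induction P using 𝒟_induction with
  | hmul a => intro z hz; rw [mulOp_smul_𝒦]; exact Subalgebra.smul_mem _ hz a
  | hder i => intro z hz; rw [derOp_partialD_smul_𝒦]; exact derK_mem_awayK i hz
  | hadd P Q hP hQ => intro z hz; rw [add_smul]; exact add_mem (hP hz) (hQ hz)
  | hmul' P Q hP hQ => intro z hz; rw [mul_smul]; exact hP (hQ hz)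

/-- The coordinates are coprime: multiplication by `y ^ l` shifts the coefficients of `g` free of
`x` to coefficients free of `x`, and these vanish on the right side. Then divide by `x` and repeat.
-/
theorem coord_pow_dvd {g h : 𝒪} {k l : ℕ} (e : coord 1 ^ l * g = coord 0 ^ k * h) :
    coord 0 ^ k ∣ g := by
  induction k generalizing g h with
  | zero => simp
  | succ k ih =>
    have h1 : coord 0 ∣ g := by
      rw [coord_dvd_iff]
      intro n hn
      rw [← cf_coord_pow_mul_add 1 l g n, e]
      exact cf_coord_pow_mul 0 (k + 1) h _ (by simp [hn])
    obtain ⟨g', rfl⟩ := h1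
    have h2 : coord 1 ^ l * g' = coord 0 ^ k * h := by
      apply mul_left_cancel₀ (coord_ne_zero 0)
      linear_combination e
    rw [pow_succ']
    exact mul_dvd_mul_left _ (ih h2)

/-- A fraction that becomes regular after multiplication with a power of the maximal ideal is
regular. -/
theorem exists_eq_algebraMap {z : 𝒦} {M : ℕ}
    (h : ∀ g ∈ 𝔪 ^ M, ∃ a, algebraMap 𝒪 𝒦 g * z = algebraMap 𝒪 𝒦 a) :
    ∃ a, z = algebraMap 𝒪 𝒦 a := by
  obtain ⟨a, ha⟩ := h _ (Ideal.pow_mem_pow (coord_mem 0) M)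
  obtain ⟨b, hb⟩ := h _ (Ideal.pow_mem_pow (coord_mem 1) M)
  have h1 : coord 1 ^ M * a = coord 0 ^ M * b := by
    apply IsFractionRing.injective 𝒪 𝒦
    rw [map_mul, map_mul, ← ha, ← hb]
    ring
  obtain ⟨c, rfl⟩ := coord_pow_dvd h1
  refine ⟨c, ?_⟩
  rw [map_mul] at ha
  refine mul_left_cancel₀ ?_ ha
  exact (map_ne_zero_iff _ (IsFractionRing.injective 𝒪 𝒦)).mpr (pow_ne_zero _ (coord_ne_zero 0))

/-! ### The tower of the derivatives of a primitive -/

/-- The vector space `𝒦 ⊕ ⨁ₖ 𝒦 Gₖ`, where `G₀` is a formal primitive of `w` along a derivation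
`τ` and `Gₖ` is its `k`-th derivative along a derivation `ε` that commutes with `τ`. -/
abbrev Tower : Type := 𝒦 × (ℕ →₀ 𝒦)

section Tower

variable (τ ε : Derivation ℂ 𝒦 𝒦) (w : 𝒦)

/-- The action of `ε` on the tower. -/
noncomputable def towerε : Module.End ℂ Tower :=
  LinearMap.prodMap (ε : 𝒦 →ₗ[ℂ] 𝒦)
    (Finsupp.mapRange.linearMap (ε : 𝒦 →ₗ[ℂ] 𝒦) + Finsupp.lmapDomain 𝒦 ℂ Nat.succ)

/-- The action of `τ` on the tower. -/
noncomputable def towerτ : Module.End ℂ Tower :=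
  LinearMap.prod
    (LinearMap.coprod (τ : 𝒦 →ₗ[ℂ] 𝒦)
      (Finsupp.lsum ℂ fun k => LinearMap.mulRight ℂ (((ε : 𝒦 →ₗ[ℂ] 𝒦) ^ k) w)))
    (Finsupp.mapRange.linearMap (τ : 𝒦 →ₗ[ℂ] 𝒦) ∘ₗ LinearMap.snd ℂ 𝒦 (ℕ →₀ 𝒦))

theorem tower_induction {p : Tower → Prop} (h0 : ∀ u, p (u, 0))
    (h1 : ∀ k c, p (0, Finsupp.single k c)) (hadd : ∀ m n, p m → p n → p (m + n)) (n : Tower) :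
    p n := by
  obtain ⟨u, q⟩ := n
  have h2 : ∀ q : ℕ →₀ 𝒦, p (0, q) := fun q => by
    induction q using Finsupp.induction_linear with
    | zero => exact h0 0
    | add q q' hq hq' => simpa using hadd _ _ hq hq'
    | single k c => exact h1 k c
  simpa using hadd _ _ (h0 u) (h2 q)

theorem towerε_inl (u : 𝒦) : towerε ε (u, 0) = (ε u, 0) := by
  simp [towerε]

theorem towerε_single (k : ℕ) (c : 𝒦) : towerε ε (0, Finsupp.single k c) =
    (0, Finsupp.single k (ε c) + Finsupp.single (k + 1) c) := by
  simp [towerε, Finsupp.mapDomain_single]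

theorem towerτ_inl (u : 𝒦) : towerτ τ ε w (u, 0) = (τ u, 0) := by
  simp [towerτ]

theorem towerτ_single (k : ℕ) (c : 𝒦) : towerτ τ ε w (0, Finsupp.single k c) =
    (c * ((ε : 𝒦 →ₗ[ℂ] 𝒦) ^ k) w, Finsupp.single k (τ c)) := by
  simp [towerτ]

theorem towerε_leibniz (a : 𝒦) (n : Tower) :
    towerε ε (a • n) = ε a • n + a • towerε ε n := by
  induction n using tower_induction with
  | h0 u =>
    simp only [Prod.smul_mk, smul_zero, towerε_inl, Prod.mk_add_mk, add_zero, smul_eq_mul,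
      Derivation.leibniz]
    rw [add_comm, mul_comm u]
  | h1 k c =>
    simp only [Prod.smul_mk, Finsupp.smul_single, towerε_single, Prod.mk_add_mk,
      add_zero, mul_zero, smul_eq_mul, Derivation.leibniz, smul_add, Finsupp.single_add]
    rw [mul_comm c]
    abel_nf
  | hadd m n hm hn => rw [smul_add, map_add, hm, hn, map_add, smul_add, smul_add]; abel

theorem towerτ_leibniz (a : 𝒦) (n : Tower) :
    towerτ τ ε w (a • n) = τ a • n + a • towerτ τ ε w n := by
  induction n using tower_induction with
  | h0 u =>
    simp only [Prod.smul_mk, smul_zero, towerτ_inl, Prod.mk_add_mk, add_zero, smul_eq_mul,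
      Derivation.leibniz]
    rw [add_comm, mul_comm u]
  | h1 k c =>
    simp only [Prod.smul_mk, Finsupp.smul_single, towerτ_single, Prod.mk_add_mk,
      zero_add, mul_zero, smul_eq_mul, Derivation.leibniz, Finsupp.single_add, mul_assoc]
    rw [mul_comm c (τ a), add_comm (Finsupp.single k (a * τ c))]
  | hadd m n hm hn => rw [smul_add, map_add, hm, hn, map_add, smul_add, smul_add]; abel

/-- `τ Gₖ` is defined as `εᵏ w` precisely for this: that value is forced by `τ G₀ = w`, `Gₖ = εᵏ G₀`
and commutation. -/
theorem tower_comm (τ ε : Derivation ℂ 𝒦 𝒦) (w : 𝒦) (h : ∀ z, ε (τ z) = τ (ε z)) (n : Tower) :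
    towerε ε (towerτ τ ε w n) = towerτ τ ε w (towerε ε n) := by
  have hs : ∀ u q, ((u, q) : Tower) = (u, 0) + (0, q) := by simp
  have hs' : ∀ q q', ((0, q + q') : Tower) = (0, q) + (0, q') := by simp
  induction n using tower_induction with
  | h0 u => rw [towerε_inl, towerτ_inl, towerτ_inl, towerε_inl, h]
  | h1 k c =>
    rw [towerε_single, towerτ_single, hs, map_add, towerε_inl, towerε_single, hs' (Finsupp.single k (ε c)),
      map_add, towerτ_single, towerτ_single, h, pow_succ', Module.End.mul_apply]
    simp only [Derivation.leibniz, Prod.mk_add_mk, zero_add, smul_eq_mul]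
    rw [add_zero, add_comm, mul_comm (ε c)]
    rfl
  | hadd m n hm hn => simp only [map_add, hm, hn]

/-- The elements of the tower with components in a subring. -/
def towerSub (A : Subalgebra 𝒪 𝒦) : Submodule 𝒪 Tower where
  carrier := {n | n.1 ∈ A ∧ ∀ k, n.2 k ∈ A}
  add_mem' hm hn := ⟨add_mem hm.1 hn.1, fun k => add_mem (hm.2 k) (hn.2 k)⟩
  zero_mem' := ⟨zero_mem _, fun _ => zero_mem _⟩
  smul_mem' a _ hn := ⟨A.smul_mem hn.1 a, fun k => A.smul_mem (hn.2 k) a⟩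

variable {τ ε w} {A : Subalgebra 𝒪 𝒦}

theorem smul_mem_towerSub {a : 𝒦} (ha : a ∈ A) {n : Tower} (hn : n ∈ towerSub A) :
    a • n ∈ towerSub A :=
  ⟨mul_mem ha hn.1, fun k => mul_mem ha (hn.2 k)⟩

theorem towerε_mem (hε : ∀ z ∈ A, ε z ∈ A) {n : Tower} (hn : n ∈ towerSub A) :
    towerε ε n ∈ towerSub A := by
  refine ⟨hε _ hn.1, fun k => ?_⟩
  change ε (n.2 k) + Finsupp.mapDomain Nat.succ n.2 k ∈ A
  refine add_mem (hε _ (hn.2 k)) ?_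
  cases k with
  | zero =>
    rw [Finsupp.mapDomain_of_notMem_range _ _ (by simp)]
    exact zero_mem _
  | succ k =>
    rw [Finsupp.mapDomain_apply Nat.succ_injective]
    exact hn.2 k

theorem towerτ_mem (hε : ∀ z ∈ A, ε z ∈ A) (hτ : ∀ z ∈ A, τ z ∈ A) (hw : w ∈ A) {n : Tower}
    (hn : n ∈ towerSub A) : towerτ τ ε w n ∈ towerSub A := by
  have hk : ∀ k, ((ε : 𝒦 →ₗ[ℂ] 𝒦) ^ k) w ∈ A := by
    intro k
    induction k with
    | zero => exact hw
    | succ k ih => rw [pow_succ', Module.End.mul_apply]; exact hε _ ih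
  refine ⟨?_, fun k => hτ _ (hn.2 k)⟩
  change τ n.1 + n.2.sum (fun k c => c * ((ε : 𝒦 →ₗ[ℂ] 𝒦) ^ k) w) ∈ A
  exact add_mem (hτ _ hn.1) (sum_mem fun k _ => mul_mem (hn.2 k) (hk k))

end Tower

/-- The mixed second derivatives of a tower element expanded along `τ` and `ε`. The second-order
terms agree by symmetry, which leaves the coefficients of the `ε`-derivative `E` as the only
condition. -/
theorem smul_comm_aux {K V : Type*} [CommRing K] [AddCommGroup V] [Module K V]
    {s₀ s₁ φ₀ φ₁ a b c d : K} {E TT TE EE : V}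
    (h : (s₀ * a + φ₀ * b) • E = (s₁ * c + φ₁ * d) • E) :
    s₀ • (s₁ • TT + (a • E + φ₁ • TE)) + φ₀ • (s₁ • TE + (b • E + φ₁ • EE)) =
      s₁ • (s₀ • TT + (c • E + φ₀ • TE)) + φ₁ • (s₀ • TE + (d • E + φ₀ • EE)) := by
  linear_combination (norm := module) h

/-! ### The homomorphism from the logarithmic ideal to `𝒦 / 𝒪` -/

/-- The pairs `(δ, a)` with `δ f = a f`. -/
abbrev LogPair (f : 𝒪) : Type := {p : Derivation ℂ 𝒪 𝒪 × 𝒪 // p.1 f = p.2 * f}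

/-- The generators `δ + a` of the ideal. -/
noncomputable def logGen (f : 𝒪) (p : LogPair f) : 𝒟 := derOp p.1.1 + mulOp p.1.2

/-- The fraction `x δ(y) / f`. -/
noncomputable def logFrac (f : 𝒪) (p : LogPair f) : 𝒦 :=
  algebraMap 𝒪 𝒦 (coord 0 * p.1.1 (coord 1)) / algebraMap 𝒪 𝒦 f

theorem tildeILog_eq (f : 𝒪) : tildeILog f =
    LinearMap.range (Finsupp.linearCombination 𝒟 (logGen f)) := by
  rw [Finsupp.range_linearCombination, tildeILog, Ideal.span]
  congr 1
  ext P
  constructor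
  · rintro ⟨δ, a, h, rfl⟩
    exact ⟨⟨(δ, a), h⟩, rfl⟩
  · rintro ⟨⟨⟨δ, a⟩, h⟩, rfl⟩
    exact ⟨δ, a, h, rfl⟩

theorem linearCombination_logFrac_mem_awayK {f : 𝒪} (c : LogPair f →₀ 𝒟) :
    Finsupp.linearCombination 𝒟 (logFrac f) c ∈ awayK f := by
  rw [Finsupp.linearCombination_apply]
  refine sum_mem fun p _ => smul_mem_awayK _ ?_
  rw [logFrac, div_eq_mul_inv]
  exact mul_mem (Subalgebra.algebraMap_mem _ _) (inv_mem_awayK f)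

/-- Where `∂ⱼ f` is invertible, `f` and the coordinate other than `j` form a coordinate system. `ε`
is its partial derivative with respect to `f` and `τ` the one along the level curves, so they
commute; `s i` is the `τ`-component of the partial derivative with index `i`. -/
theorem exists_adapted_derivations {f : 𝒪} {j : Fin 2} (hj : partialD j f ≠ 0) :
    ∃ (ε τ : Derivation ℂ 𝒦 𝒦) (s : Fin 2 → 𝒦), (∀ i, s i = 0 ∨ s i = 1) ∧
      (∀ i z, derK i z = s i * τ z + algebraMap 𝒪 𝒦 (partialD i f) * ε z) ∧
      ε (algebraMap 𝒪 𝒦 f) = 1 ∧ τ (algebraMap 𝒪 𝒦 f) = 0 ∧ (∀ z, ε (τ z) = τ (ε z)) ∧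
      (∀ z ∈ awayK (partialD j f), ε z ∈ awayK (partialD j f)) ∧
      ∀ z ∈ awayK (partialD j f), τ z ∈ awayK (partialD j f) := by
  have hinj := IsFractionRing.injective 𝒪 𝒦
  set ι := algebraMap 𝒪 𝒦 with hι
  have hj' : ι (partialD j f) ≠ 0 := (map_ne_zero_iff _ hinj).mpr hj
  obtain ⟨j', hjj'⟩ : ∃ j' : Fin 2, j' ≠ j := exists_ne j
  have hall : ∀ i, i ≠ j → i = j' := by
    intro i hi
    fin_cases i <;> fin_cases j <;> fin_cases j' <;> simp_all
  let ε : Derivation ℂ 𝒦 𝒦 := (ι (partialD j f))⁻¹ • derK j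
  let τ : Derivation ℂ 𝒦 𝒦 := derK j' - ι (partialD j' f) • ε
  have hετ : ∀ z, ε z = (ι (partialD j f))⁻¹ * derK j z := fun z => rfl
  have hττ : ∀ z, τ z = derK j' z - ι (partialD j' f) * ε z := fun z => rfl
  let s : Fin 2 → 𝒦 := fun i => if i = j then 0 else 1
  have hder : ∀ i z, derK i z = s i * τ z + ι (partialD i f) * ε z := by
    intro i z
    by_cases hi : i = j
    · subst hi
      simp only [s, if_true, zero_mul, zero_add]
      rw [hετ, mul_inv_cancel_left₀ hj']
    · have := hall i hi
      subst this
      simp only [s, if_neg hi, one_mul]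
      rw [hττ]
      ring
  have hε1 : ε (ι f) = 1 := by rw [hετ, derK_algebraMap, inv_mul_cancel₀ hj']
  have hτ0 : τ (ι f) = 0 := by rw [hττ, hε1, derK_algebraMap]; ring
  have hcommK : ∀ i i' z, derK i (derK i' z) = derK i' (derK i z) := by
    intro i i' z
    fin_cases i <;> fin_cases i'
    · rfl
    · exact derK_comm z
    · exact (derK_comm z).symm
    · rfl
  have hcommP : ∀ i i', partialD i (partialD i' f) = partialD i' (partialD i f) := fun i i' =>
    hinj (by rw [← derK_algebraMap, ← derK_algebraMap, hcommK, derK_algebraMap, derK_algebraMap])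
  have hcomm : ∀ z, ε (τ z) = τ (ε z) := by
    intro z
    rw [hττ, hττ, map_sub, Derivation.leibniz, hετ (derK j' z), hετ (ι _), derK_algebraMap]
    have h1 : derK j' (ε z) = (ι (partialD j f))⁻¹ * derK j' (derK j z) -
        (ι (partialD j f))⁻¹ * ι (partialD j' (partialD j f)) * ε z := by
      rw [hετ, Derivation.leibniz, Derivation.leibniz_inv, derK_algebraMap]
      simp only [smul_eq_mul]
      ring
    rw [h1, hcommK j' j, hcommP j' j]
    simp only [smul_eq_mul]
    ring
  have hεA : ∀ z ∈ awayK (partialD j f), ε z ∈ awayK (partialD j f) := fun z hz =>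
    mul_mem (inv_mem_awayK _) (derK_mem_awayK j hz)
  refine ⟨ε, τ, s, fun i => ?_, hder, hε1, hτ0, hcomm, hεA, fun z hz =>
    sub_mem (derK_mem_awayK j' hz) (mul_mem (Subalgebra.algebraMap_mem _ _) (hεA z hz))⟩
  by_cases hi : i = j <;> simp [s, hi]

/-- In the tower over `𝒦`, the operator `δ + a` sends `G₀ / f` to `x δ(y) / f` up to an element with
components in `A = 𝒪[1/∂ⱼ f]`. Such elements form a set stable under `𝒟`, so a relation between the
operators, applied to `G₀ / f`, puts the combination of the fractions in `A`. -/
theorem linearCombination_logFrac_mem_awayK_partialD {f : 𝒪} (hf : f ≠ 0) {j : Fin 2}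
    (hj : partialD j f ≠ 0) {c : LogPair f →₀ 𝒟}
    (hc : Finsupp.linearCombination 𝒟 (logGen f) c = 0) :
    Finsupp.linearCombination 𝒟 (logFrac f) c ∈ awayK (partialD j f) := by
  have hinj := IsFractionRing.injective 𝒪 𝒦
  obtain ⟨ε, τ, s, hs, hder, hε1, hτ0, hcomm, hεA, hτA⟩ := exists_adapted_derivations hj
  set ι := algebraMap 𝒪 𝒦 with hι
  have hf' : ι f ≠ 0 := (map_ne_zero_iff _ hinj).mpr hf
  -- The contraction of `x dy` with `τ`, whose formal primitive along `τ` is `G₀`.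
  set w : 𝒦 := ι (coord 0) * τ (ι (coord 1)) with hw
  -- the action of the differential operators on the tower
  let d : Fin 2 → Module.End ℂ Tower := fun i =>
    Algebra.lsmul ℂ ℂ Tower (s i) * towerτ τ ε w + Algebra.lsmul ℂ ℂ Tower (ι (partialD i f)) * towerε ε
  have hd : ∀ i n, d i n = s i • towerτ τ ε w n + ι (partialD i f) • towerε ε n := fun i n => rfl
  have hleib : ∀ i (a : 𝒪) n, d i (a • n) = partialD i a • n + a • d i n := by
    intro i a n
    rw [← algebraMap_smul 𝒦 a n, ← algebraMap_smul 𝒦 a (d i n), ← algebraMap_smul 𝒦 (partialD i a) n,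
      hd, hd, towerε_leibniz, towerτ_leibniz]
    have e := hder i (ι a)
    rw [derK_algebraMap] at e
    rw [e]
    module
  have hsD : ∀ i, τ (s i) = 0 ∧ ε (s i) = 0 := by
    intro i
    rcases hs i with h | h <;> rw [h] <;> simp
  have hdcomm : ∀ n, d 0 (d 1 n) = d 1 (d 0 n) := by
    intro n
    have h1 : (s 0 * τ (ι (partialD 1 f)) + ι (partialD 0 f) * ε (ι (partialD 1 f))) • towerε ε n =
        (s 1 * τ (ι (partialD 0 f)) + ι (partialD 1 f) * ε (ι (partialD 0 f))) • towerε ε n := by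
      rw [← hder, ← hder, derK_algebraMap, derK_algebraMap, partialD_comm]
    simp only [hd, map_add, towerε_leibniz, towerτ_leibniz, tower_comm _ _ _ hcomm, (hsD _).1,
      (hsD _).2, zero_smul, zero_add]
    exact smul_comm_aux h1
  -- This is `G₀ / f`.
  let G : Tower := (0, Finsupp.single 0 (ι f)⁻¹)
  set A := awayK (partialD j f) with hA
  have hmemι : ∀ a, ι a ∈ A := fun a => Subalgebra.algebraMap_mem _ a
  have hwA : w ∈ A := mul_mem (hmemι _) (hτA _ (hmemι _))
  have hsA : ∀ i, s i ∈ A := by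
    intro i
    rcases hs i with h | h <;> rw [h]
    · exact zero_mem _
    · exact one_mem _
  have hstable : ∀ P : 𝒟, ∀ n ∈ towerSub A, opAction hleib hdcomm P n ∈ towerSub A := by
    intro P
    induction P using 𝒟_induction with
    | hmul a => intro n hn; rw [opAction_mulOp]; exact Submodule.smul_mem _ a hn
    | hder i =>
      have hdA : ∀ i, ∀ n ∈ towerSub A, d i n ∈ towerSub A := by
        intro i n hn
        rw [hd]
        exact add_mem (smul_mem_towerSub (hsA i) (towerτ_mem hεA hτA hwA hn))
          (smul_mem_towerSub (hmemι _) (towerε_mem hεA hn))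
      intro n hn
      rw [opAction_derOp]
      exact add_mem (Submodule.smul_mem _ _ (hdA 0 n hn)) (Submodule.smul_mem _ _ (hdA 1 n hn))
    | hadd P Q hP hQ => intro n hn; rw [map_add]; exact add_mem (hP n hn) (hQ n hn)
    | hmul' P Q hP hQ => intro n hn; rw [map_mul]; exact hP _ (hQ n hn)
  have hincl : ∀ (P : 𝒟) (u : 𝒦), opAction hleib hdcomm P (u, 0) = (P • u, 0) := by
    intro P
    induction P using 𝒟_induction with
    | hmul a => intro u; rw [opAction_mulOp, mulOp_smul_𝒦, Prod.smul_mk, smul_zero]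
    | hder i =>
      have hd0 : ∀ i u, d i (u, 0) = (derK i u, 0) := by
        intro i u
        rw [hd, towerε_inl, towerτ_inl, hder, Prod.smul_mk, Prod.smul_mk, smul_zero, smul_zero,
          Prod.mk_add_mk, add_zero, smul_eq_mul, smul_eq_mul]
      intro u
      rw [opAction_derOp, hd0, hd0, derOp_smul_𝒦, Prod.smul_mk, Prod.smul_mk, smul_zero, smul_zero,
        Prod.mk_add_mk, add_zero]
    | hadd P Q hP hQ =>
      intro u
      rw [map_add, LinearMap.add_apply, hP, hQ, add_smul, Prod.mk_add_mk, add_zero]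
    | hmul' P Q hP hQ => intro u; rw [map_mul, Module.End.mul_apply, hQ, hP, mul_smul]
  have hgen : ∀ p : LogPair f,
      ((logFrac f p, 0) : Tower) - opAction hleib hdcomm (logGen f p) G ∈ towerSub A := by
    rintro ⟨⟨δ, a⟩, hδ⟩
    change δ f = a * f at hδ
    have hdG : ∀ i, d i G = (s i * ((ι f)⁻¹ * w),
        ι (partialD i f) • (Finsupp.single 0 (-(ι f)⁻¹ ^ 2) + Finsupp.single 1 (ι f)⁻¹)) := by
      intro i
      rw [hd, towerε_single, towerτ_single, Derivation.leibniz_inv, Derivation.leibniz_inv, hε1, hτ0,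
        smul_zero, Finsupp.single_zero, pow_zero, Module.End.one_apply, Prod.smul_mk, Prod.smul_mk,
        smul_zero, smul_zero, Prod.mk_add_mk, add_zero, zero_add, smul_eq_mul, smul_eq_mul, mul_one]
    have h1 : ι (δ (coord 0)) * ι (partialD 0 f) + ι (δ (coord 1)) * ι (partialD 1 f) =
        ι a * ι f := by
      rw [← map_mul, ← map_mul, ← map_add, ← derivation_apply, hδ, map_mul]
    -- As `τ f = 0` and `ε f = 1`, the condition `δ f = a f` says that the `ε`-component of `δ` is
    -- `a f`. Only the `τ`-component contributes a pole along `f` to `x δ(y) / f`.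
    have h2 : ι (δ (coord 1)) = (ι (δ (coord 0)) * s 0 +
        ι (δ (coord 1)) * s 1) * τ (ι (coord 1)) +
          ι a * ι f * ε (ι (coord 1)) := by
      rw [← h1]
      have h3 := congrArg ι (derivation_apply δ (coord 1))
      rw [map_add, map_mul, map_mul, ← derK_algebraMap, ← derK_algebraMap, hder, hder] at h3
      linear_combination h3
    -- The contribution `a f ε(1/f) = -a / f` to the coefficient of `G₀` cancels the term from
    -- multiplication by `a`. What survives beyond the fraction is `a G₁` and a term regular along
    -- `f`.
    have h4 : ((logFrac f ⟨(δ, a), hδ⟩, 0) : Tower) -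
        opAction hleib hdcomm (logGen f ⟨(δ, a), hδ⟩) G =
          (ι (coord 0) * (ι a * ε (ι (coord 1))), -Finsupp.single 1 (ι a)) := by
      rw [logGen, map_add, LinearMap.add_apply, opAction_derOp, opAction_mulOp, hdG, hdG, logFrac]
      refine Prod.ext ?_ ?_
      · simp only [Prod.fst_sub, Prod.fst_add, Prod.smul_fst, Algebra.smul_def, G, mul_zero, add_zero,
          map_mul, ← hι]
        rw [hw]
        field_simp
        linear_combination ι (coord 0) * h2
      · simp only [Prod.snd_sub, Prod.snd_add, Prod.smul_snd, zero_sub, neg_inj, G]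
        rw [← algebraMap_smul 𝒦, ← algebraMap_smul 𝒦 (δ (coord 1)), ← algebraMap_smul 𝒦 a, smul_smul,
          smul_smul, ← add_smul, ← hι, h1, smul_add, Finsupp.smul_single, Finsupp.smul_single,
          Finsupp.smul_single, add_right_comm, ← Finsupp.single_add]
        simp only [smul_eq_mul]
        rw [mul_inv_cancel_right₀ hf']
        have h5 : ι a * ι f * -(ι f)⁻¹ ^ 2 + ι a * (ι f)⁻¹ = 0 := by field_simp; ring
        rw [h5, Finsupp.single_zero, zero_add]
    rw [h4]
    refine ⟨mul_mem (hmemι _) (mul_mem (hmemι _) (hεA _ (hmemι _))), fun k => ?_⟩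
    change (-Finsupp.single 1 (ι a) : ℕ →₀ 𝒦) k ∈ A
    rw [Finsupp.neg_apply, Finsupp.single_apply]
    split_ifs
    · exact neg_mem (hmemι a)
    · exact neg_mem (zero_mem _)
  have hall' : ∀ c : LogPair f →₀ 𝒟, ((Finsupp.linearCombination 𝒟 (logFrac f) c, 0) : Tower) -
      opAction hleib hdcomm (Finsupp.linearCombination 𝒟 (logGen f) c) G ∈ towerSub A := by
    intro c
    induction c using Finsupp.induction_linear with
    | zero =>
      rw [map_zero, map_zero, map_zero, LinearMap.zero_apply, sub_zero]
      exact zero_mem _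
    | add c c' hc hc' =>
      have := add_mem hc hc'
      have e : ∀ u v : 𝒦, ((u + v, 0) : Tower) = (u, 0) + (v, 0) := by simp
      rwa [map_add, map_add, map_add, LinearMap.add_apply, e, add_sub_add_comm]
    | single p P =>
      rw [Finsupp.linearCombination_single, Finsupp.linearCombination_single, ← hincl, smul_eq_mul,
        map_mul, Module.End.mul_apply, ← map_sub]
      exact hstable P _ (hgen p)
  have h6 := hall' c
  rw [hc, map_zero, LinearMap.zero_apply, sub_zero] at h6
  exact h6.1

/-! ### From vanishing of `Ext²` to a logarithmic field of divergence one -/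

open CategoryTheory Abelian in
/-- If `Ext²(R ⧸ I, A) = 0`, then homomorphisms from `I` to a quotient of modules with kernel `A`
can be lifted. -/
theorem exists_lift_of_subsingleton_ext {R : Type} [Ring R] (I : Ideal R) {A B : Type}
    [AddCommGroup A] [Module R A] [AddCommGroup B] [Module R B] (i : A →ₗ[R] B)
    (hi : Function.Injective i)
    (h : Subsingleton (Ext (ModuleCat.of R (R ⧸ I)) (ModuleCat.of R A) 2))
    (θ : I →ₗ[R] B ⧸ LinearMap.range i) :
    ∃ θ' : I →ₗ[R] B, (LinearMap.range i).mkQ ∘ₗ θ' = θ := by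
  let S : ShortComplex (ModuleCat R) := ShortComplex.mk (ModuleCat.ofHom I.subtype)
    (ModuleCat.ofHom I.mkQ) (by ext x; simp)
  have hS : S.ShortExact := by
    refine ModuleCat.shortComplex_shortExact S ?_ I.injective_subtype I.mkQ_surjective
    exact LinearMap.exact_subtype_mkQ I
  let T : ShortComplex (ModuleCat R) := ShortComplex.mk (ModuleCat.ofHom i)
    (ModuleCat.ofHom (LinearMap.range i).mkQ) (by ext x; simp)
  have hT : T.ShortExact := by
    refine ModuleCat.shortComplex_shortExact T ?_ hi (LinearMap.range i).mkQ_surjective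
    exact LinearMap.exact_map_mkQ_range i
  -- Dimension shift: a class in `Ext¹(I, A)` has zero image in `Ext²(R ⧸ I, A)`, so it comes from
  -- `Ext¹(R, A)`, which is zero because `R` is projective.
  have h1 : ∀ e : Ext S.X₁ T.X₁ 1, e = 0 := by
    intro e
    obtain ⟨e', he'⟩ := Ext.contravariant_sequence_exact₁ hS T.X₁ e (n₁ := 2) rfl
      (Subsingleton.elim (α := Ext (ModuleCat.of R (R ⧸ I)) (ModuleCat.of R A) 2) _ _)
    have hP : Projective S.X₂ := inferInstanceAs (Projective (ModuleCat.of R R))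
    rw [← he', Ext.eq_zero_of_projective e', Ext.comp_zero]
  obtain ⟨e, he⟩ := Ext.covariant_sequence_exact₃ S.X₁ hT
    (Ext.mk₀ (ModuleCat.ofHom θ : S.X₁ ⟶ T.X₃)) (n₁ := 1) rfl (h1 _)
  obtain ⟨g, rfl⟩ := (Ext.mk₀_bijective _ _).2 e
  rw [Ext.mk₀_comp_mk₀] at he
  refine ⟨g.hom, ?_⟩
  have h2 := congrArg ModuleCat.Hom.hom ((Ext.mk₀_bijective _ _).1 he)
  exact h2

/-- A relation between the generators `δ + a` of the logarithmic ideal of a square-free `f` gives a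
relation modulo `𝒪` between the fractions `x δ(y) / f`. -/
theorem linearCombination_logFrac_mem_range {f : 𝒪} (hf : Squarefree f) {c : LogPair f →₀ 𝒟}
    (hc : Finsupp.linearCombination 𝒟 (logGen f) c = 0) :
    Finsupp.linearCombination 𝒟 (logFrac f) c ∈ LinearMap.range inclK := by
  set z := Finsupp.linearCombination 𝒟 (logFrac f) c with hz
  -- The ideal of denominators of `z`. Membership of `z` in `𝒪[1/g]` means that a power of `g` lies
  -- in `J`.
  let J : Ideal 𝒪 := Submodule.comap ((LinearMap.toSpanSingleton 𝒪 𝒦 z))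
    (LinearMap.range (Algebra.linearMap 𝒪 𝒦))
  have hJ : ∀ g, g ∈ J ↔ ∃ a, algebraMap 𝒪 𝒦 g * z = algebraMap 𝒪 𝒦 a := by
    intro g
    change (∃ a, algebraMap 𝒪 𝒦 a = g • z) ↔ _
    simp only [Algebra.smul_def, eq_comm]
  have haway : ∀ g, z ∈ awayK g → g ∈ J.radical := by
    intro g hg
    obtain ⟨k, a, h⟩ := exists_pow_mul_eq hg
    exact ⟨k, (hJ _).mpr ⟨a, h⟩⟩
  have hrad : tjurina f ≤ J.radical := by
    refine Ideal.span_le.mpr ?_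
    have hp : ∀ i, partialD i f ∈ J.radical := by
      intro i
      by_cases hi : partialD i f = 0
      · rw [hi]; exact zero_mem _
      · exact haway _ (linearCombination_logFrac_mem_awayK_partialD hf.ne_zero hi hc)
    rintro g (rfl | rfl | rfl)
    · exact haway _ (linearCombination_logFrac_mem_awayK c)
    · exact hp 0
    · exact hp 1
  obtain ⟨M, hM⟩ := exists_𝔪_pow_le_tjurina hf
  obtain ⟨k, hk⟩ := Ideal.exists_pow_le_of_le_radical_of_fg (hM.trans hrad) (𝔪_pow_fg M)
  rw [← pow_mul] at hk
  obtain ⟨a, ha⟩ := exists_eq_algebraMap fun g hg => (hJ g).mp (hk hg)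
  exact ⟨a, ha.symm⟩

/-- The homomorphism `δ + a ↦ x δ(y) / f` from the logarithmic ideal to `𝒦 / 𝒪`. -/
theorem exists_linearMap_logFrac {f : 𝒪} (hf : Squarefree f) :
    ∃ θ : tildeILog f →ₗ[𝒟] 𝒦 ⧸ LinearMap.range inclK, ∀ (p : LogPair f) (h : logGen f p ∈ tildeILog f),
      θ ⟨logGen f p, h⟩ = (LinearMap.range inclK).mkQ (logFrac f p) := by
  let Φ := (Finsupp.linearCombination 𝒟 (logGen f)).rangeRestrict
  have hΦ : Function.Surjective Φ := LinearMap.surjective_rangeRestrict _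
  let Ψ := (LinearMap.range inclK).mkQ ∘ₗ Finsupp.linearCombination 𝒟 (logFrac f)
  have hker : LinearMap.ker Φ ≤ LinearMap.ker Ψ := by
    intro c hc
    rw [LinearMap.ker_rangeRestrict, LinearMap.mem_ker] at hc
    rw [LinearMap.mem_ker, LinearMap.comp_apply, Submodule.mkQ_apply, Submodule.Quotient.mk_eq_zero]
    exact linearCombination_logFrac_mem_range hf hc
  let e := Φ.quotKerEquivOfSurjective hΦ
  let θ : LinearMap.range (Finsupp.linearCombination 𝒟 (logGen f)) →ₗ[𝒟]
      𝒦 ⧸ LinearMap.range inclK := (Submodule.liftQ _ Ψ hker) ∘ₗ e.symm.toLinearMap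
  rw [tildeILog_eq]
  refine ⟨θ, fun p h => ?_⟩
  have h1 : (⟨logGen f p, h⟩ : LinearMap.range (Finsupp.linearCombination 𝒟 (logGen f))) =
      e (Submodule.Quotient.mk (Finsupp.single p 1)) := by
    apply Subtype.ext
    change _ = Finsupp.linearCombination 𝒟 (logGen f) (Finsupp.single p 1)
    rw [Finsupp.linearCombination_single, one_smul]
  rw [h1]
  change Submodule.liftQ _ Ψ hker (e.symm (e _)) = _
  rw [e.symm_apply_apply, Submodule.liftQ_apply]
  change (LinearMap.range inclK).mkQ (Finsupp.linearCombination 𝒟 (logFrac f) _) = _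
  rw [Finsupp.linearCombination_single, one_smul]

theorem 𝒟_ext {P Q : 𝒟} (h : ∀ g : 𝒪, P • g = Q • g) : P = Q :=
  Subtype.ext (LinearMap.ext h)

/-- If `Ext²(M̃^log, 𝒪) = 0` for a square-free `f`, then there is a logarithmic vector field along
`f` whose divergence is `1`. -/
theorem exists_divergence_eq_one {f : 𝒪} (hf : Squarefree f)
    (h : Subsingleton (CategoryTheory.Abelian.Ext (ModuleCat.of 𝒟 (TildeMLog f))
      (ModuleCat.of 𝒟 𝒪) 2)) :
    ∃ b c a : 𝒪, partialD 0 b + partialD 1 c = 1 ∧ b * partialD 0 f + c * partialD 1 f = a * f := by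
  obtain ⟨θ, hθ⟩ := exists_linearMap_logFrac hf
  obtain ⟨θ', hθ'⟩ := exists_lift_of_subsingleton_ext (tildeILog f) inclK inclK_injective h θ
  have hf0 : algebraMap 𝒪 𝒦 f ≠ 0 :=
    (map_ne_zero_iff _ (IsFractionRing.injective 𝒪 𝒦)).mpr hf.ne_zero
  have hmem : ∀ p : LogPair f, logGen f p ∈ tildeILog f := fun p =>
    Ideal.subset_span ⟨p.1.1, p.1.2, p.2, rfl⟩
  have key : ∀ p : LogPair f, ∃ w : 𝒪, θ' ⟨logGen f p, hmem p⟩ = logFrac f p - algebraMap 𝒪 𝒦 w := by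
    intro p
    have h1 := LinearMap.congr_fun hθ' ⟨logGen f p, hmem p⟩
    rw [hθ, LinearMap.comp_apply, Submodule.mkQ_apply, Submodule.mkQ_apply, eq_comm,
      Submodule.Quotient.eq] at h1
    obtain ⟨w, hw⟩ := h1
    exact ⟨w, by rw [← inclK_apply, hw]; abel⟩
  let px : LogPair f := ⟨(f • partialD 0, partialD 0 f), by
    rw [Derivation.smul_apply, smul_eq_mul, mul_comm]⟩
  let py : LogPair f := ⟨(f • partialD 1, partialD 1 f), by
    rw [Derivation.smul_apply, smul_eq_mul, mul_comm]⟩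
  let pH : LogPair f := ⟨(partialD 1 f • partialD 0 - partialD 0 f • partialD 1, 0), by
    rw [Derivation.sub_apply, Derivation.smul_apply, Derivation.smul_apply, smul_eq_mul, smul_eq_mul]
    ring⟩
  obtain ⟨wx, hx⟩ := key px
  obtain ⟨wy, hy⟩ := key py
  obtain ⟨wH, hH⟩ := key pH
  have hgen : ∀ (p : LogPair f) (g : 𝒪), logGen f p • g = p.1.1 g + p.1.2 * g := by
    intro p g
    rw [logGen, add_smul, derOp_smul_𝒪, mulOp_smul_𝒪]
  -- The generator from `f ∂y` is the composite of multiplication by `f` with `∂y`, and likewise for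
  -- `x`. Both sides are therefore `∂x ∂y` after multiplication by `f`.
  have e1 : derOp (partialD 0) • (⟨logGen f py, hmem py⟩ : tildeILog f) =
      derOp (partialD 1) • ⟨logGen f px, hmem px⟩ := by
    refine Subtype.ext (𝒟_ext fun g => ?_)
    change (derOp (partialD 0) * logGen f py) • g = (derOp (partialD 1) * logGen f px) • g
    rw [mul_smul, mul_smul, hgen, hgen, derOp_smul_𝒪, derOp_smul_𝒪]
    simp only [px, py, Derivation.smul_apply, smul_eq_mul, map_add, Derivation.leibniz]
    rw [partialD_comm g, partialD_comm f]
    ring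
  have e2 : mulOp (partialD 1 f) • (⟨logGen f px, hmem px⟩ : tildeILog f) -
      mulOp (partialD 0 f) • ⟨logGen f py, hmem py⟩ = mulOp f • ⟨logGen f pH, hmem pH⟩ := by
    refine Subtype.ext (𝒟_ext fun g => ?_)
    change (mulOp (partialD 1 f) * logGen f px - mulOp (partialD 0 f) * logGen f py) • g =
      (mulOp f * logGen f pH) • g
    rw [sub_smul, mul_smul, mul_smul, mul_smul, hgen, hgen, hgen, mulOp_smul_𝒪, mulOp_smul_𝒪,
      mulOp_smul_𝒪]
    simp only [px, py, pH, Derivation.smul_apply, Derivation.sub_apply, smul_eq_mul]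
    ring
  have fx : logFrac f px = 0 := by
    simp only [logFrac, px, Derivation.smul_apply, partialD_coord_ne (zero_ne_one (α := Fin 2)), smul_zero,
      mul_zero, map_zero, zero_div]
  have fy : logFrac f py = algebraMap 𝒪 𝒦 (coord 0) := by
    simp only [logFrac, py, Derivation.smul_apply, partialD_coord_self, smul_eq_mul, mul_one, map_mul]
    rw [mul_div_assoc, div_self hf0, mul_one]
  have fH : algebraMap 𝒪 𝒦 f * logFrac f pH = -algebraMap 𝒪 𝒦 (coord 0 * partialD 0 f) := by
    simp only [logFrac, pH, Derivation.sub_apply, Derivation.smul_apply, partialD_coord_self,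
      partialD_coord_ne (zero_ne_one (α := Fin 2)), smul_eq_mul, mul_one, mul_zero, zero_sub]
    rw [mul_div_cancel₀ _ hf0, mul_neg, map_neg]
  -- The first relation becomes the divergence equation, with right side `∂x x = 1`. The second
  -- becomes the logarithmic condition, since the fraction terms `x f_x` cancel.
  have r1 := congrArg θ' e1
  have r2 := congrArg θ' e2
  rw [map_smul, map_smul, hx, hy, fx, fy, zero_sub, ← map_sub, ← map_neg, derOp_partialD_smul_𝒦,
    derOp_partialD_smul_𝒦, derK_algebraMap, derK_algebraMap] at r1
  rw [map_sub, map_smul, map_smul, map_smul, hx, hy, hH, fx, fy, zero_sub, ← map_sub, ← map_neg,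
    mulOp_smul_𝒦, mulOp_smul_𝒦, mulOp_smul_𝒦, smul_sub, Algebra.smul_def, Algebra.smul_def,
    Algebra.smul_def, Algebra.smul_def, fH, ← map_mul, ← map_mul, ← map_mul, ← map_neg, ← map_sub,
    ← map_sub] at r2
  have s1 := IsFractionRing.injective 𝒪 𝒦 r1
  have s2 := IsFractionRing.injective 𝒪 𝒦 r2
  rw [map_sub, partialD_coord_self, map_neg] at s1
  refine ⟨wy, -wx, -wH, ?_, ?_⟩
  · rw [map_neg]
    linear_combination -s1
  · linear_combination s2

/-! ### Solving linear equations for vector fields of Poincaré type -/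

/-- The inverse eigenvalue of the operator `p x ∂x + q y ∂y - l` on the monomial with exponent `n`,
replaced by `0` on the resonant monomials and on those of degree less than `k`. -/
noncomputable def invEig (p q l k : ℕ) (n : Fin 2 →₀ ℕ) : ℂ :=
  if k ≤ n.degree ∧ p * n 0 + q * n 1 ≠ l then ((p * n 0 + q * n 1 : ℂ) - l)⁻¹ else 0

/-- The multiplication of the coefficients with `invEig`. -/
noncomputable def partialInv (p q l k : ℕ) :
    MvPowerSeries (Fin 2) ℂ →ₗ[ℂ] MvPowerSeries (Fin 2) ℂ where
  toFun f := fun n => invEig p q l k n * MvPowerSeries.coeff n f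
  map_add' f g := by ext n; simp only [map_add, mul_add]; rfl
  map_smul' c f := by ext n; simp only [map_smul, smul_eq_mul, mul_left_comm _ c]; rfl

theorem coeff_partialInv (p q l k : ℕ) (f : MvPowerSeries (Fin 2) ℂ) (n : Fin 2 →₀ ℕ) :
    MvPowerSeries.coeff n (partialInv p q l k f) = invEig p q l k n * MvPowerSeries.coeff n f := rfl

/-- Absence of small divisors: a nonzero `M - l` is an integer, so `|M - l| ≥ 1` and `max 1 M ≤ (l +
1) |M - l|`. The factor `m` is there so that a first derivative is bounded too. -/
theorem norm_invEig_mul_le {p q : ℕ} (l k m : ℕ) {n : Fin 2 →₀ ℕ}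
    (hm : m ≤ max 1 (p * n 0 + q * n 1)) : ‖(m : ℂ) * invEig p q l k n‖ ≤ l + 1 := by
  unfold invEig
  split_ifs with h
  · set M := p * n 0 + q * n 1 with hM
    have e : (p * n 0 + q * n 1 : ℂ) - l = (((M : ℤ) - l : ℤ) : ℂ) := by rw [hM]; push_cast; ring
    rw [e, norm_mul, norm_inv, Complex.norm_natCast, Complex.norm_intCast]
    have h1 : (1 : ℝ) ≤ |(((M : ℤ) - l : ℤ) : ℝ)| := by
      have : 1 ≤ |(M : ℤ) - l| := Int.one_le_abs (by have := h.2; omega)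
      exact_mod_cast this
    rw [← div_eq_mul_inv, div_le_iff₀ (by linarith)]
    have h2 : (m : ℝ) ≤ max 1 (M : ℝ) := by exact_mod_cast hm
    have h3 : (M : ℝ) ≤ l + |(((M : ℤ) - l : ℤ) : ℝ)| := by
      have := le_abs_self (((M : ℤ) - l : ℤ) : ℝ)
      push_cast at this ⊢
      linarith
    have h4 : (0 : ℝ) ≤ l := Nat.cast_nonneg _
    rcases le_max_iff.mp h2 with h5 | h5 <;> nlinarith
  · rw [mul_zero, norm_zero]
    positivity

theorem enorm_le_of_norm_le {z : ℂ} {l : ℕ} (h : ‖z‖ ≤ l + 1) : ‖z‖ₑ ≤ (l + 1 : ℝ≥0∞) := by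
  have h1 : ‖z‖₊ ≤ (l + 1 : ℝ≥0) := by exact_mod_cast h
  have h2 : ‖z‖ₑ ≤ ((l + 1 : ℝ≥0) : ℝ≥0∞) := ENNReal.coe_le_coe.mpr h1
  push_cast at h2
  exact h2

theorem wnorm_partialInv_le (ρ : Fin 2 → ℝ≥0) (p q l k : ℕ) (f : MvPowerSeries (Fin 2) ℂ) :
    wnorm ρ (partialInv p q l k f) ≤ (l + 1) * wnorm ρ f := by
  refine wnorm_le_of_coeff_le ρ _ fun n => ?_
  rw [coeff_partialInv, enorm_mul]
  gcongr
  refine enorm_le_of_norm_le ?_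
  simpa using norm_invEig_mul_le (p := p) (q := q) l k 1 (n := n) (le_max_left _ _)

/-- Differentiation multiplies a coefficient by its exponent `n i`, which is at most `p n₀ + q n₁`
because `p, q ≥ 1`. The inverse eigenvalue thus absorbs the loss of a derivative, and `ρ i` accounts
for the shift of exponent. -/
theorem wnorm_pderiv_partialInv_le (ρ : Fin 2 → ℝ≥0) {p q : ℕ} (hp : 1 ≤ p) (hq : 1 ≤ q) (l k : ℕ)
    (i : Fin 2) (f : MvPowerSeries (Fin 2) ℂ) :
    wnorm ρ (MvPowerSeries.pderiv ℂ i (partialInv p q l k f)) * ρ i ≤ (l + 1) * wnorm ρ f := by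
  let g : MvPowerSeries (Fin 2) ℂ := fun n => n i * MvPowerSeries.coeff n (partialInv p q l k f)
  have hg : ∀ n, MvPowerSeries.coeff n g =
    n i * MvPowerSeries.coeff n (partialInv p q l k f) := fun n => rfl
  have e : MvPowerSeries.pderiv ℂ i (partialInv p q l k f) = shift i g := by
    ext n
    rw [MvPowerSeries.coeff_pderiv, coeff_shift, hg, mul_comm]
    simp
  rw [e]
  refine (wnorm_shift_le ρ i g).trans (wnorm_le_of_coeff_le ρ _ fun n => ?_)
  rw [hg, coeff_partialInv, ← mul_assoc, enorm_mul]
  gcongr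
  refine enorm_le_of_norm_le (norm_invEig_mul_le l k _ (le_max_of_le_right ?_))
  have h0 := Nat.mul_le_mul_right (n 0) hp
  have h1 := Nat.mul_le_mul_right (n 1) hq
  fin_cases i <;> simp <;> omega

/-- The perturbation `g₀ ∂x + g₁ ∂y + e` composed with the partial inverse. -/
noncomputable def perturb (p q l k : ℕ) (g : Fin 2 → MvPowerSeries (Fin 2) ℂ)
    (e : MvPowerSeries (Fin 2) ℂ) : MvPowerSeries (Fin 2) ℂ →ₗ[ℂ] MvPowerSeries (Fin 2) ℂ :=
  -((LinearMap.mulLeft ℂ (g 0) ∘ₗ (MvPowerSeries.pderiv ℂ 0).toLinearMap +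
    LinearMap.mulLeft ℂ (g 1) ∘ₗ (MvPowerSeries.pderiv ℂ 1).toLinearMap + LinearMap.mulLeft ℂ e) ∘ₗ
      partialInv p q l k)

theorem wnorm_perturb_le {ρ : Fin 2 → ℝ≥0} {p q : ℕ} (hp : 1 ≤ p) (hq : 1 ≤ q)
    (l k : ℕ) {g : Fin 2 → MvPowerSeries (Fin 2) ℂ} {e : MvPowerSeries (Fin 2) ℂ} {ε : ℝ≥0}
    (hε : 6 * (l + 1) * ε ≤ 1) (hg : ∀ i, wnorm ρ (g i) ≤ ε * ρ i) (he : wnorm ρ e ≤ ε)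
    (f : MvPowerSeries (Fin 2) ℂ) : wnorm ρ (perturb p q l k g e f) ≤ 2⁻¹ * wnorm ρ f := by
  have h1 : ∀ i, wnorm ρ (g i * MvPowerSeries.pderiv ℂ i (partialInv p q l k f)) ≤
      ε * ((l + 1) * wnorm ρ f) := by
    intro i
    refine (wnorm_mul_le _ _ _).trans ?_
    refine le_trans (mul_le_mul_left (hg i) _) ?_
    rw [mul_assoc, mul_comm (ρ i : ℝ≥0∞)]
    exact mul_le_mul' le_rfl (wnorm_pderiv_partialInv_le ρ hp hq l k i f)
  have h2 : wnorm ρ (e * partialInv p q l k f) ≤ ε * ((l + 1) * wnorm ρ f) :=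
    (wnorm_mul_le _ _ _).trans (mul_le_mul' he (wnorm_partialInv_le ρ p q l k f))
  change wnorm ρ (-(g 0 * MvPowerSeries.pderiv ℂ 0 (partialInv p q l k f) +
    g 1 * MvPowerSeries.pderiv ℂ 1 (partialInv p q l k f) + e * partialInv p q l k f)) ≤ _
  rw [wnorm_neg]
  refine (wnorm_add_le _ _ _).trans ((add_le_add ((wnorm_add_le _ _ _).trans
    (add_le_add (h1 0) (h1 1))) h2).trans ?_)
  -- Three terms of size `(l + 1) ε` each; the constant `6` in the hypothesis leaves a total of one
  -- half.
  have h3 : (3 * (l + 1) * ε : ℝ≥0∞) ≤ 2⁻¹ := by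
    have h4 : 3 * (l + 1) * ε ≤ (2⁻¹ : ℝ≥0) := by
      rw [← mul_le_mul_iff_right₀ (two_pos), mul_inv_cancel₀ two_ne_zero]
      calc 2 * (3 * (l + 1) * ε) = 6 * (l + 1) * ε := by ring
        _ ≤ 1 := hε
    have h5 := ENNReal.coe_le_coe.mpr h4
    push_cast at h5
    exact h5
  calc _ = (3 * (l + 1) * ε : ℝ≥0∞) * wnorm ρ f := by ring
    _ ≤ _ := by gcongr

theorem cf_coord_mul_partialD (i : Fin 2) (f : 𝒪) (n : Fin 2 →₀ ℕ) :
    cf n (coord i * partialD i f) = n i * cf n f := by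
  rw [cf_coord_mul]
  split_ifs with h
  · have h1 : n - Finsupp.single i 1 + Finsupp.single i 1 = n :=
      tsub_add_cancel_of_le (Finsupp.single_le_iff.mpr h)
    rw [cf_partialD, h1, mul_comm]
    congr 1
    rw [Finsupp.tsub_apply, Finsupp.single_eq_same]
    push_cast [h]
    ring
  · have : n i = 0 := by omega
    rw [this]
    simp

/-- The nilpotent term `κ x` in the `y`-component is linear and is not made small by shrinking the
polydisc. It is made small by taking the `x`-radius to be a small fraction `σ` of the `y`-radius
`s`; then `s` is chosen small depending on `σ` to control the rest. -/
theorem exists_radii {h : Fin 2 → 𝒪} (hh : ∀ i, h i ∈ 𝔪 ^ 2) {e : 𝒪} (he : e ∈ 𝔪) (κ : ℂ) (r : 𝒪)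
    {ε : ℝ≥0} (hε : 0 < ε) : ∃ ρ : Fin 2 → ℝ≥0, (∀ i, 0 < ρ i) ∧
      wnorm ρ (toSeries (h 0)) ≤ ε * ρ 0 ∧ wnorm ρ (toSeries (κ • coord 0 + h 1)) ≤ ε * ρ 1 ∧
      wnorm ρ (toSeries e) ≤ ε ∧ wnorm ρ (toSeries r) ≠ ⊤ := by
  obtain ⟨C₀, r₀, hr₀, h0⟩ := exists_wnorm_le (hh 0)
  obtain ⟨C₁, r₁, hr₁, h1⟩ := exists_wnorm_le (hh 1)
  obtain ⟨C₂, r₂, hr₂, h2⟩ := exists_wnorm_le (k := 1) (by rwa [pow_one])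
  obtain ⟨C₃, r₃, hr₃, h3⟩ := exists_wnorm_le (f := r) (k := 0) (by simp)
  set K := ‖κ‖₊ with hK
  -- the ratio of the two radii
  set σ : ℝ≥0 := min 1 (ε / (2 * (K + 1))) with hσ
  have hσ0 : 0 < σ := lt_min one_pos (by positivity)
  have hσ1 : σ ≤ 1 := min_le_left _ _
  have hσK : K * σ ≤ ε / 2 := by
    calc K * σ ≤ (K + 1) * (ε / (2 * (K + 1))) := by
          gcongr
          · exact le_add_of_nonneg_right zero_le_one
          · exact min_le_right _ _
      _ = ε / 2 := by field_simp
  set D := C₀ + C₁ + C₂ + 1 with hD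
  obtain ⟨s, hs, hs0, hs1, hs2, hs3, hsD⟩ : ∃ s : ℝ≥0, 0 < s ∧ s ≤ r₀ ∧ s ≤ r₁ ∧ s ≤ r₂ ∧ s ≤ r₃ ∧
      D * s ≤ ε * σ / 2 := by
    refine ⟨min (min (min r₀ r₁) (min r₂ r₃)) (ε * σ / 2 / D), ?_, ?_, ?_, ?_, ?_, ?_⟩
    · have : 0 < D := by positivity
      exact lt_min (lt_min (lt_min hr₀ hr₁) (lt_min hr₂ hr₃)) (by positivity)
    · exact (min_le_left _ _).trans ((min_le_left _ _).trans (min_le_left _ _))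
    · exact (min_le_left _ _).trans ((min_le_left _ _).trans (min_le_right _ _))
    · exact (min_le_left _ _).trans ((min_le_right _ _).trans (min_le_left _ _))
    · exact (min_le_left _ _).trans ((min_le_right _ _).trans (min_le_right _ _))
    · calc D * _ ≤ D * (ε * σ / 2 / D) := by gcongr; exact min_le_right _ _
        _ = ε * σ / 2 := by have : D ≠ 0 := by positivity
                            field_simp
  let ρ : Fin 2 → ℝ≥0 := ![σ * s, s]
  have hρ0 : ρ 0 = σ * s := rfl
  have hρ1 : ρ 1 = s := rfl
  have hmono : ∀ f, wnorm ρ f ≤ wnorm (fun _ => s) f := wnorm_mono (fun i => by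
    fin_cases i
    · exact mul_le_of_le_one_left zero_le hσ1
    · exact le_rfl)
  have hCs : ∀ C ≤ D, C * s ≤ ε * σ / 2 := fun C hC => le_trans (by gcongr) hsD
  have b0 := hCs C₀ (by rw [hD, add_assoc, add_assoc]; exact le_add_of_nonneg_right zero_le)
  have b1 := hCs C₁ (by
    rw [hD]
    calc C₁ ≤ C₀ + C₁ := le_add_of_nonneg_left zero_le
      _ ≤ _ := by rw [add_assoc _ C₂]; exact le_add_of_nonneg_right zero_le)
  have b2 := hCs C₂ (by
    rw [hD]
    calc C₂ ≤ C₀ + C₁ + C₂ := le_add_of_nonneg_left zero_le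
      _ ≤ _ := le_add_of_nonneg_right zero_le)
  have hεσ : ε * σ / 2 ≤ ε / 2 := by
    gcongr
    exact mul_le_of_le_one_right zero_le hσ1
  refine ⟨ρ, fun i => ?_, ?_, ?_, ?_, ?_⟩
  · fin_cases i
    · exact mul_pos hσ0 hs
    · exact hs
  · refine (hmono _).trans ((h0 s hs0).trans ?_)
    rw [hρ0, ← ENNReal.coe_pow, ← ENNReal.coe_mul, ← ENNReal.coe_mul, ENNReal.coe_le_coe]
    calc C₀ * s ^ 2 = (C₀ * s) * s := by ring
      _ ≤ (ε * σ / 2) * s := by gcongr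
      _ ≤ (ε * σ) * s := by gcongr; exact half_le_self zero_le
      _ = _ := by ring
  · rw [map_add]
    have hx : wnorm ρ (toSeries (κ • coord 0)) ≤ (K * (σ * s) : ℝ≥0) := by
      rw [map_smul]
      refine (wnorm_le_of_coeff_le ρ (g := toSeries (coord 0)) K fun n => ?_).trans ?_
      · rw [map_smul, enorm_smul]; rfl
      · change _ * wnorm ρ (MvPowerSeries.X 0) ≤ _
        rw [wnorm_X, hρ0, ENNReal.coe_mul, ENNReal.coe_mul, ENNReal.coe_mul]
    refine (wnorm_add_le _ _ _).trans ((add_le_add hx ((hmono _).trans (h1 s hs1))).trans ?_)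
    rw [hρ1, ← ENNReal.coe_pow, ← ENNReal.coe_mul, ← ENNReal.coe_mul, ← ENNReal.coe_add,
      ENNReal.coe_le_coe]
    calc K * (σ * s) + C₁ * s ^ 2 = (K * σ + C₁ * s) * s := by ring
      _ ≤ (ε / 2 + ε / 2) * s := by gcongr; exact b1.trans hεσ
      _ = _ := by rw [add_halves]
  · refine (hmono _).trans ((h2 s hs2).trans ?_)
    rw [pow_one, ← ENNReal.coe_mul, ENNReal.coe_le_coe]
    exact b2.trans (hεσ.trans (half_le_self zero_le))
  · refine ne_top_of_le_ne_top ?_ ((hmono _).trans (h3 s hs3))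
    simp

/-- For a vector field `η` with linear part `p x ∂x + (q y + κ x) ∂y`, the equation
`(η - l + e) z = r` can be solved up to resonant monomials. -/
theorem exists_solution_mod_resonant {η : Derivation ℂ 𝒪 𝒪} {p q : ℕ} (hp : 1 ≤ p) (hq : 1 ≤ q)
    {κ : ℂ} (hη₀ : η (coord 0) - (p : ℂ) • coord 0 ∈ 𝔪 ^ 2)
    (hη₁ : η (coord 1) - ((q : ℂ) • coord 1 + κ • coord 0) ∈ 𝔪 ^ 2) (l : ℕ) {k : ℕ} {e r : 𝒪}
    (he : e ∈ 𝔪) (hr : r ∈ 𝔪 ^ k) : ∃ z ∈ 𝔪 ^ k, η z - (l : ℂ) • z + e * z - r ∈ 𝔪 ^ k ∧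
      ∀ n, p * n 0 + q * n 1 ≠ l → cf n (η z - (l : ℂ) • z + e * z - r) = 0 := by
  set h : Fin 2 → 𝒪 := ![η (coord 0) - (p : ℂ) • coord 0,
    η (coord 1) - ((q : ℂ) • coord 1 + κ • coord 0)] with hh
  have hη : ∀ i, η (coord i) ∈ 𝔪 := by
    have h2 : 𝔪 ^ 2 ≤ 𝔪 := Ideal.pow_le_self two_ne_zero
    intro i
    fin_cases i
    · have := add_mem (h2 hη₀) (Submodule.smul_of_tower_mem 𝔪 (p : ℂ) (coord_mem 0))
      rwa [sub_add_cancel] at this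
    · have := add_mem (h2 hη₁) (add_mem (Submodule.smul_of_tower_mem 𝔪 (q : ℂ) (coord_mem 1))
        (Submodule.smul_of_tower_mem 𝔪 κ (coord_mem 0)))
      rwa [sub_add_cancel] at this
  obtain ⟨ρ, hρ, h0, h1, h2, h3⟩ := exists_radii (h := h) (fun i => by fin_cases i <;> assumption)
    he κ r (ε := (6 * (l + 1))⁻¹) (by positivity)
  let g : Fin 2 → 𝒪 := ![h 0, κ • coord 0 + h 1]
  -- The unknown is `z = partialInv w`. The diagonal part `p x ∂x + q y ∂y - l` returns `w` at the
  -- nonresonant exponents of degree at least `k`, and the equation becomes a fixed-point problem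
  -- for `w`.
  obtain ⟨w, hw, hw'⟩ := exists_fixed_point hρ (perturb p q l k (fun i => toSeries (g i)) (toSeries e))
    (wnorm_perturb_le hp hq l k (le_of_eq (mul_inv_cancel₀ (by positivity)))
      (fun i => by fin_cases i <;> assumption) h2) h3
  have hz : wnorm ρ (partialInv p q l k w) ≠ ⊤ :=
    ne_top_of_le_ne_top (ENNReal.mul_ne_top (by finiteness) hw) (wnorm_partialInv_le ρ p q l k w)
  set z : 𝒪 := mk (partialInv p q l k w) (.of_wnorm hρ hz) with hzdef
  set w' : 𝒪 := mk w (.of_wnorm hρ hw) with hwdef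
  have hcz : ∀ n, cf n z = invEig p q l k n * cf n w' := fun n => rfl
  have hw'' : w' = r - (g 0 * partialD 0 z + g 1 * partialD 1 z + e * z) := by
    apply toSeries_injective
    rw [sub_eq_add_neg]
    exact hw'
  have hz𝔪 : z ∈ 𝔪 ^ k := by
    rw [mem_𝔪_pow]
    intro n hn
    rw [hcz, invEig, if_neg (by omega), zero_mul]
  have hmem : η z - (l : ℂ) • z + e * z - r ∈ 𝔪 ^ k :=
    sub_mem (add_mem (sub_mem (derivation_mem_pow hη hz𝔪)
      (Submodule.smul_of_tower_mem (𝔪 ^ k) (l : ℂ) hz𝔪)) (Ideal.mul_mem_left _ _ hz𝔪)) hr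
  refine ⟨z, hz𝔪, hmem, fun n hn => ?_⟩
  by_cases hk : n.degree < k
  · exact mem_𝔪_pow.mp hmem n hk
  have e1 : η z - (l : ℂ) • z + e * z - r = (p : ℂ) • (coord 0 * partialD 0 z) +
      (q : ℂ) • (coord 1 * partialD 1 z) - (l : ℂ) • z - w' := by
    rw [hw'', derivation_apply η z]
    simp only [g, h, Matrix.cons_val_zero, Matrix.cons_val_one, Algebra.smul_def]
    ring
  rw [e1, map_sub, map_sub, map_add, map_smul, map_smul, map_smul, cf_coord_mul_partialD,
    cf_coord_mul_partialD, hcz, invEig, if_pos ⟨not_lt.mp hk, hn⟩]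
  have h4 : (p * n 0 + q * n 1 : ℂ) - l ≠ 0 := by
    rw [sub_ne_zero]
    exact_mod_cast hn
  simp only [smul_eq_mul]
  field_simp
  ring

/-! ### Coordinate systems -/

theorem sub_linear_mem {f : 𝒪} (hf : f ∈ 𝔪) :
    f - (evalHom (partialD 0 f) • coord 0 + evalHom (partialD 1 f) • coord 1) ∈ 𝔪 ^ 2 := by
  rw [𝔪_eq_span, Ideal.mem_span_pair] at hf
  obtain ⟨a, b, rfl⟩ := hf
  have e0 : evalHom (partialD 0 (a * coord 0 + b * coord 1)) = evalHom a := by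
    simp [Derivation.leibniz, partialD_coord_ne]
  have e1 : evalHom (partialD 1 (a * coord 0 + b * coord 1)) = evalHom b := by
    simp [Derivation.leibniz, partialD_coord_ne]
  rw [e0, e1, Algebra.smul_def, Algebra.smul_def, pow_two]
  have e : a * coord 0 + b * coord 1 -
      (algebraMap ℂ 𝒪 (evalHom a) * coord 0 + algebraMap ℂ 𝒪 (evalHom b) * coord 1) =
      (a - algebraMap ℂ 𝒪 (evalHom a)) * coord 0 + (b - algebraMap ℂ 𝒪 (evalHom b)) * coord 1 := by
    ring
  rw [e]
  exact add_mem (Ideal.mul_mem_mul (sub_algebraMap_mem a) (coord_mem 0))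
    (Ideal.mul_mem_mul (sub_algebraMap_mem b) (coord_mem 1))

theorem 𝔪_eq_span_of_sub_mem {u v : 𝒪} (hu : u ∈ 𝔪) (hv : v ∈ 𝔪)
    (h : ∀ i, ∃ w ∈ Ideal.span {u, v}, coord i - w ∈ 𝔪 ^ 2) : 𝔪 = Ideal.span {u, v} := by
  apply le_antisymm
  · have h1 : 𝔪 ^ 1 ≤ Ideal.span {u, v} ⊔ 𝔪 ^ (1 + 1) := by
      have h2 : ∀ i, coord i ∈ Ideal.span {u, v} ⊔ 𝔪 ^ (1 + 1) := by
        intro i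
        obtain ⟨w, hw, hw'⟩ := h i
        rw [← add_sub_cancel w (coord i)]
        exact add_mem (Ideal.mem_sup_left hw) (Ideal.mem_sup_right hw')
      rw [pow_one]
      nth_rewrite 1 [𝔪_eq_span]
      rw [Ideal.span_le]
      rintro _ (rfl | rfl)
      · exact h2 0
      · exact h2 1
    simpa using 𝔪_pow_le_of_le_sup h1
  · rw [Ideal.span_le]
    rintro _ (rfl | rfl)
    · exact hu
    · exact hv

/-- If the Jacobian matrix is invertible, its inverse expresses the coordinates by `u, v` modulo `𝔪
^ 2`, and Nakayama's lemma applies. Conversely, differentiating such expressions at the origin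
produces an inverse of the Jacobian matrix. -/
theorem isCoordinateSystem_iff {u v : 𝒪} : IsCoordinateSystem u v ↔ 𝔪 = Ideal.span {u, v} := by
  constructor
  · rintro ⟨hu, hv, hJ⟩
    rw [← evalHom_apply, map_sub, map_mul, map_mul] at hJ
    have hu' := sub_linear_mem (f := u) hu
    have hv' := sub_linear_mem (f := v) hv
    set a := evalHom (partialD 0 u)
    set b := evalHom (partialD 1 u)
    set c := evalHom (partialD 0 v)
    set d := evalHom (partialD 1 v)
    obtain ⟨Δ, hΔ⟩ : ∃ Δ, Δ = a * d - b * c := ⟨_, rfl⟩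
    rw [← hΔ] at hJ
    have hus : u ∈ Ideal.span {u, v} := Ideal.subset_span (by simp)
    have hvs : v ∈ Ideal.span {u, v} := Ideal.subset_span (by simp)
    have key : ∀ s t : ℂ, s • u + t • v ∈ Ideal.span {u, v} := fun s t =>
      add_mem (Submodule.smul_of_tower_mem _ s hus) (Submodule.smul_of_tower_mem _ t hvs)
    have key' : ∀ s t : ℂ, s • (u - (a • coord 0 + b • coord 1)) +
        t • (v - (c • coord 0 + d • coord 1)) ∈ 𝔪 ^ 2 := fun s t =>
      add_mem (Submodule.smul_of_tower_mem _ s hu') (Submodule.smul_of_tower_mem _ t hv')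
    refine 𝔪_eq_span_of_sub_mem hu hv fun i => ?_
    fin_cases i
    · refine ⟨_, key (d / Δ) (-b / Δ), ?_⟩
      convert neg_mem (key' (d / Δ) (-b / Δ)) using 1
      simp only [Fin.zero_eta]
      match_scalars <;> field_simp <;> rw [hΔ] <;> ring
    · refine ⟨_, key (-c / Δ) (a / Δ), ?_⟩
      convert neg_mem (key' (-c / Δ) (a / Δ)) using 1
      simp only [Fin.mk_one]
      match_scalars <;> field_simp <;> rw [hΔ] <;> ring
  · intro h
    have hu : evalHom u = 0 := mem_𝔪.mp (h ▸ Ideal.subset_span (by simp))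
    have hv : evalHom v = 0 := mem_𝔪.mp (h ▸ Ideal.subset_span (by simp))
    refine ⟨hu, hv, ?_⟩
    have h0 := coord_mem 0
    have h1 := coord_mem 1
    rw [h, Ideal.mem_span_pair] at h0 h1
    obtain ⟨α, β, h0⟩ := h0
    obtain ⟨γ, δ, h1⟩ := h1
    have e : ∀ i j (s t : 𝒪), s * u + t * v = coord j → evalHom s * evalHom (partialD i u) +
        evalHom t * evalHom (partialD i v) = if i = j then 1 else 0 := by
      intro i j s t hst
      have h2 := congrArg (fun g => evalHom (partialD i g)) hst
      simp only [map_add, Derivation.leibniz, smul_eq_mul, map_mul, hu, hv, zero_mul, add_zero,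
        partialD_coord] at h2
      rw [h2]
      split_ifs <;> simp
    have e00 := e 0 0 _ _ h0
    have e10 := e 1 0 _ _ h0
    have e01 := e 0 1 _ _ h1
    have e11 := e 1 1 _ _ h1
    simp only [↓reduceIte, one_ne_zero, zero_ne_one] at e00 e10 e01 e11
    rw [← evalHom_apply, map_sub, map_mul, map_mul]
    intro hJ
    have : (1 : ℂ) = 0 := by
      linear_combination (evalHom α * evalHom δ - evalHom β * evalHom γ) * hJ -
        e00 * (evalHom γ * evalHom (partialD 1 u) + evalHom δ * evalHom (partialD 1 v)) - e11 +
        e10 * (evalHom γ * evalHom (partialD 0 u) + evalHom δ * evalHom (partialD 0 v))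
    exact one_ne_zero this

theorem 𝔪_eq_span_of_sub_coord_mem {u v : 𝒪} (hu : u - coord 0 ∈ 𝔪 ^ 2) (hv : v - coord 1 ∈ 𝔪 ^ 2) :
    𝔪 = Ideal.span {u, v} := by
  have h2 : 𝔪 ^ 2 ≤ 𝔪 := Ideal.pow_le_self two_ne_zero
  refine 𝔪_eq_span_of_sub_mem ?_ ?_ fun i => ?_
  · rw [← sub_add_cancel u (coord 0)]; exact add_mem (h2 hu) (coord_mem 0)
  · rw [← sub_add_cancel v (coord 1)]; exact add_mem (h2 hv) (coord_mem 1)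
  · fin_cases i
    · exact ⟨u, Ideal.subset_span (by simp), by rw [← neg_mem_iff, neg_sub]; exact hu⟩
    · exact ⟨v, Ideal.subset_span (by simp), by rw [← neg_mem_iff, neg_sub]; exact hv⟩

theorem mul_sub_mul_mem {a a' b b' : 𝒪} {s t : ℕ} (ha : a - a' ∈ 𝔪 ^ (s + 1)) (ha' : a' ∈ 𝔪 ^ s)
    (hb : b - b' ∈ 𝔪 ^ (t + 1)) (hb' : b' ∈ 𝔪 ^ t) : a * b - a' * b' ∈ 𝔪 ^ (s + t + 1) := by
  have hb'' : b ∈ 𝔪 ^ t := by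
    rw [← sub_add_cancel b b']
    exact add_mem (Ideal.pow_le_pow_right (Nat.le_succ t) hb) hb'
  have e : a * b - a' * b' = (a - a') * b + a' * (b - b') := by ring
  rw [e]
  refine add_mem ?_ ?_
  · rw [add_right_comm, pow_add]; exact Ideal.mul_mem_mul ha hb''
  · rw [add_assoc, pow_add]; exact Ideal.mul_mem_mul ha' hb

theorem pow_sub_coord_pow_mem {u : 𝒪} {i : Fin 2} (hu : u - coord i ∈ 𝔪 ^ 2) (k : ℕ) :
    u ^ k - coord i ^ k ∈ 𝔪 ^ (k + 1) := by
  induction k with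
  | zero => simp
  | succ k ih =>
    rw [pow_succ u, pow_succ (coord i)]
    exact mul_sub_mul_mem (s := k) (t := 1) ih (Ideal.pow_mem_pow (coord_mem i) k)
      (by rw [one_add_one_eq_two]; exact hu) (by rw [pow_one]; exact coord_mem i)

/-- Polynomials in coordinates tangent to the standard ones are determined modulo the powers of the
maximal ideal by their coefficients. -/
theorem coeff_eq_zero_of_aeval_mem {u v : 𝒪} (hu : u - coord 0 ∈ 𝔪 ^ 2) (hv : v - coord 1 ∈ 𝔪 ^ 2)
    {K : ℕ} {Q : MvPolynomial (Fin 2) ℂ} (hQ : MvPolynomial.aeval ![u, v] Q ∈ 𝔪 ^ K)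
    (n : Fin 2 →₀ ℕ) (hn : n.degree < K) : Q.coeff n = 0 := by
  obtain ⟨D, hD⟩ : ∃ D, n.degree = D := ⟨_, rfl⟩
  induction D using Nat.strong_induction_on generalizing n with
  | h D ih =>
    -- All terms of `Q` of degree below `D` are already known to vanish, so replacing `u, v` by the
    -- standard coordinates changes the value only in order `D + 1`.
    have h1 : MvPolynomial.aeval ![u, v] Q - MvPolynomial.aeval ![coord 0, coord 1] Q ∈
        𝔪 ^ (D + 1) := by
      rw [Q.as_sum, map_sum, map_sum, ← Finset.sum_sub_distrib]
      refine sum_mem fun m hm => ?_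
      rw [MvPolynomial.aeval_monomial, MvPolynomial.aeval_monomial, ← mul_sub]
      refine Ideal.mul_mem_left _ _ ?_
      have hmD : D ≤ m.degree := by
        by_contra hlt
        exact MvPolynomial.mem_support_iff.mp hm (ih _ (not_le.mp hlt) m (by omega) rfl)
      refine Ideal.pow_le_pow_right (Nat.succ_le_succ hmD) ?_
      rw [Finsupp.prod_fintype _ _ (by simp), Finsupp.prod_fintype _ _ (by simp), Fin.prod_univ_two,
        Fin.prod_univ_two, degree_eq]
      exact mul_sub_mul_mem (pow_sub_coord_pow_mem hu _) (Ideal.pow_mem_pow (coord_mem 0) _)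
        (pow_sub_coord_pow_mem hv _) (Ideal.pow_mem_pow (coord_mem 1) _)
    have h2 := mem_𝔪_pow.mp h1 n (by omega)
    rw [map_sub, cf_aeval_coord, mem_𝔪_pow.mp hQ n hn, zero_sub, neg_eq_zero] at h2
    exact h2

theorem cf_coord_zero_pow (k : ℕ) (n : Fin 2 →₀ ℕ) :
    cf n (coord 0 ^ k) = if n = Finsupp.single 0 k then 1 else 0 := by
  classical
  rw [cf_apply, map_pow, toSeries_coord, MvPowerSeries.coeff_X_pow]

theorem resonant_cases {p q a b : ℕ} (hp : 1 ≤ p) (hq : 1 ≤ q) (h : p * a + q * b = q) :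
    (b = 0 ∧ p * a = q) ∨ (a = 0 ∧ b = 1) := by
  rcases b with _ | _ | b
  · exact Or.inl ⟨rfl, by simpa using h⟩
  · have h1 : p * a = 0 := by omega
    exact Or.inr ⟨(Nat.mul_eq_zero.mp h1).resolve_left (by omega), rfl⟩
  · nlinarith [Nat.zero_le (p * a), Nat.zero_le (q * b)]

/-- Eigenfunctions of a vector field of Poincaré type, up to the resonant term. -/
theorem exists_eigen_coords {η : Derivation ℂ 𝒪 𝒪} {p q : ℕ} (hp : 1 ≤ p) (hpq : p ≤ q)
    {κ : ℂ} (hκ : κ = 0 ∨ p = q) (hη₀ : η (coord 0) - (p : ℂ) • coord 0 ∈ 𝔪 ^ 2)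
    (hη₁ : η (coord 1) - ((q : ℂ) • coord 1 + κ • coord 0) ∈ 𝔪 ^ 2) :
    ∃ (u v : 𝒪) (c : ℂ) (k : ℕ), u - coord 0 ∈ 𝔪 ^ 2 ∧ v - coord 1 ∈ 𝔪 ^ 2 ∧ 1 ≤ k ∧
      η u = (p : ℂ) • u ∧ η v = (q : ℂ) • v + c • u ^ k ∧ (c = 0 ∨ p * k = q) := by
  have hq : 1 ≤ q := hp.trans hpq
  have solve := fun l k r hr => exists_solution_mod_resonant (e := 0) (r := r) (k := k) hp hq hη₀ hη₁
    l (zero_mem _) hr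
  simp only [zero_mul, add_zero] at solve
  -- the first eigenfunction
  obtain ⟨z, hz, hW, hW'⟩ := solve p 2 (-(η (coord 0) - (p : ℂ) • coord 0)) (neg_mem hη₀)
  have hu : η (coord 0 + z) = (p : ℂ) • (coord 0 + z) := by
    have h0 : η z - (p : ℂ) • z - -(η (coord 0) - (p : ℂ) • coord 0) = 0 := by
      refine ext_cf fun n => ?_
      rw [map_zero]
      by_cases hn : p * n 0 + q * n 1 = p
      · refine mem_𝔪_pow.mp hW n ?_
        rw [degree_eq]
        have : p * (n 0 + n 1) ≤ p * 1 := by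
          rw [mul_add]
          have := Nat.mul_le_mul_right (n 1) hpq
          omega
        have := Nat.le_of_mul_le_mul_left this hp
        omega
      · exact hW' n hn
    rw [map_add, smul_add]
    linear_combination h0
  set u := coord 0 + z with hudef
  have hu' : u - coord 0 ∈ 𝔪 ^ 2 := by rwa [hudef, add_sub_cancel_left]
  have hr : -(η (coord 1) - ((q : ℂ) • coord 1 + κ • u)) ∈ 𝔪 ^ 2 := by
    have e : -(η (coord 1) - ((q : ℂ) • coord 1 + κ • u)) =
        κ • (u - coord 0) - (η (coord 1) - ((q : ℂ) • coord 1 + κ • coord 0)) := by module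
    rw [e]
    exact sub_mem (Submodule.smul_of_tower_mem _ κ hu') hη₁
  obtain ⟨z', hz', hV, hV'⟩ := solve q 2 _ hr
  -- The resonant monomials of weight `q` and degree at least `2` are the powers `x ^ k` with `p k =
  -- q`. If one exists then `p ≠ q`, so `κ = 0`, and the error is a multiple of `x ^ k`.
  by_cases hk : ∃ k, 2 ≤ k ∧ p * k = q
  · obtain ⟨k, hk2, hk⟩ := hk
    have hκ0 : κ = 0 := hκ.resolve_right (by rintro rfl; nlinarith)
    subst hκ0
    simp only [zero_smul, add_zero] at hV hV'
    set V := η z' - (q : ℂ) • z' - -(η (coord 1) - (q : ℂ) • coord 1) with hVdef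
    set c := cf (Finsupp.single 0 k) V with hc
    have hVc : V = c • coord 0 ^ k := by
      refine ext_cf fun n => ?_
      rw [map_smul, cf_coord_zero_pow]
      split_ifs with h
      · rw [h, smul_eq_mul, mul_one]
      rw [smul_zero]
      by_cases hn : p * n 0 + q * n 1 = q
      · by_cases hd : n.degree < 2
        · exact mem_𝔪_pow.mp hV n hd
        · exfalso
          rw [degree_eq] at hd
          have hn1 : n 1 = 0 := by
            rcases resonant_cases hp hq hn with h | h <;> omega
          have hn0 : n 0 = k := by
            rw [hn1, mul_zero, add_zero, ← hk] at hn
            exact Nat.eq_of_mul_eq_mul_left hp hn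
          refine h (Finsupp.ext fun i => ?_)
          fin_cases i
          · simpa using hn0
          · simpa using hn1
      · exact hV' n hn
    -- The error `c x ^ k` is traded for `c u ^ k`. Their difference lies in `𝔪 ^ (k + 1)`, where no
    -- monomial has weight `q`, so this correction is exact.
    obtain ⟨z'', hz'', hT, hT'⟩ := solve q (k + 1) (c • (u ^ k - coord 0 ^ k))
      (Submodule.smul_of_tower_mem _ c (pow_sub_coord_pow_mem hu' k))
    have h0 : η z'' - (q : ℂ) • z'' - c • (u ^ k - coord 0 ^ k) = 0 := by
      refine ext_cf fun n => ?_
      rw [map_zero]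
      by_cases hn : p * n 0 + q * n 1 = q
      · refine mem_𝔪_pow.mp hT n ?_
        rw [degree_eq]
        have h1 : p * n 0 + p * n 1 ≤ p * k := by
          rw [hk]
          have := Nat.mul_le_mul_right (n 1) hpq
          omega
        rw [← mul_add] at h1
        have := Nat.le_of_mul_le_mul_left h1 hp
        omega
      · exact hT' n hn
    refine ⟨u, coord 1 + z' + z'', c, k, hu', ?_, by omega, hu, ?_, Or.inr hk⟩
    · rw [add_assoc, add_sub_cancel_left]
      exact add_mem hz' (Ideal.pow_le_pow_right (by omega) hz'')
    · rw [map_add, map_add]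
      have h1 : V - c • coord 0 ^ k = 0 := sub_eq_zero.mpr hVc
      rw [hVdef] at h1
      linear_combination (norm := module) h0 + h1
  · refine ⟨u, coord 1 + z', κ, 1, hu', by rwa [add_sub_cancel_left], le_rfl, hu, ?_, ?_⟩
    · have h0 : η z' - (q : ℂ) • z' - -(η (coord 1) - ((q : ℂ) • coord 1 + κ • u)) = 0 := by
        refine ext_cf fun n => ?_
        rw [map_zero]
        by_cases hn : p * n 0 + q * n 1 = q
        · refine mem_𝔪_pow.mp hV n ?_
          by_contra hd
          rw [degree_eq] at hd
          by_cases hn1 : n 1 = 0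
          · exact hk ⟨n 0, by omega, by rwa [hn1, mul_zero, add_zero] at hn⟩
          · rcases resonant_cases hp hq hn with h | h <;> omega
        · exact hV' n hn
      rw [map_add, pow_one]
      linear_combination (norm := module) h0
    · rwa [mul_one]

/-! ### Eigenfunctions and weighted homogeneous polynomials -/

theorem derivation_aeval (δ : Derivation ℂ 𝒪 𝒪) (u v : 𝒪) (P : MvPolynomial (Fin 2) ℂ) :
    δ (MvPolynomial.aeval ![u, v] P) =
      MvPolynomial.aeval ![u, v] (MvPolynomial.pderiv 0 P) * δ u +
        MvPolynomial.aeval ![u, v] (MvPolynomial.pderiv 1 P) * δ v := by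
  induction P using MvPolynomial.induction_on with
  | C a => simp
  | add P Q hP hQ => simp only [map_add, hP, hQ]; ring
  | mul_X P i hP =>
    rw [map_mul, MvPolynomial.aeval_X, Derivation.leibniz, hP, MvPolynomial.pderiv_mul,
      MvPolynomial.pderiv_mul]
    fin_cases i <;>
      simp [MvPolynomial.pderiv_X, MvPolynomial.aeval_X] <;> ring

theorem aeval_pderiv_coord (i : Fin 2) (P : MvPolynomial (Fin 2) ℂ) :
    MvPolynomial.aeval ![coord 0, coord 1] (MvPolynomial.pderiv i P) =
      partialD i (MvPolynomial.aeval ![coord 0, coord 1] P) := by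
  rw [derivation_aeval]
  fin_cases i <;> simp [partialD_coord]

theorem weight_eq (p q : ℕ) (n : Fin 2 →₀ ℕ) : Finsupp.weight ![p, q] n = p * n 0 + q * n 1 := by
  rw [Finsupp.weight_apply, Finsupp.sum_fintype _ _ (by simp), Fin.sum_univ_two]
  simp [mul_comm]

section Eigen

variable {η : Derivation ℂ 𝒪 𝒪} {p q : ℕ} {u v : 𝒪} {c : ℂ} {k : ℕ} {F : 𝒪} {a₀ : ℂ}

/-- An eigenfunction is modulo every power of the maximal ideal a polynomial in the eigencoordinates
whose terms have the same eigenvalue. -/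
theorem exists_aeval_sub_mem_of_eigen (hη : ∀ i, η (coord i) ∈ 𝔪) (hu : u - coord 0 ∈ 𝔪 ^ 2)
    (hv : v - coord 1 ∈ 𝔪 ^ 2) (hk : 1 ≤ k) (hηu : η u = (p : ℂ) • u)
    (hηv : η v = (q : ℂ) • v + c • u ^ k) (hc : c = 0 ∨ p * k = q) (hF : η F = a₀ • F) (K : ℕ) :
    ∃ P : MvPolynomial (Fin 2) ℂ, (∀ n ∈ P.support, ((p * n 0 + q * n 1 : ℕ) : ℂ) = a₀) ∧
      F - MvPolynomial.aeval ![u, v] P ∈ 𝔪 ^ K := by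
  obtain ⟨P, hP⟩ := exists_aeval_sub_mem_of_eq_span (𝔪_eq_span_of_sub_coord_mem hu hv) K F
  -- `η - a₀` written in the eigencoordinates and applied to `P`. As `F` is annihilated by it and
  -- `η` preserves powers of `𝔪`, the value of `L` lies in `𝔪 ^ K`.
  let L : MvPolynomial (Fin 2) ℂ := MvPolynomial.C (p : ℂ) * (MvPolynomial.X 0 * MvPolynomial.pderiv 0 P) +
    (MvPolynomial.C (q : ℂ) * (MvPolynomial.X 1 * MvPolynomial.pderiv 1 P) + MvPolynomial.C c *
      (MvPolynomial.X 0 ^ k * MvPolynomial.pderiv 1 P)) - MvPolynomial.C a₀ * P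
  have hL : MvPolynomial.aeval ![u, v] L ∈ 𝔪 ^ K := by
    have e : MvPolynomial.aeval ![u, v] L = a₀ • (F - MvPolynomial.aeval ![u, v] P) -
        η (F - MvPolynomial.aeval ![u, v] P) := by
      rw [map_sub η, hF, derivation_aeval, hηu, hηv]
      simp only [L, map_add, map_sub, map_mul, map_pow, MvPolynomial.aeval_X, MvPolynomial.aeval_C,
        Algebra.smul_def, Matrix.cons_val_zero, Matrix.cons_val_one]
      ring
    rw [e]
    exact sub_mem (Submodule.smul_of_tower_mem _ a₀ hP) (derivation_mem_pow hη hP)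
  have hLc : ∀ n : Fin 2 →₀ ℕ, ((p * n 0 + q * n 1 : ℕ) : ℂ) * P.coeff n + c * cf n
      (coord 0 ^ k * partialD 1 (MvPolynomial.aeval ![coord 0, coord 1] P)) - a₀ * P.coeff n =
        L.coeff n := by
    intro n
    rw [← cf_aeval_coord n L]
    simp only [L, map_add, map_sub, map_mul, map_pow, MvPolynomial.aeval_X, MvPolynomial.aeval_C,
      ← Algebra.smul_def, Matrix.cons_val_zero, Matrix.cons_val_one, aeval_pderiv_coord, map_smul,
      cf_coord_mul_partialD, cf_aeval_coord, smul_eq_mul]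
    push_cast
    ring
  -- The resonant term couples the coefficient at `n` to one of the same weight and degree no
  -- larger, with a smaller exponent of `u`. This is why the induction runs on `n 0`.
  have hvanish : ∀ m, ∀ n : Fin 2 →₀ ℕ, n 0 = m → n.degree < K →
      ((p * n 0 + q * n 1 : ℕ) : ℂ) ≠ a₀ → P.coeff n = 0 := by
    intro m
    induction m using Nat.strong_induction_on with
    | h m ih =>
      intro n hm hn ha
      have h1 := hLc n
      rw [coeff_eq_zero_of_aeval_mem hu hv hL n hn] at h1
      have h2 : c * cf n
          (coord 0 ^ k * partialD 1 (MvPolynomial.aeval ![coord 0, coord 1] P)) = 0 := by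
        by_cases hlt : n 0 < k
        · rw [cf_coord_pow_mul 0 k _ n hlt, mul_zero]
        rcases hc with hc | hc
        · rw [hc, zero_mul]
        · obtain ⟨n', rfl⟩ : ∃ n', n = n' + Finsupp.single 0 k :=
            ⟨n - Finsupp.single 0 k, (tsub_add_cancel_of_le
              (Finsupp.single_le_iff.mpr (not_lt.mp hlt))).symm⟩
          rw [cf_coord_pow_mul_add, cf_partialD, cf_aeval_coord,
            ih (n' 0) (by simp at hm; omega) (n' + Finsupp.single 1 1) (by simp)
              (by rw [map_add, Finsupp.degree_single] at hn ⊢; omega) ?_, zero_mul, mul_zero]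
          have e : p * (n' + Finsupp.single 1 1 : Fin 2 →₀ ℕ) 0 +
              q * (n' + Finsupp.single 1 1 : Fin 2 →₀ ℕ) 1 =
              p * (n' + Finsupp.single 0 k : Fin 2 →₀ ℕ) 0 +
                q * (n' + Finsupp.single 0 k : Fin 2 →₀ ℕ) 1 := by
            rw [← hc]
            simp
            ring
          rwa [e]
      rw [h2, add_zero, ← sub_mul] at h1
      exact (mul_eq_zero.mp h1).resolve_left (sub_ne_zero.mpr ha)
  classical
  let P' : MvPolynomial (Fin 2) ℂ := ∑ n ∈ P.support.filter
    (fun n => ((p * n 0 + q * n 1 : ℕ) : ℂ) = a₀), MvPolynomial.monomial n (P.coeff n)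
  have hP' : ∀ n, P'.coeff n = if ((p * n 0 + q * n 1 : ℕ) : ℂ) = a₀ then P.coeff n else 0 := by
    intro n
    simp only [P', MvPolynomial.coeff_sum, MvPolynomial.coeff_monomial, Finset.sum_ite_eq',
      Finset.mem_filter, MvPolynomial.mem_support_iff]
    split_ifs <;> simp_all
  refine ⟨P', fun n hn => ?_, ?_⟩
  · by_contra hne
    rw [MvPolynomial.mem_support_iff, hP', if_neg hne] at hn
    exact hn rfl
  · have h2 : 𝔪 ^ 2 ≤ 𝔪 := Ideal.pow_le_self two_ne_zero
    have hu𝔪 : u ∈ 𝔪 := by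
      rw [← sub_add_cancel u (coord 0)]; exact add_mem (h2 hu) (coord_mem 0)
    have hv𝔪 : v ∈ 𝔪 := by
      rw [← sub_add_cancel v (coord 1)]; exact add_mem (h2 hv) (coord_mem 1)
    rw [← sub_add_sub_cancel F (MvPolynomial.aeval ![u, v] P), ← map_sub]
    refine add_mem hP ?_
    rw [(P - P').as_sum, map_sum]
    refine sum_mem fun n hn => ?_
    rw [MvPolynomial.aeval_monomial]
    refine Ideal.mul_mem_left _ _ ?_
    have hnK : K ≤ n.degree := by
      by_contra hlt
      rw [MvPolynomial.mem_support_iff, MvPolynomial.coeff_sub, hP'] at hn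
      split_ifs at hn with h
      · exact hn (sub_self _)
      · rw [hvanish (n 0) n rfl (not_le.mp hlt) h, sub_zero] at hn
        exact hn rfl
    refine Ideal.pow_le_pow_right hnK ?_
    rw [Finsupp.prod_fintype _ _ (by simp), Fin.prod_univ_two, degree_eq, pow_add]
    exact Ideal.mul_mem_mul (Ideal.pow_mem_pow hu𝔪 _) (Ideal.pow_mem_pow hv𝔪 _)

/-- An eigenfunction is a weighted homogeneous polynomial in the eigencoordinates. -/
theorem exists_weightedHomogeneous_of_eigen (hp : 1 ≤ p) (hq : 1 ≤ q) (hη : ∀ i, η (coord i) ∈ 𝔪)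
    (hu : u - coord 0 ∈ 𝔪 ^ 2) (hv : v - coord 1 ∈ 𝔪 ^ 2) (hk : 1 ≤ k) (hηu : η u = (p : ℂ) • u)
    (hηv : η v = (q : ℂ) • v + c • u ^ k) (hc : c = 0 ∨ p * k = q) (hF : η F = a₀ • F)
    (hF0 : F ≠ 0) : ∃ (d : ℕ) (P : MvPolynomial (Fin 2) ℂ), a₀ = d ∧
      P.IsWeightedHomogeneous ![p, q] d ∧ F = MvPolynomial.aeval ![u, v] P := by
  choose P hPs hP using exists_aeval_sub_mem_of_eigen hη hu hv hk hηu hηv hc hF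
  -- If `a₀` were not a natural number, no monomial could occur in any approximation, and `F` would
  -- lie in all powers of `𝔪`.
  obtain ⟨d, hd⟩ : ∃ d : ℕ, a₀ = d := by
    by_contra hd
    refine hF0 (eq_zero_of_forall_mem 0 fun K _ => ?_)
    have h0 : P K = 0 := by
      rw [← MvPolynomial.support_eq_empty, Finset.eq_empty_iff_forall_notMem]
      exact fun n hn => hd ⟨_, (hPs K n hn).symm⟩
    simpa [h0] using hP K
  have hdeg : ∀ K, ∀ n ∈ (P K).support, p * n 0 + q * n 1 = d := by
    intro K n hn
    have := hPs K n hn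
    rw [hd] at this
    exact_mod_cast this
  -- Positive weights bound the degree of monomials of weight `d` by `d`, so the approximations
  -- stabilise.
  have hPK : ∀ K, d + 1 ≤ K → P K = P (d + 1) := by
    intro K hK
    have h1 : MvPolynomial.aeval ![u, v] (P K - P (d + 1)) ∈ 𝔪 ^ (d + 1) := by
      rw [map_sub, ← sub_sub_sub_cancel_left _ _ F]
      exact sub_mem (hP (d + 1)) (Ideal.pow_le_pow_right hK (hP K))
    ext n
    by_cases hn : n.degree < d + 1
    · have := coeff_eq_zero_of_aeval_mem hu hv h1 n hn
      rwa [MvPolynomial.coeff_sub, sub_eq_zero] at this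
    · have h2 : ∀ K, (P K).coeff n = 0 := by
        intro K
        by_contra hne
        have h3 := hdeg K n (MvPolynomial.mem_support_iff.mpr hne)
        rw [degree_eq] at hn
        have h4 := Nat.mul_le_mul_right (n 0) hp
        have h5 := Nat.mul_le_mul_right (n 1) hq
        omega
      rw [h2, h2]
  refine ⟨d, P (d + 1), hd, fun n hn => ?_, ?_⟩
  · rw [weight_eq]
    exact hdeg _ n (MvPolynomial.mem_support_iff.mpr hn)
  · rw [← sub_eq_zero]
    refine eq_zero_of_forall_mem (d + 1) fun K hK => ?_
    rw [← hPK K hK]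
    exact hP K

end Eigen

theorem aeval_mul_weightedHomogeneous {p q d : ℕ} {P : MvPolynomial (Fin 2) ℂ}
    (hP : P.IsWeightedHomogeneous ![p, q] d) (ε u v : 𝒪) :
    MvPolynomial.aeval ![ε ^ p * u, ε ^ q * v] P = ε ^ d * MvPolynomial.aeval ![u, v] P := by
  rw [P.as_sum, map_sum, map_sum, Finset.mul_sum]
  refine Finset.sum_congr rfl fun n hn => ?_
  have h := hP (MvPolynomial.mem_support_iff.mp hn)
  rw [weight_eq] at h
  rw [MvPolynomial.aeval_monomial, MvPolynomial.aeval_monomial, Finsupp.prod_fintype _ _ (by simp),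
    Finsupp.prod_fintype _ _ (by simp), Fin.prod_univ_two, Fin.prod_univ_two, ← h]
  simp only [Matrix.cons_val_zero, Matrix.cons_val_one]
  ring

/-- A series with a logarithmic vector field of Poincaré type is quasi-homogeneous. -/
theorem isQuasiHomogeneous_of_poincare {η : Derivation ℂ 𝒪 𝒪} {p q : ℕ} (hp : 1 ≤ p) (hpq : p ≤ q)
    {κ : ℂ} (hκ : κ = 0 ∨ p = q) (hη₀ : η (coord 0) - (p : ℂ) • coord 0 ∈ 𝔪 ^ 2)
    (hη₁ : η (coord 1) - ((q : ℂ) • coord 1 + κ • coord 0) ∈ 𝔪 ^ 2) {f a : 𝒪} (hf : η f = a * f)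
    (hf0 : f ≠ 0) (hf𝔪 : f ∈ 𝔪) : IsQuasiHomogeneous f := by
  have hq : 1 ≤ q := hp.trans hpq
  have h2 : 𝔪 ^ 2 ≤ 𝔪 := Ideal.pow_le_self two_ne_zero
  have hη : ∀ i, η (coord i) ∈ 𝔪 := by
    intro i
    fin_cases i
    · have := add_mem (h2 hη₀) (Submodule.smul_of_tower_mem 𝔪 (p : ℂ) (coord_mem 0))
      rwa [sub_add_cancel] at this
    · have := add_mem (h2 hη₁) (add_mem (Submodule.smul_of_tower_mem 𝔪 (q : ℂ) (coord_mem 1))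
        (Submodule.smul_of_tower_mem 𝔪 κ (coord_mem 0)))
      rwa [sub_add_cancel] at this
  obtain ⟨u, v, c, k, hu, hv, hk, hηu, hηv, hc⟩ := exists_eigen_coords hp hpq hκ hη₀ hη₁
  set a₀ := evalHom a with ha₀
  -- a unit `ε` such that `ε ^ t * f` is an eigenfunction
  have hε : ∀ t : ℕ, 1 ≤ t → ∃ ε : 𝒪, IsUnit ε ∧ ∃ (d : ℕ) (P : MvPolynomial (Fin 2) ℂ), a₀ = d ∧
      P.IsWeightedHomogeneous ![p, q] d ∧ ε ^ t * f = MvPolynomial.aeval ![u, v] P := by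
    intro t ht
    have ht0 : (t : ℂ) ≠ 0 := by exact_mod_cast (by omega : t ≠ 0)
    set e : 𝒪 := (t : ℂ)⁻¹ • (a - algebraMap ℂ 𝒪 a₀) with he
    have he𝔪 : e ∈ 𝔪 := Submodule.smul_of_tower_mem _ _ (sub_algebraMap_mem a)
    -- The unit `ε = 1 + z` should satisfy `η ε = -e ε`, which turns the multiplier `a` of `f` into
    -- the constant `a₀` for `ε ^ t f`. At eigenvalue `0` only the constant monomial is resonant,
    -- and the error lies in `𝔪`.
    obtain ⟨z, hz, hW, hW'⟩ := exists_solution_mod_resonant hp hq hη₀ hη₁ 0 (k := 1) he𝔪 (r := -e)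
      (by rw [pow_one]; exact neg_mem he𝔪)
    have h0 : η z - ((0 : ℕ) : ℂ) • z + e * z - -e = 0 := by
      refine ext_cf fun n => ?_
      rw [map_zero]
      by_cases hn : p * n 0 + q * n 1 = 0
      · refine mem_𝔪_pow.mp hW n ?_
        have h4 := Nat.mul_le_mul_right (n 0) hp
        have h5 := Nat.mul_le_mul_right (n 1) hq
        rw [degree_eq]
        omega
      · exact hW' n hn
    rw [Nat.cast_zero, zero_smul, sub_zero] at h0
    have hηε : η (1 + z) = -(e * (1 + z)) := by
      rw [map_add, Derivation.map_one_eq_zero]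
      linear_combination h0
    have hunit : IsUnit (1 + z) := by
      rw [pow_one] at hz
      rw [isUnit_iff, map_add, map_one, mem_𝔪.mp hz, add_zero]
      exact one_ne_zero
    refine ⟨1 + z, hunit, ?_⟩
    have hte : (t : 𝒪) * e = a - algebraMap ℂ 𝒪 a₀ := by
      rw [he, Algebra.smul_def, ← mul_assoc, ← map_natCast (algebraMap ℂ 𝒪), ← map_mul,
        mul_inv_cancel₀ ht0, map_one, one_mul]
    refine exists_weightedHomogeneous_of_eigen hp hq hη hu hv hk hηu hηv hc ?_
      (mul_ne_zero (pow_ne_zero _ hunit.ne_zero) hf0)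
    obtain ⟨s, rfl⟩ : ∃ s, t = s + 1 := ⟨t - 1, by omega⟩
    rw [Derivation.leibniz, Derivation.leibniz_pow, hf, hηε, Algebra.smul_def a₀]
    simp only [nsmul_eq_mul, smul_eq_mul, Nat.add_sub_cancel]
    linear_combination -((1 + z) ^ (s + 1) * f) * hte
  -- The exponent `t = 1` serves only to identify the weight `d` and to show `d ≥ 1`. Afterwards `t
  -- = d` is used, so that the unit `ε ^ d` can be absorbed by weighted rescaling with `ε⁻¹`.
  obtain ⟨ε₁, hε₁, d, P₁, hd, hP₁, hf₁⟩ := hε 1 le_rfl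
  have hd1 : 1 ≤ d := by
    by_contra hlt
    have hd0 : d = 0 := by omega
    subst hd0
    have hC : P₁ = MvPolynomial.C (P₁.coeff 0) := by
      ext n
      rw [MvPolynomial.coeff_C]
      split_ifs with h
      · rw [h]
      · by_contra hne
        have h1 := hP₁ hne
        rw [weight_eq] at h1
        refine h (Finsupp.ext fun i => ?_)
        have h4 := Nat.mul_le_mul_right (n 0) hp
        have h5 := Nat.mul_le_mul_right (n 1) hq
        fin_cases i <;> simp <;> omega
    rw [hC, MvPolynomial.aeval_C] at hf₁
    have h3 := congrArg evalHom hf₁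
    rw [map_mul, mem_𝔪.mp hf𝔪, mul_zero, AlgHom.commutes] at h3
    have h4 : P₁.coeff 0 = 0 := h3.symm
    rw [h4, map_zero] at hf₁
    exact mul_ne_zero (pow_ne_zero _ hε₁.ne_zero) hf0 hf₁
  obtain ⟨ε, hε, d', P, hd', hP, hfP⟩ := hε d hd1
  have hdd : d' = d := by exact_mod_cast hd'.symm.trans hd
  subst hdd
  obtain ⟨ω, hω⟩ := hε.exists_left_inv
  have hωu : IsUnit ω := IsUnit.of_mul_eq_one ε hω
  refine ⟨ω ^ p * u, ω ^ q * v, ![p, q], d', P, ?_, fun i => by fin_cases i <;> assumption, hP, ?_⟩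
  · rw [isCoordinateSystem_iff, 𝔪_eq_span_of_sub_coord_mem hu hv, Ideal.span_insert,
      Ideal.span_insert, Ideal.span_singleton_mul_left_unit (hωu.pow p),
      Ideal.span_singleton_mul_left_unit (hωu.pow q)]
  · rw [aeval_mul_weightedHomogeneous hP, ← hfP, ← mul_assoc, ← mul_pow, hω, one_pow, one_mul]

/-! ### Substitution of convergent power series -/

theorem wnorm_pow_le' (ρ : Fin 2 → ℝ≥0) (f : MvPowerSeries (Fin 2) ℂ) (k : ℕ) :
    wnorm ρ (f ^ k) ≤ wnorm ρ f ^ k := by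
  cases k with
  | zero => rw [pow_zero, pow_zero, wnorm_one]
  | succ k => exact wnorm_pow_le ρ f k

/-- Each monomial in the `a i` has `σ`-norm at most its `ρ`-weight. Summing against the coefficients
of `f`, with the order of the nonnegative sums exchanged, gives the bound. -/
theorem wnorm_subst_le {σ ρ : Fin 2 → ℝ≥0} {a : Fin 2 → MvPowerSeries (Fin 2) ℂ}
    (ha : MvPowerSeries.HasSubst a) (h : ∀ i, wnorm σ (a i) ≤ ρ i) (f : MvPowerSeries (Fin 2) ℂ) :
    wnorm σ (MvPowerSeries.subst a f) ≤ wnorm ρ f := by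
  let A : (Fin 2 →₀ ℕ) → MvPowerSeries (Fin 2) ℂ := fun d => d.prod fun s e => a s ^ e
  have hA : ∀ d, wnorm σ (A d) ≤ wt ρ d := by
    intro d
    change wnorm σ (d.prod fun s e => a s ^ e) ≤ _
    rw [Finsupp.prod_fintype _ _ (by simp), Fin.prod_univ_two, wt]
    refine (wnorm_mul_le _ _ _).trans (mul_le_mul' ?_ ?_)
    · exact (wnorm_pow_le' _ _ _).trans (pow_le_pow_left₀ zero_le (h 0) _)
    · exact (wnorm_pow_le' _ _ _).trans (pow_le_pow_left₀ zero_le (h 1) _)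
  have hc : ∀ e, ‖MvPowerSeries.coeff e (MvPowerSeries.subst a f)‖ₑ ≤
      ∑' d, ‖MvPowerSeries.coeff d f‖ₑ * ‖MvPowerSeries.coeff e (A d)‖ₑ := by
    intro e
    rw [MvPowerSeries.coeff_subst ha, finsum_eq_sum _ (MvPowerSeries.coeff_subst_finite ha f e)]
    refine (enorm_sum_le _ _).trans (le_trans (Finset.sum_le_sum fun d _ => ?_)
      (ENNReal.sum_le_tsum _))
    rw [enorm_smul]
  calc wnorm σ (MvPowerSeries.subst a f)
      ≤ ∑' e, ∑' d, ‖MvPowerSeries.coeff d f‖ₑ * ‖MvPowerSeries.coeff e (A d)‖ₑ * wt σ e := by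
        refine ENNReal.tsum_le_tsum fun e => ?_
        rw [ENNReal.tsum_mul_right]
        exact mul_le_mul' (hc e) le_rfl
    _ = ∑' d, ‖MvPowerSeries.coeff d f‖ₑ * wnorm σ (A d) := by
        rw [ENNReal.tsum_comm]
        refine tsum_congr fun d => ?_
        rw [wnorm, ← ENNReal.tsum_mul_left]
        exact tsum_congr fun e => mul_assoc _ _ _
    _ ≤ wnorm ρ f := ENNReal.tsum_le_tsum fun d => mul_le_mul' le_rfl (hA d)

theorem hasSubst_of_mem {u : Fin 2 → 𝒪} (hu : ∀ i, u i ∈ 𝔪) :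
    MvPowerSeries.HasSubst fun i => toSeries (u i) :=
  MvPowerSeries.hasSubst_of_constantCoeff_zero hu

theorem isConvergent_subst {u : Fin 2 → 𝒪} (hu : ∀ i, u i ∈ 𝔪) (f : 𝒪) :
    IsConvergent (MvPowerSeries.subst (fun i => toSeries (u i)) (toSeries f)) := by
  obtain ⟨r, hr, hf⟩ := (isConvergent_iff _).mp (isConvergent_toSeries f)
  have hs : ∀ i, ∃ s : ℝ≥0, 0 < s ∧ ∀ t ≤ s, wnorm (fun _ => t) (toSeries (u i)) ≤ r := by
    intro i
    obtain ⟨C, r₀, hr₀, h⟩ := exists_wnorm_le (f := u i) (k := 1) (by rw [pow_one]; exact hu i)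
    refine ⟨min r₀ (r / (C + 1)), lt_min hr₀ (by positivity), fun t ht => ?_⟩
    refine (h t (ht.trans (min_le_left _ _))).trans ?_
    rw [pow_one, ← ENNReal.coe_mul, ENNReal.coe_le_coe]
    calc C * t ≤ (C + 1) * (r / (C + 1)) := by
          gcongr
          · exact le_add_of_nonneg_right zero_le_one
          · exact ht.trans (min_le_right _ _)
      _ = r := by field_simp
  obtain ⟨s₀, h₀, h₀'⟩ := hs 0
  obtain ⟨s₁, h₁, h₁'⟩ := hs 1
  refine IsConvergent.of_wnorm (ρ := fun _ => min s₀ s₁) (fun _ => lt_min h₀ h₁)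
    (ne_top_of_le_ne_top hf (wnorm_subst_le (hasSubst_of_mem hu) (fun i => ?_) _))
  fin_cases i
  · exact h₀' _ (min_le_left _ _)
  · exact h₁' _ (min_le_right _ _)

/-- The substitution of series without constant term for the coordinates. -/
noncomputable def substHom (u : Fin 2 → 𝒪) (hu : ∀ i, u i ∈ 𝔪) : 𝒪 →ₐ[ℂ] 𝒪 :=
  AlgHom.codRestrict ((MvPowerSeries.substAlgHom (hasSubst_of_mem hu)).comp toSeries)
    convergentSubalgebra (fun f => by
      change IsConvergent (MvPowerSeries.substAlgHom (hasSubst_of_mem hu) (toSeries f))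
      rw [MvPowerSeries.substAlgHom_apply]
      exact isConvergent_subst hu f)

theorem substHom_coord (u : Fin 2 → 𝒪) (hu : ∀ i, u i ∈ 𝔪) (i : Fin 2) :
    substHom u hu (coord i) = u i :=
  toSeries_injective (MvPowerSeries.substAlgHom_X (hasSubst_of_mem hu) i)

theorem algHom_mem_pow {φ : 𝒪 →ₐ[ℂ] 𝒪} (hφ : ∀ i, φ (coord i) ∈ 𝔪) {k : ℕ} {f : 𝒪}
    (hf : f ∈ 𝔪 ^ k) : φ f ∈ 𝔪 ^ k := by
  have h1 : Ideal.map φ 𝔪 ≤ 𝔪 := by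
    nth_rewrite 1 [𝔪_eq_span]
    rw [Ideal.map_span, Ideal.span_le]
    rintro _ ⟨_, rfl | rfl, rfl⟩
    · exact hφ 0
    · exact hφ 1
  have h2 := Ideal.mem_map_of_mem φ hf
  rw [Ideal.map_pow] at h2
  exact Ideal.pow_right_mono h1 k h2

/-- Both homomorphisms preserve the powers of `𝔪`, and they agree on polynomials in the coordinates,
which approximate every series to any order. -/
theorem algHom_ext {φ ψ : 𝒪 →ₐ[ℂ] 𝒪} (hφ : ∀ i, φ (coord i) ∈ 𝔪)
    (h : ∀ i, φ (coord i) = ψ (coord i)) : φ = ψ := by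
  ext f
  rw [← sub_eq_zero]
  refine eq_zero_of_forall_mem 0 fun k _ => ?_
  obtain ⟨P, hP⟩ := exists_aeval_sub_mem_of_eq_span 𝔪_eq_span k f
  have hc : ∀ χ : 𝒪 →ₐ[ℂ] 𝒪, χ (MvPolynomial.aeval ![coord 0, coord 1] P) =
      MvPolynomial.aeval ![χ (coord 0), χ (coord 1)] P := by
    intro χ
    rw [← AlgHom.comp_apply]
    congr 1
    ext i
    fin_cases i <;> simp
  have e : φ f - ψ f = φ (f - MvPolynomial.aeval ![coord 0, coord 1] P) -
      ψ (f - MvPolynomial.aeval ![coord 0, coord 1] P) := by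
    rw [map_sub, map_sub, hc, hc, h, h]
    ring
  rw [e]
  exact sub_mem (algHom_mem_pow hφ hP) (algHom_mem_pow (fun i => h i ▸ hφ i) hP)

/-- The linear forms with coefficient matrix `T`. -/
noncomputable def linForm (T : Matrix (Fin 2) (Fin 2) ℂ) (i : Fin 2) : 𝒪 :=
  T i 0 • coord 0 + T i 1 • coord 1

theorem linForm_mem (T : Matrix (Fin 2) (Fin 2) ℂ) (i : Fin 2) : linForm T i ∈ 𝔪 :=
  add_mem (Submodule.smul_of_tower_mem _ _ (coord_mem 0))
    (Submodule.smul_of_tower_mem _ _ (coord_mem 1))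

theorem linForm_one (i : Fin 2) : linForm 1 i = coord i := by
  revert i
  exact Fin.forall_fin_two.mpr ⟨by simp [linForm], by simp [linForm]⟩

/-- The linear substitution with coefficient matrix `T`. -/
noncomputable def linSubst (T : Matrix (Fin 2) (Fin 2) ℂ) : 𝒪 →ₐ[ℂ] 𝒪 :=
  substHom (linForm T) (linForm_mem T)

theorem linSubst_coord (T : Matrix (Fin 2) (Fin 2) ℂ) (i : Fin 2) :
    linSubst T (coord i) = linForm T i := substHom_coord _ _ i

theorem linSubst_linForm (S T : Matrix (Fin 2) (Fin 2) ℂ) (i : Fin 2) :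
    linSubst S (linForm T i) = linForm (T * S) i := by
  rw [linForm, map_add, map_smul, map_smul, linSubst_coord, linSubst_coord, linForm, linForm, linForm,
    Matrix.mul_apply, Matrix.mul_apply, Fin.sum_univ_two, Fin.sum_univ_two]
  module

theorem linSubst_linSubst {S T : Matrix (Fin 2) (Fin 2) ℂ} (h : T * S = 1) (f : 𝒪) :
    linSubst S (linSubst T f) = f := by
  have h1 : (linSubst S).comp (linSubst T) = AlgHom.id ℂ 𝒪 := by
    refine algHom_ext (fun i => ?_) fun i => ?_
    · rw [AlgHom.comp_apply, linSubst_coord, linSubst_linForm]; exact linForm_mem _ i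
    · rw [AlgHom.comp_apply, linSubst_coord, linSubst_linForm, h, linForm_one]; rfl
  exact DFunLike.congr_fun h1 f

/-! ### Transport of logarithmic vector fields -/

/-- There is a logarithmic vector field along `f` which vanishes at the origin and whose linear part
has the matrix `M`. -/
def HasLogField (f : 𝒪) (M : Matrix (Fin 2) (Fin 2) ℂ) : Prop :=
  ∃ (η : Derivation ℂ 𝒪 𝒪) (a : 𝒪), η f = a * f ∧ ∀ i, η (coord i) - linForm M i ∈ 𝔪 ^ 2

theorem HasLogField.smul {f : 𝒪} {M : Matrix (Fin 2) (Fin 2) ℂ} (h : HasLogField f M) (c : ℂ) :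
    HasLogField f (c • M) := by
  obtain ⟨η, a, hf, hη⟩ := h
  refine ⟨c • η, c • a, ?_, fun i => ?_⟩
  · rw [Derivation.smul_apply, hf, smul_mul_assoc]
  · have e : (c • η) (coord i) - linForm (c • M) i = c • (η (coord i) - linForm M i) := by
      rw [Derivation.smul_apply, linForm, linForm, Matrix.smul_apply, Matrix.smul_apply]
      module
    rw [e]
    exact Submodule.smul_of_tower_mem _ c (hη i)

theorem linSubst_mem (T : Matrix (Fin 2) (Fin 2) ℂ) {k : ℕ} {f : 𝒪} (hf : f ∈ 𝔪 ^ k) :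
    linSubst T f ∈ 𝔪 ^ k :=
  algHom_mem_pow (fun i => by rw [linSubst_coord]; exact linForm_mem T i) hf

theorem squarefree_linSubst {S T : Matrix (Fin 2) (Fin 2) ℂ} (h : T * S = 1) {f : 𝒪}
    (hf : Squarefree f) : Squarefree (linSubst S f) := by
  have h' : S * T = 1 := mul_eq_one_comm.mp h
  rintro x ⟨y, hy⟩
  have h1 : IsUnit (linSubst T x) := by
    refine hf _ ⟨linSubst T y, ?_⟩
    rw [← map_mul, ← map_mul, ← hy, linSubst_linSubst h']
  have h2 := h1.map (linSubst S)
  rwa [linSubst_linSubst h] at h2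

theorem IsQuasiHomogeneous.of_linSubst {S T : Matrix (Fin 2) (Fin 2) ℂ} (h : T * S = 1) {f : 𝒪}
    (hf : IsQuasiHomogeneous (linSubst S f)) : IsQuasiHomogeneous f := by
  have h' : S * T = 1 := mul_eq_one_comm.mp h
  obtain ⟨u, v, w, d, P, huv, hw, hP, hf⟩ := hf
  refine ⟨linSubst T u, linSubst T v, w, d, P, ?_, hw, hP, ?_⟩
  · rw [isCoordinateSystem_iff] at huv ⊢
    have hmem : ∀ g ∈ 𝔪, ∀ R, linSubst R g ∈ 𝔪 := fun g hg R => by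
      rw [← pow_one 𝔪] at hg ⊢
      exact linSubst_mem R hg
    apply le_antisymm
    · intro g hg
      have h1 := hmem g hg S
      rw [huv, Ideal.mem_span_pair] at h1
      obtain ⟨a, b, hab⟩ := h1
      rw [Ideal.mem_span_pair]
      refine ⟨linSubst T a, linSubst T b, ?_⟩
      rw [← map_mul, ← map_mul, ← map_add, hab, linSubst_linSubst h']
    · rw [Ideal.span_le]
      rintro _ (rfl | rfl)
      · exact hmem _ (huv ▸ Ideal.subset_span (by simp)) T
      · exact hmem _ (huv ▸ Ideal.subset_span (by simp)) T
  · rw [← linSubst_linSubst h' f, hf, ← AlgHom.comp_apply]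
    congr 1
    ext i
    fin_cases i <;> simp

/-- Conjugating the derivation by the linear substitution conjugates its linear part to `T M T⁻¹`;
the condition `T M = N T` expresses this without an inverse. -/
theorem HasLogField.linSubst {S T M N : Matrix (Fin 2) (Fin 2) ℂ} (h : T * S = 1)
    (hN : T * M = N * T) {f : 𝒪} (hf : HasLogField f M) : HasLogField (linSubst S f) N := by
  have h' : S * T = 1 := mul_eq_one_comm.mp h
  obtain ⟨η, a, hf, hη⟩ := hf
  let η' : Derivation ℂ 𝒪 𝒪 := Derivation.mk'
    ((PlaneCurve.linSubst S).toLinearMap ∘ₗ (η : 𝒪 →ₗ[ℂ] 𝒪) ∘ₗ (PlaneCurve.linSubst T).toLinearMap)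
    (fun x y => by simp [linSubst_linSubst h, Derivation.leibniz])
  have hη' : ∀ g, η' g = PlaneCurve.linSubst S (η (PlaneCurve.linSubst T g)) := fun g => rfl
  refine ⟨η', PlaneCurve.linSubst S a, ?_, fun i => ?_⟩
  · rw [hη', linSubst_linSubst h', hf, map_mul]
  · have e : η' (coord i) - linForm N i = PlaneCurve.linSubst S
        (T i 0 • (η (coord 0) - linForm M 0) + T i 1 • (η (coord 1) - linForm M 1)) := by
      have e1 : linForm N i = PlaneCurve.linSubst S (linForm (T * M) i) := by
        rw [linSubst_linForm, hN, Matrix.mul_assoc, h, Matrix.mul_one]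
      rw [hη', linSubst_coord, e1, ← map_sub]
      congr 1
      simp only [linForm, map_add, Derivation.map_smul, Matrix.mul_apply, Fin.sum_univ_two]
      module
    rw [e]
    exact linSubst_mem S (add_mem (Submodule.smul_of_tower_mem _ _ (hη 0))
      (Submodule.smul_of_tower_mem _ _ (hη 1)))

/-! ### Eigenvalues of logarithmic vector fields -/

/-- Splits off the pure power of `x`: the part divisible by `v` can later be absorbed into the
cofactor of an approximately invariant curve. -/
theorem exists_decomp_pow {x v : 𝒪} (h : 𝔪 = Ideal.span {x, v}) (n : ℕ) {r : 𝒪}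
    (hr : r ∈ 𝔪 ^ (n + 1)) : ∃ c, ∃ γ ∈ 𝔪 ^ n, r = c * x ^ (n + 1) + γ * v := by
  induction n generalizing r with
  | zero =>
    rw [zero_add, pow_one, h, Ideal.mem_span_pair] at hr
    obtain ⟨a, b, rfl⟩ := hr
    exact ⟨a, b, by simp, by ring⟩
  | succ n ih =>
    rw [pow_succ] at hr
    induction hr using Submodule.mul_induction_on' with
    | mem_mul_mem s hs t ht =>
      obtain ⟨c, γ, hγ, rfl⟩ := ih hs
      obtain ⟨α, β, hαβ⟩ := Ideal.mem_span_pair.mp (h ▸ ht)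
      refine ⟨c * α, c * β * x ^ (n + 1) + γ * t, ?_, ?_⟩
      · refine add_mem (Ideal.mul_mem_left _ _ (Ideal.pow_mem_pow ?_ _)) ?_
        · rw [h]; exact Ideal.subset_span (by simp)
        · rw [pow_succ]; exact Ideal.mul_mem_mul hγ ht
      · linear_combination -(c * x ^ (n + 1)) * hαβ
    | add s _ t _ hs ht =>
      obtain ⟨c, γ, hγ, rfl⟩ := hs
      obtain ⟨c', γ', hγ', rfl⟩ := ht
      exact ⟨c + c', γ + γ', add_mem hγ hγ', by ring⟩

theorem sub_smul_one_mem (f : 𝒪) : f - evalHom f • (1 : 𝒪) ∈ 𝔪 := by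
  rw [← Algebra.algebraMap_eq_smul_one]
  exact sub_algebraMap_mem f

theorem 𝔪_eq_span_coord_pair {i j : Fin 2} (hij : i ≠ j) {v : 𝒪} (hv : v - coord j ∈ 𝔪 ^ 2) :
    𝔪 = Ideal.span {coord i, v} := by
  fin_cases i <;> fin_cases j
  · exact absurd rfl hij
  · exact 𝔪_eq_span_of_sub_coord_mem (by simp) hv
  · rw [Set.pair_comm]
    exact 𝔪_eq_span_of_sub_coord_mem hv (by simp)
  · exact absurd rfl hij

/-- On the smooth curve `v = 0`, the coordinate with index `i` is a parameter, so none of its powers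
vanishes there. Comparing lowest-order terms raises the order of `β` step by step up to `M - 1`;
then `xⱼ β` would have to contain a pure power of `xᵢ`. -/
theorem mul_coord_pow_ne {i j : Fin 2} (hij : i ≠ j) {v : 𝒪} (hv : v - coord j ∈ 𝔪 ^ 2) (M : ℕ)
    (β : 𝒪) : coord i ^ M ≠ β * v := by
  intro h
  have hx : ∀ n : Fin 2 →₀ ℕ, n.degree < M → cf n (β * v) = 0 := by
    rw [← h]
    exact mem_𝔪_pow.mp (Ideal.pow_mem_pow (coord_mem i) M)
  have hstep : ∀ s, β ∈ 𝔪 ^ s → ∀ n : Fin 2 →₀ ℕ, n.degree < s + 2 →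
      cf n (β * v) = cf n (coord j * β) := by
    intro s hs n hn
    have h1 : β * (v - coord j) ∈ 𝔪 ^ (s + 2) := by rw [pow_add]; exact Ideal.mul_mem_mul hs hv
    have h2 := mem_𝔪_pow.mp h1 n hn
    rwa [mul_sub, map_sub, sub_eq_zero, mul_comm β (coord j)] at h2
  have hβ : ∀ s, s + 1 ≤ M → β ∈ 𝔪 ^ s := by
    intro s
    induction s with
    | zero => simp
    | succ s ih =>
      intro hs
      rw [mem_𝔪_pow]
      intro n hn
      rw [← cf_add_single_coord_mul j, ← hstep s (ih (by omega)) _ (by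
        rw [map_add, Finsupp.degree_single]; omega)]
      exact hx _ (by rw [map_add, Finsupp.degree_single]; omega)
  have h3 : cf (Finsupp.single i M) (coord j * β) = 0 := by
    rw [cf_coord_mul, if_neg]
    simp [hij.symm]
  have h4 : cf (Finsupp.single i M) (coord i ^ M) = 1 := by
    have := cf_coord_pow_mul_add i M 1 0
    rw [mul_one, zero_add, cf_zero, map_one] at this
    exact this
  rw [h, hstep (M - 1) ?_ _ (by rw [Finsupp.degree_single]; omega), h3] at h4
  · exact zero_ne_one h4
  · cases M with
    | zero => simp
    | succ M => exact hβ _ le_rfl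

section

variable {η : Derivation ℂ 𝒪 𝒪} {l : Fin 2 → ℂ}

theorem apply_coord_mem (hη : ∀ k, η (coord k) - l k • coord k ∈ 𝔪 ^ 2) (k : Fin 2) :
    η (coord k) ∈ 𝔪 := by
  have := add_mem (Ideal.pow_le_self two_ne_zero (hη k))
    (Submodule.smul_of_tower_mem 𝔪 (l k) (coord_mem k))
  rwa [sub_add_cancel] at this

/-- A smooth curve tangent to a coordinate axis which is invariant to a high order. -/
theorem exists_invariant_curve (hη : ∀ k, η (coord k) - l k • coord k ∈ 𝔪 ^ 2) {i j : Fin 2}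
    (hij : i ≠ j) (hres : ∀ n : ℕ, 2 ≤ n → n * l i ≠ l j) (N : ℕ) :
    ∃ v β : 𝒪, v - coord j ∈ 𝔪 ^ 2 ∧ evalHom β = l j ∧ η v - β * v ∈ 𝔪 ^ (N + 2) := by
  induction N with
  | zero =>
    refine ⟨coord j, algebraMap ℂ 𝒪 (l j), by simp, AlgHom.commutes _ _, ?_⟩
    rw [← Algebra.smul_def]
    exact hη j
  | succ N ih =>
    obtain ⟨v, β, hv, hβ, hr⟩ := ih
    obtain ⟨c, γ, hγ, hcγ⟩ := exists_decomp_pow (𝔪_eq_span_coord_pair hij hv) (N + 1) hr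
    have hγ0 : evalHom γ = 0 := mem_𝔪.mp (Ideal.pow_le_self (Nat.succ_ne_zero N) hγ)
    have hne : ((N + 2 : ℕ) : ℂ) * l i - l j ≠ 0 := sub_ne_zero.mpr (hres _ (by omega))
    -- Adding `d xᵢ ^ (N + 2)` to `v` changes the coefficient of that power in the error by `d ((N +
    -- 2) lᵢ - lⱼ)`, which is nonzero for `d ≠ 0` by nonresonance.
    set d : ℂ := -evalHom c / (((N + 2 : ℕ) : ℂ) * l i - l j) with hd
    refine ⟨v + d • coord i ^ (N + 2), β + γ, ?_, by rw [map_add, hγ0, add_zero, hβ], ?_⟩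
    · rw [add_sub_right_comm]
      refine add_mem hv (Submodule.smul_of_tower_mem _ _ ?_)
      exact Ideal.pow_le_pow_right (by omega) (Ideal.pow_mem_pow (coord_mem i) _)
    · have e : η (v + d • coord i ^ (N + 2)) - (β + γ) * (v + d • coord i ^ (N + 2)) =
          coord i ^ (N + 2) * (c + algebraMap ℂ 𝒪 (d * ((N + 2 : ℕ) * l i)) -
            algebraMap ℂ 𝒪 d * (β + γ)) +
          (algebraMap ℂ 𝒪 d * (N + 2 : ℕ)) *
            (coord i ^ (N + 1) * (η (coord i) - l i • coord i)) := by
        rw [map_add, Derivation.map_smul, Derivation.leibniz_pow, nsmul_eq_mul, smul_eq_mul]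
        simp only [Algebra.smul_def, map_mul, map_natCast,
          show N + 2 - 1 = N + 1 by omega]
        linear_combination hcγ
      rw [e]
      refine add_mem ?_ (Ideal.mul_mem_left _ _ ?_)
      · rw [pow_succ]
        refine Ideal.mul_mem_mul (Ideal.pow_mem_pow (coord_mem i) _) ?_
        have hE : ∀ z, evalHom (algebraMap ℂ 𝒪 z) = z := AlgHom.commutes evalHom
        rw [mem_𝔪]
        simp only [map_sub, map_add, map_mul, hE, hγ0, hβ]
        rw [hd]
        field_simp
        ring
      · rw [show N + 1 + 2 = (N + 1) + 2 by omega, pow_add]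
        exact Ideal.mul_mem_mul (Ideal.pow_mem_pow (coord_mem i) _) (hη i)

theorem partialD_derivation (η : Derivation ℂ 𝒪 𝒪) (k : Fin 2) (f : 𝒪) :
    partialD k (η f) = η (partialD k f) + (partialD k (η (coord 0)) * partialD 0 f +
      partialD k (η (coord 1)) * partialD 1 f) := by
  rw [derivation_apply η f, derivation_apply η (partialD k f)]
  simp only [map_add, Derivation.leibniz, smul_eq_mul]
  have h : ∀ k, partialD k (partialD 0 f) = partialD 0 (partialD k f) ∧
      partialD k (partialD 1 f) = partialD 1 (partialD k f) := by
    intro k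
    fin_cases k
    · exact ⟨rfl, partialD_comm f⟩
    · exact ⟨(partialD_comm f).symm, rfl⟩
  rw [(h k).1, (h k).2]
  ring

end

/-- A relation between the eigenvalues of the linear part of a logarithmic vector field. -/
theorem exists_eigenvalue_relation {f : 𝒪} (hf : Squarefree f) {η : Derivation ℂ 𝒪 𝒪} {a : 𝒪}
    (hηf : η f = a * f) {l : Fin 2 → ℂ} (hη : ∀ k, η (coord k) - l k • coord k ∈ 𝔪 ^ 2)
    {i j : Fin 2} (hij : i ≠ j) (hres : ∀ n : ℕ, 2 ≤ n → n * l i ≠ l j)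
    (hJ : tjurina f ≤ Ideal.span {coord j} ⊔ 𝔪 ^ 2) :
    ∃ M : ℕ, 2 ≤ M ∧ (M * l i = evalHom a ∨ ∃ k, M * l i = evalHom a - l k) := by
  classical
  obtain ⟨N, hN⟩ := exists_𝔪_pow_le_tjurina hf
  obtain ⟨v, β, hv, hβ, hr⟩ := exists_invariant_curve hη hij hres N
  have hspan := 𝔪_eq_span_coord_pair hij hv
  have hηi := apply_coord_mem hη i
  set x := coord i with hx
  have hx𝔪 : x ∈ 𝔪 := coord_mem i
  have hex : ∃ M, x ^ M ∈ tjurina f ⊔ Ideal.span {v} :=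
    ⟨N, Ideal.mem_sup_left (hN (Ideal.pow_mem_pow hx𝔪 N))⟩
  -- `M` is the order to which the Tjurina ideal vanishes on the curve `v = 0`, measured by the
  -- parameter `x`.
  set M := Nat.find hex with hM
  have hMmem : x ^ M ∈ tjurina f ⊔ Ideal.span {v} := Nat.find_spec hex
  have hMmin : ∀ m < M, x ^ m ∉ tjurina f ⊔ Ideal.span {v} := fun m hm => Nat.find_min hex hm
  have hMN : M ≤ N := Nat.find_min' hex (Ideal.mem_sup_left (hN (Ideal.pow_mem_pow hx𝔪 N)))
  -- Modulo `𝔪 ^ 2`, neither the Tjurina ideal nor `v` involves `x`, so `x` is not in their sum.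
  have hM2 : 2 ≤ M := by
    by_contra hlt
    have h1 : x ∈ tjurina f ⊔ Ideal.span {v} := by
      have h2 := Ideal.mul_mem_left _ (x ^ (1 - M)) hMmem
      rwa [← pow_add, Nat.sub_add_cancel (by omega), pow_one] at h2
    have h3 : tjurina f ⊔ Ideal.span {v} ≤ Ideal.span {coord j} ⊔ 𝔪 ^ 2 := by
      refine sup_le hJ ?_
      rw [Ideal.span_singleton_le_iff_mem, ← add_sub_cancel (coord j) v]
      exact add_mem (Ideal.mem_sup_left (Ideal.mem_span_singleton_self _)) (Ideal.mem_sup_right hv)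
    obtain ⟨s, hs, t, ht, hst⟩ := Submodule.mem_sup.mp (h3 h1)
    obtain ⟨b, rfl⟩ := Ideal.mem_span_singleton.mp hs
    have h4 := congrArg (cf (Finsupp.single i 1)) hst
    rw [map_add, mem_𝔪_pow.mp ht _ (by rw [Finsupp.degree_single]; omega), cf_coord_mul,
      if_neg (by simp [hij.symm]), ← mul_one x, hx] at h4
    have h5 := cf_add_single_coord_mul i 1 0
    rw [zero_add, cf_zero, map_one] at h5
    rw [h5, add_zero] at h4
    exact zero_ne_one h4
  -- Modulo `K` the Tjurina ideal becomes the line spanned by `x ^ M`. Since the curve is invariant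
  -- to sufficiently high order, `η` acts on this line by `M lᵢ`. A generator of the Tjurina ideal
  -- with nonzero image is also an eigenvector, and comparing the two eigenvalues gives the
  -- relation.
  set K : Ideal 𝒪 := Ideal.span {x ^ (M + 1), v} with hK
  have hxK : x ^ (M + 1) ∈ K := Ideal.subset_span (by simp)
  have hvK : v ∈ K := Ideal.subset_span (by simp)
  -- multiples of `x ^ M` by elements of the maximal ideal
  have hmx : ∀ m ∈ 𝔪, m * x ^ M ∈ K := by
    intro m hm
    obtain ⟨α, b, rfl⟩ := Ideal.mem_span_pair.mp (hspan ▸ hm)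
    have e : (α * x + b * v) * x ^ M = α * x ^ (M + 1) + (b * x ^ M) * v := by ring
    rw [e]
    exact add_mem (Ideal.mul_mem_left _ _ hxK) (Ideal.mul_mem_left _ _ hvK)
  have hxMK : x ^ M ∉ K := by
    intro h
    obtain ⟨α, b, hab⟩ := Ideal.mem_span_pair.mp h
    have hu : IsUnit (1 - α * x) := by
      rw [isUnit_iff, map_sub, map_mul, mem_𝔪.mp hx𝔪, mul_zero, sub_zero, map_one]
      exact one_ne_zero
    obtain ⟨w, hw⟩ := hu.exists_left_inv
    refine mul_coord_pow_ne hij hv M (w * b) ?_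
    linear_combination -(x ^ M) * hw - w * hab
  have hpowK : 𝔪 ^ (N + 2) ≤ K := by
    intro r hr
    obtain ⟨c, γ, -, rfl⟩ := exists_decomp_pow hspan (N + 1) hr
    refine add_mem (Ideal.mul_mem_left _ _ ?_) (Ideal.mul_mem_left _ _ hvK)
    rw [← Nat.sub_add_cancel (show M + 1 ≤ N + 1 + 1 by omega), pow_add]
    exact Ideal.mul_mem_left _ _ hxK
  -- elements of the Tjurina ideal modulo `K`
  have hJK : ∀ g ∈ tjurina f, ∃ c : ℂ, g - c • x ^ M ∈ K := by
    intro g hg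
    have h1 : ∀ k ≤ M, ∃ α b, g = α * x ^ k + b * v := by
      intro k
      induction k with
      | zero => exact fun _ => ⟨g, 0, by ring⟩
      | succ k ih =>
        intro hk
        obtain ⟨α, b, hαb⟩ := ih (by omega)
        by_cases hα : IsUnit α
        · obtain ⟨w, hw⟩ := hα.exists_left_inv
          refine absurd ?_ (hMmin k (by omega))
          have e : x ^ k = w * g + -(w * b) * v := by
            linear_combination -(x ^ k) * hw - w * hαb
          rw [e]
          exact add_mem (Ideal.mem_sup_left (Ideal.mul_mem_left _ _ hg))
            (Ideal.mem_sup_right (Ideal.mul_mem_left _ _ (Ideal.mem_span_singleton_self v)))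
        · have hα' : α ∈ 𝔪 := by rwa [isUnit_iff, not_not] at hα
          obtain ⟨s, t, rfl⟩ := Ideal.mem_span_pair.mp (hspan ▸ hα')
          exact ⟨s, t * x ^ k + b, by rw [hαb]; ring⟩
    obtain ⟨α, b, rfl⟩ := h1 M le_rfl
    refine ⟨evalHom α, ?_⟩
    have e : α * x ^ M + b * v - evalHom α • x ^ M =
        (α - evalHom α • (1 : 𝒪)) * x ^ M + b * v := by
      rw [sub_mul, smul_mul_assoc, one_mul]
      ring
    rw [e]
    exact add_mem (hmx _ (sub_smul_one_mem α)) (Ideal.mul_mem_left _ _ hvK)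
  have h𝔪JK : ∀ m ∈ 𝔪, ∀ g ∈ tjurina f, m * g ∈ K := by
    intro m hm g hg
    obtain ⟨c, hc⟩ := hJK g hg
    have e : m * g = m * (g - c • x ^ M) + c • (m * x ^ M) := by
      rw [mul_sub, mul_smul_comm]; abel
    rw [e]
    exact add_mem (Ideal.mul_mem_left _ _ hc) (Submodule.smul_of_tower_mem _ c (hmx m hm))
  -- the action of `η` modulo `K`
  have hηx : ∀ m, η (x ^ (m + 1)) = (m + 1 : ℕ) * (x ^ m * η x) := by
    intro m
    rw [Derivation.leibniz_pow, nsmul_eq_mul, smul_eq_mul, Nat.add_sub_cancel]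
  have hηK : ∀ g ∈ K, η g ∈ K := by
    intro g hg
    obtain ⟨α, b, rfl⟩ := Ideal.mem_span_pair.mp hg
    rw [map_add, Derivation.leibniz, Derivation.leibniz, hηx]
    refine add_mem (add_mem (Ideal.mul_mem_left _ _ (Ideal.mul_mem_left _ _ ?_)) ?_)
      (add_mem (Ideal.mul_mem_left _ _ ?_) ?_)
    · rw [mul_comm]; exact hmx _ hηi
    · rw [smul_eq_mul]; exact Ideal.mul_mem_right _ _ hxK
    · rw [← sub_add_cancel (η v) (β * v)]
      exact add_mem (hpowK hr) (Ideal.mul_mem_left _ _ hvK)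
    · rw [smul_eq_mul]; exact Ideal.mul_mem_right _ _ hvK
  have hηxM : η (x ^ M) - (M * l i : ℂ) • x ^ M ∈ K := by
    obtain ⟨m, hm⟩ : ∃ m, M = m + 1 := ⟨M - 1, by omega⟩
    obtain ⟨c, γ, -, hcγ⟩ := exists_decomp_pow hspan 1 (hη i)
    have e : η (x ^ M) - (M * l i : ℂ) • x ^ M =
        (M * c) * x ^ (M + 1) + (M * x ^ m * γ) * v := by
      rw [hm, hηx, Algebra.smul_def, map_mul, map_natCast]
      rw [Algebra.smul_def] at hcγ
      linear_combination ((m + 1 : ℕ) * x ^ m : 𝒪) * hcγ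
    rw [e]
    exact add_mem (Ideal.mul_mem_left _ _ hxK) (Ideal.mul_mem_left _ _ hvK)
  have key : ∀ g ∈ tjurina f, ∀ μ : ℂ, η g - μ • g ∈ K → g ∉ K → M * l i = μ := by
    intro g hg μ hgμ hgK
    obtain ⟨c, hc⟩ := hJK g hg
    by_contra hne
    have hne' : (M * l i : ℂ) - μ ≠ 0 := sub_ne_zero.mpr hne
    have h1 : c • x ^ M ∈ K := by
      have h2 : (c * ((M * l i : ℂ) - μ)) • x ^ M ∈ K := by
        have e : (c * ((M * l i : ℂ) - μ)) • x ^ M = (η g - μ • g) - η (g - c • x ^ M) +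
            μ • (g - c • x ^ M) - c • (η (x ^ M) - (M * l i : ℂ) • x ^ M) := by
          rw [map_sub, Derivation.map_smul]
          module
        rw [e]
        exact sub_mem (add_mem (sub_mem hgμ (hηK _ hc)) (Submodule.smul_of_tower_mem _ μ hc))
          (Submodule.smul_of_tower_mem _ c hηxM)
      have h3 := Submodule.smul_of_tower_mem K ((M * l i : ℂ) - μ)⁻¹ h2
      rwa [smul_smul, mul_comm c, ← mul_assoc, inv_mul_cancel₀ hne', one_mul] at h3
    have h4 := add_mem hc h1
    rw [sub_add_cancel] at h4
    exact hgK h4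
  have hfJ := self_mem_tjurina f
  -- If `f` survives modulo `K`, its eigenvalue is `a(0)`. If not, some `∂ₖ f` survives, with
  -- eigenvalue `a(0) - lₖ`.
  by_cases hfK : f ∈ K
  · have hpart : ∃ k, partialD k f ∉ K := by
      by_contra! hall
      have h1 : tjurina f ≤ K := by
        rw [tjurina, Ideal.span_le]
        rintro _ (rfl | rfl | rfl)
        · exact hfK
        · exact hall 0
        · exact hall 1
      exact hxMK ((sup_le h1 ((Ideal.span_singleton_le_iff_mem _).mpr hvK)) hMmem)
    obtain ⟨k, hk⟩ := hpart
    refine ⟨M, hM2, Or.inr ⟨k, key _ (partialD_mem_tjurina f k) _ ?_ hk⟩⟩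
    have hd : ∀ m, partialD k (η (coord m)) - l m • partialD k (coord m) ∈ 𝔪 := by
      intro m
      have := partialD_mem (k := 1) (hη m) k
      rwa [pow_one, map_sub, Derivation.map_smul] at this
    have hsum : l 0 • (partialD k (coord 0) * partialD 0 f) +
        l 1 • (partialD k (coord 1) * partialD 1 f) = l k • partialD k f := by
      fin_cases k <;> simp [partialD_coord_ne]
    have e : η (partialD k f) - (evalHom a - l k) • partialD k f =
        (a - evalHom a • (1 : 𝒪)) * partialD k f + partialD k a * f -
          ((partialD k (η (coord 0)) - l 0 • partialD k (coord 0)) * partialD 0 f +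
            (partialD k (η (coord 1)) - l 1 • partialD k (coord 1)) * partialD 1 f) := by
      have h1 := partialD_derivation η k f
      rw [hηf, Derivation.leibniz, smul_eq_mul, smul_eq_mul] at h1
      rw [sub_smul, ← hsum]
      simp only [Algebra.smul_def] at h1 ⊢
      linear_combination -h1
    rw [e]
    exact sub_mem (add_mem (h𝔪JK _ (sub_smul_one_mem a) _ (partialD_mem_tjurina f k))
      (Ideal.mul_mem_left _ _ hfK)) (add_mem (h𝔪JK _ (hd 0) _ (partialD_mem_tjurina f 0))
        (h𝔪JK _ (hd 1) _ (partialD_mem_tjurina f 1)))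
  · refine ⟨M, hM2, Or.inl (key f hfJ _ ?_ hfK)⟩
    have e : η f - evalHom a • f = (a - evalHom a • (1 : 𝒪)) * f := by
      rw [hηf, sub_mul, smul_mul_assoc, one_mul]
    rw [e]
    exact h𝔪JK _ (sub_smul_one_mem a) _ hfJ

/-! ### From the linear part to quasi-homogeneity -/

theorem linForm_cons (a b c d : ℂ) (i : Fin 2) : linForm !![a, b; c, d] i =
    ![a • coord 0 + b • coord 1, c • coord 0 + d • coord 1] i := by
  fin_cases i <;> simp [linForm]

/-- Series of order one are quasi-homogeneous. -/
theorem isQuasiHomogeneous_of_notMem {f : 𝒪} (hf : f ∈ 𝔪) (hf2 : f ∉ 𝔪 ^ 2) :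
    IsQuasiHomogeneous f := by
  have h1 : ∃ v, IsCoordinateSystem f v := by
    by_cases h0 : evalHom (partialD 0 f) = 0
    · refine ⟨coord 0, hf, coord_mem 0, fun h => ?_⟩
      rw [← evalHom_apply, partialD_coord_self, partialD_coord_ne one_ne_zero, mul_zero, mul_one,
        zero_sub, map_neg, neg_eq_zero] at h
      have h2 := sub_linear_mem hf
      rw [h0, h, zero_smul, zero_smul, add_zero, sub_zero] at h2
      exact hf2 h2
    · refine ⟨coord 1, hf, coord_mem 1, ?_⟩
      rwa [← evalHom_apply, partialD_coord_self, partialD_coord_ne zero_ne_one, mul_zero, mul_one,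
        sub_zero]
  obtain ⟨v, hv⟩ := h1
  refine ⟨f, v, fun _ => 1, 1, MvPolynomial.X 0, hv, fun _ => one_pos,
    MvPolynomial.isWeightedHomogeneous_X ℂ _ 0, ?_⟩
  simp

/-- Logarithmic vector fields along a reduced singular curve vanish at the singular point. -/
theorem apply_coord_mem_of_log {f : 𝒪} (hf : Squarefree f) (hf2 : f ∈ 𝔪 ^ 2)
    {η : Derivation ℂ 𝒪 𝒪} {a : 𝒪} (hη : η f = a * f) (i : Fin 2) : η (coord i) ∈ 𝔪 := by
  classical
  have hJ𝔪 : tjurina f ≤ 𝔪 := by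
    have hp : ∀ i, partialD i f ∈ 𝔪 := fun i => by
      have := partialD_mem (k := 1) hf2 i
      rwa [pow_one] at this
    rw [tjurina, Ideal.span_le]
    rintro _ (rfl | rfl | rfl)
    · exact Ideal.pow_le_self two_ne_zero hf2
    · exact hp 0
    · exact hp 1
  -- The Tjurina ideal is stable under `η`. If `η xᵢ` were a unit, applying `η` to the least power
  -- of `xᵢ` in the ideal would produce a smaller one.
  have hηJ : ∀ g ∈ tjurina f, η g ∈ tjurina f := by
    intro g hg
    rw [tjurina] at hg
    refine Submodule.span_induction ?_ (by rw [map_zero]; exact zero_mem _)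
      (fun x y _ _ hx hy => by rw [map_add]; exact add_mem hx hy) (fun b x hx hx' => ?_) hg
    · have hp : ∀ k, η (partialD k f) ∈ tjurina f := by
        intro k
        have h1 := partialD_derivation η k f
        rw [hη, Derivation.leibniz, smul_eq_mul, smul_eq_mul] at h1
        rw [eq_sub_of_add_eq h1.symm]
        exact sub_mem (add_mem (Ideal.mul_mem_left _ _ (partialD_mem_tjurina f k))
          (Ideal.mul_mem_right _ _ (self_mem_tjurina f)))
          (add_mem (Ideal.mul_mem_left _ _ (partialD_mem_tjurina f 0))
            (Ideal.mul_mem_left _ _ (partialD_mem_tjurina f 1)))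
      rintro x (hx | hx | (hx : x = partialD 1 f))
      · rw [hx, hη]; exact Ideal.mul_mem_left _ _ (self_mem_tjurina f)
      · rw [hx]; exact hp 0
      · rw [hx]; exact hp 1
    · rw [smul_eq_mul, Derivation.leibniz]
      exact add_mem (Ideal.mul_mem_left _ _ hx') (Ideal.mul_mem_right _ _ hx)
  obtain ⟨N, hN⟩ := exists_𝔪_pow_le_tjurina hf
  have hex : ∃ n, coord i ^ n ∈ tjurina f := ⟨N, hN (Ideal.pow_mem_pow (coord_mem i) N)⟩
  by_contra hne
  have hu : IsUnit (η (coord i)) := isUnit_iff.mpr hne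
  have hspec := Nat.find_spec hex
  cases hn : Nat.find hex with
  | zero =>
    rw [hn, pow_zero] at hspec
    have := mem_𝔪.mp (hJ𝔪 hspec)
    rw [map_one] at this
    exact one_ne_zero this
  | succ n =>
    refine Nat.find_min hex (m := n) (by omega) ?_
    rw [hn] at hspec
    have h1 := hηJ _ hspec
    rw [Derivation.leibniz_pow, nsmul_eq_mul, smul_eq_mul, Nat.add_sub_cancel, ← mul_assoc] at h1
    have hc : IsUnit ((n + 1 : ℕ) : 𝒪) := by
      rw [isUnit_iff, map_natCast]
      exact_mod_cast Nat.succ_ne_zero n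
    rw [mul_comm _ (coord i ^ n), mul_assoc] at h1
    exact (Ideal.mul_unit_mem_iff_mem _ (hc.mul hu)).mp h1

/-- Series with a nondegenerate quadratic part are quasi-homogeneous. -/
theorem isQuasiHomogeneous_of_hessian_ne_zero {f : 𝒪} (hf0 : f ≠ 0) (hf2 : f ∈ 𝔪 ^ 2)
    (hH : evalHom (partialD 0 (partialD 0 f)) * evalHom (partialD 1 (partialD 1 f)) -
      evalHom (partialD 1 (partialD 0 f)) * evalHom (partialD 0 (partialD 1 f)) ≠ 0) :
    IsQuasiHomogeneous f := by
  have hp : ∀ i, partialD i f ∈ 𝔪 := fun i => by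
    have := partialD_mem (k := 1) hf2 i
    rwa [pow_one] at this
  have h𝔪 : 𝔪 = Ideal.span {partialD 0 f, partialD 1 f} := by
    rw [← isCoordinateSystem_iff]
    refine ⟨hp 0, hp 1, ?_⟩
    rwa [← evalHom_apply, map_sub, map_mul, map_mul]
  -- Euler's formula for the quadratic part. Since the partial derivatives generate `𝔪`, the error
  -- in `𝔪 ^ 3` is a combination of them with coefficients in `𝔪 ^ 2`, which corrects the Euler
  -- field to a logarithmic one.
  have h3 : (2 : ℂ) • f - coord 0 * partialD 0 f - coord 1 * partialD 1 f ∈ 𝔪 ^ 3 := by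
    rw [mem_𝔪_pow]
    intro n hn
    rw [map_sub, map_sub, map_smul, cf_coord_mul_partialD, cf_coord_mul_partialD, smul_eq_mul]
    by_cases h : n.degree < 2
    · rw [mem_𝔪_pow.mp hf2 n h]; ring
    · have h2 : n 0 + n 1 = 2 := by rw [degree_eq] at hn h; omega
      have h2' : (n 0 : ℂ) + n 1 = 2 := by exact_mod_cast h2
      rw [← h2']
      ring
  have h4 : 𝔪 ^ 3 = 𝔪 ^ 2 * Ideal.span {partialD 0 f, partialD 1 f} := by rw [← h𝔪, ← pow_succ]
  rw [h4, Ideal.span_insert, Ideal.mul_sup, Submodule.mem_sup] at h3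
  obtain ⟨s, hs, t, ht, hst⟩ := h3
  obtain ⟨α, hα, rfl⟩ := Ideal.mem_mul_span_singleton.mp hs
  obtain ⟨β, hβ, rfl⟩ := Ideal.mem_mul_span_singleton.mp ht
  let η : Derivation ℂ 𝒪 𝒪 := (coord 0 + α) • partialD 0 + (coord 1 + β) • partialD 1
  refine isQuasiHomogeneous_of_poincare (η := η) (p := 1) (q := 1) (κ := 0) (a := 2) le_rfl le_rfl
    (Or.inl rfl) ?_ ?_ ?_ hf0 (Ideal.pow_le_self two_ne_zero hf2)
  · simpa [η, partialD_coord_ne] using hα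
  · simpa [η, partialD_coord_ne] using hβ
  · have h2 : (2 : ℂ) • f = 2 * f := by
      rw [Algebra.smul_def, map_ofNat]
    rw [h2] at hst
    simp only [η, Derivation.add_apply, Derivation.smul_apply, smul_eq_mul]
    linear_combination hst

theorem HasLogField.isQuasiHomogeneous {f : 𝒪} {p q : ℕ} {κ : ℂ}
    (h : HasLogField f !![(p : ℂ), 0; κ, (q : ℂ)]) (hp : 1 ≤ p) (hpq : p ≤ q) (hκ : κ = 0 ∨ p = q)
    (hf0 : f ≠ 0) (hf : f ∈ 𝔪) : IsQuasiHomogeneous f := by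
  obtain ⟨η, a, hηf, hη⟩ := h
  simp only [linForm_cons] at hη
  refine isQuasiHomogeneous_of_poincare hp hpq hκ ?_ ?_ hηf hf0 hf
  · simpa using hη 0
  · have := hη 1
    rw [Matrix.cons_val_one, Matrix.cons_val_zero, add_comm (κ • _)] at this
    exact this

/-- The quadratic part of `f` is an eigenvector of the linear part of `η`, on which the product of
the coordinates `k` and `i` has eigenvalue `l k + l i`. Differentiate `η f = a f` twice at the
origin. -/
theorem hessian_eigen {f : 𝒪} (hf2 : f ∈ 𝔪 ^ 2) {η : Derivation ℂ 𝒪 𝒪} {a : 𝒪} (hηf : η f = a * f)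
    {l : Fin 2 → ℂ} (hη : ∀ k, η (coord k) - l k • coord k ∈ 𝔪 ^ 2) (k i : Fin 2) :
    (l k + l i) * evalHom (partialD k (partialD i f)) =
      evalHom a * evalHom (partialD k (partialD i f)) := by
  have hf0 : evalHom f = 0 := mem_𝔪.mp (Ideal.pow_le_self two_ne_zero hf2)
  have hp : ∀ m, evalHom (partialD m f) = 0 := fun m => mem_𝔪.mp (by
    have := partialD_mem (k := 1) hf2 m
    rwa [pow_one] at this)
  have hη0 : ∀ g, evalHom (η g) = 0 := by
    intro g
    rw [derivation_apply, map_add, map_mul, map_mul, mem_𝔪.mp (apply_coord_mem hη 0),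
      mem_𝔪.mp (apply_coord_mem hη 1), zero_mul, zero_mul, add_zero]
  have hd : ∀ k m, evalHom (partialD k (η (coord m))) = if k = m then l m else 0 := by
    intro k m
    have h1 := partialD_mem (k := 1) (hη m) k
    rw [pow_one, map_sub, Derivation.map_smul, mem_𝔪, map_sub, map_smul, sub_eq_zero,
      partialD_coord] at h1
    rw [h1]
    split_ifs <;> simp
  have h1 := congrArg (fun g => evalHom (partialD k g)) (partialD_derivation η i f)
  rw [map_add (partialD k), partialD_derivation η k (partialD i f), hηf] at h1
  simp only [map_add, Derivation.leibniz, smul_eq_mul, map_mul, hf0, hp, hη0, hd, zero_mul, mul_zero,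
    add_zero, zero_add] at h1
  rw [h1]
  fin_cases k <;> fin_cases i <;> simp <;> ring

theorem tjurina_le_of_hessian {f : 𝒪} (hf2 : f ∈ 𝔪 ^ 2) {i j : Fin 2} (hij : i ≠ j)
    (h : ∀ k, evalHom (partialD i (partialD k f)) = 0) :
    tjurina f ≤ Ideal.span {coord j} ⊔ 𝔪 ^ 2 := by
  have hp : ∀ k, partialD k f ∈ Ideal.span {coord j} ⊔ 𝔪 ^ 2 := by
    intro k
    have h1 : partialD k f ∈ 𝔪 := by
      have := partialD_mem (k := 1) hf2 k
      rwa [pow_one] at this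
    have h2 := sub_linear_mem h1
    rw [← sub_add_cancel (partialD k f) (evalHom (partialD 0 (partialD k f)) • coord 0 +
      evalHom (partialD 1 (partialD k f)) • coord 1)]
    refine add_mem (Ideal.mem_sup_right h2) (Ideal.mem_sup_left ?_)
    have h3 : evalHom (partialD 0 (partialD k f)) • coord 0 +
      evalHom (partialD 1 (partialD k f)) • coord 1 =
        evalHom (partialD j (partialD k f)) • coord j := by
      have hk := h k
      fin_cases i <;> fin_cases j <;> simp_all
    rw [h3]
    exact Submodule.smul_of_tower_mem _ _ (Ideal.mem_span_singleton_self _)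
  rw [tjurina, Ideal.span_le]
  rintro _ (rfl | rfl | rfl)
  · exact Ideal.mem_sup_right hf2
  · exact hp 0
  · exact hp 1

/-- The assumptions force `a ≠ 0`; scaling the field by `Q / a` turns the eigenvalues into the
positive integers `Q` and `P`. A swap of the coordinates puts them in increasing order if needed. -/
theorem isQuasiHomogeneous_of_ratio {f : 𝒪} (hf0 : f ≠ 0) (hf : f ∈ 𝔪) {a b : ℂ}
    (h : HasLogField f !![a, 0; 0, b]) (hab : a + b ≠ 0)
    (hr : ∃ P Q : ℕ, 1 ≤ P ∧ 1 ≤ Q ∧ P * a = Q * b) : IsQuasiHomogeneous f := by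
  obtain ⟨P, Q, hP, hQ, hPQ⟩ := hr
  have hP0 : (P : ℂ) ≠ 0 := by exact_mod_cast (by omega : P ≠ 0)
  have hQ0 : (Q : ℂ) ≠ 0 := by exact_mod_cast (by omega : Q ≠ 0)
  have ha : a ≠ 0 := by
    rintro rfl
    rw [mul_zero, eq_comm, mul_eq_zero, or_iff_right hQ0] at hPQ
    exact hab (by rw [hPQ, add_zero])
  have h1 : HasLogField f !![(Q : ℂ), 0; 0, (P : ℂ)] := by
    have e : !![(Q : ℂ), 0; 0, (P : ℂ)] = (Q / a) • !![a, 0; 0, b] := by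
      have e1 : (Q : ℂ) / a * a = Q := by field_simp
      have e2 : (Q : ℂ) / a * b = P := by rw [div_mul_eq_mul_div, ← hPQ]; field_simp
      simp [Matrix.smul_of, e1, e2]
    rw [e]
    exact h.smul _
  rcases le_total Q P with hle | hle
  · exact h1.isQuasiHomogeneous hQ hle (Or.inl rfl) hf0 hf
  · have hT : (!![0, 1; 1, 0] : Matrix (Fin 2) (Fin 2) ℂ) * !![0, 1; 1, 0] = 1 := by
      rw [Matrix.one_fin_two]; simp
    have h2 : HasLogField (linSubst !![0, 1; 1, 0] f) !![(P : ℂ), 0; 0, (Q : ℂ)] :=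
      h1.linSubst hT (by simp)
    refine IsQuasiHomogeneous.of_linSubst hT (h2.isQuasiHomogeneous hP hle (Or.inl rfl) ?_ ?_)
    · intro h0
      apply hf0
      rw [← linSubst_linSubst hT f, h0, map_zero]
    · rw [← pow_one 𝔪] at hf ⊢
      exact linSubst_mem _ hf

/-- With a degenerate Hessian, each ordered pair of eigenvalues either satisfies a resonance or
yields an integral expression of `a(0)` by both eigenvalues. A resonance gives the ratio at once;
otherwise eliminating `a(0)` from the two expressions gives it. -/
theorem isQuasiHomogeneous_of_diagonal {f : 𝒪} (hf : Squarefree f) (hf2 : f ∈ 𝔪 ^ 2) {b c : ℂ}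
    (h : HasLogField f !![b, 0; 0, c]) (hbc : b + c ≠ 0) (hne : b ≠ c) :
    IsQuasiHomogeneous f := by
  have hf𝔪 := Ideal.pow_le_self two_ne_zero hf2
  by_cases hH : evalHom (partialD 0 (partialD 0 f)) * evalHom (partialD 1 (partialD 1 f)) -
      evalHom (partialD 1 (partialD 0 f)) * evalHom (partialD 0 (partialD 1 f)) ≠ 0
  · exact isQuasiHomogeneous_of_hessian_ne_zero hf.ne_zero hf2 hH
  rw [not_not] at hH
  obtain ⟨η, a, hηf, hη'⟩ := id h
  set l : Fin 2 → ℂ := ![b, c] with hl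
  have hη : ∀ k, η (coord k) - l k • coord k ∈ 𝔪 ^ 2 := by
    intro k
    have := hη' k
    rw [linForm_cons] at this
    fin_cases k <;> simpa [hl] using this
  have heig := hessian_eigen hf2 hηf hη
  have hl0 : l 0 = b := rfl
  have hl1 : l 1 = c := rfl
  -- the Hessian is diagonal
  have h01 : evalHom (partialD 0 (partialD 1 f)) = 0 := by
    by_contra hne01
    rw [← partialD_comm] at hH
    have h00 : evalHom (partialD 0 (partialD 0 f)) ≠ 0 := by
      intro h0
      rw [h0, zero_mul, zero_sub, neg_eq_zero, mul_self_eq_zero] at hH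
      exact hne01 hH
    have h11 : evalHom (partialD 1 (partialD 1 f)) ≠ 0 := by
      intro h0
      rw [h0, mul_zero, zero_sub, neg_eq_zero, mul_self_eq_zero] at hH
      exact hne01 hH
    have e0 := mul_right_cancel₀ h00 (heig 0 0)
    have e1 := mul_right_cancel₀ h11 (heig 1 1)
    rw [hl0] at e0
    rw [hl1] at e1
    exact hne (by linear_combination (e0 - e1) / 2)
  have hoff : ∀ i j, i ≠ j → evalHom (partialD i (partialD j f)) = 0 := by
    intro i j hij
    fin_cases i <;> fin_cases j
    · exact absurd rfl hij
    · exact h01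
    · change evalHom (partialD 1 (partialD 0 f)) = 0
      rw [← partialD_comm]; exact h01
    · exact absurd rfl hij
  -- A nonzero diagonal Hessian entry gives `2 lᵢ = a(0)` directly. If it vanishes, the whole row
  -- vanishes, and the eigenvalue relation along an invariant curve applies.
  have key : ∀ i j, i ≠ j → (∃ n : ℕ, 2 ≤ n ∧ n * l i = l j) ∨
      ∃ M α β : ℕ, 2 ≤ M ∧ α ≤ 1 ∧ β ≤ 1 ∧ (M + α) * l i + β * l j = evalHom a := by
    intro i j hij
    by_cases hii : evalHom (partialD i (partialD i f)) = 0
    · by_cases hres : ∃ n : ℕ, 2 ≤ n ∧ n * l i = l j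
      · exact Or.inl hres
      · push Not at hres
        obtain ⟨M, hM, hrel⟩ := exists_eigenvalue_relation hf hηf hη hij hres
          (tjurina_le_of_hessian hf2 hij fun k => by
            by_cases hik : i = k
            · rw [← hik]; exact hii
            · exact hoff i k hik)
        right
        rcases hrel with hrel | ⟨k, hrel⟩
        · exact ⟨M, 0, 0, hM, by omega, by omega, by push_cast; linear_combination hrel⟩
        · by_cases hik : k = i
          · subst hik
            exact ⟨M, 1, 0, hM, by omega, by omega, by push_cast; linear_combination hrel⟩
          · have hkj : k = j := by omega
            subst hkj
            exact ⟨M, 0, 1, hM, by omega, by omega, by push_cast; linear_combination hrel⟩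
    · right
      have e := mul_right_cancel₀ hii (heig i i)
      exact ⟨2, 0, 0, le_rfl, by omega, by omega, by push_cast; linear_combination e⟩
  refine isQuasiHomogeneous_of_ratio hf.ne_zero hf𝔪 h hbc ?_
  rcases key 0 1 zero_ne_one with ⟨n, hn, hnl⟩ | ⟨M, α, β, hM, hα, hβ, hrel⟩
  · exact ⟨n, 1, by omega, le_rfl, by rw [Nat.cast_one, one_mul]; exact hnl⟩
  rcases key 1 0 one_ne_zero with ⟨n, hn, hnl⟩ | ⟨M', α', β', hM', hα', hβ', hrel'⟩
  · exact ⟨1, n, le_rfl, by omega, by rw [Nat.cast_one, one_mul]; exact hnl.symm⟩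
  -- Subtracting the two expressions of `a(0)`. The coefficients are positive because `M, M' ≥ 2`
  -- while `β, β' ≤ 1`.
  refine ⟨M + α - β', M' + α' - β, by omega, by omega, ?_⟩
  rw [Nat.cast_sub (by omega), Nat.cast_sub (by omega)]
  push_cast
  rw [hl0, hl1] at hrel hrel'
  linear_combination hrel - hrel'

/-- For equal eigenvalues the field is scaled to `p = q = 1` and a possible Jordan block is kept in
`κ`. For distinct ones a shear removes the off-diagonal entry. -/
theorem isQuasiHomogeneous_of_triangular {f : 𝒪} (hf : Squarefree f) (hf2 : f ∈ 𝔪 ^ 2)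
    {b c κ : ℂ} (h : HasLogField f !![b, 0; κ, c]) (hbc : b + c ≠ 0) : IsQuasiHomogeneous f := by
  by_cases hne : b = c
  · subst hne
    have hb : b ≠ 0 := by
      rintro rfl
      exact hbc (add_zero 0)
    have h1 := h.smul b⁻¹
    have e : b⁻¹ • !![b, 0; κ, b] = !![((1 : ℕ) : ℂ), 0; b⁻¹ * κ, ((1 : ℕ) : ℂ)] := by
      simp [Matrix.smul_of, hb]
    rw [e] at h1
    exact h1.isQuasiHomogeneous le_rfl le_rfl (Or.inr rfl) hf.ne_zero
      (Ideal.pow_le_self two_ne_zero hf2)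
  · set s := κ / (c - b) with hs
    have hcb : c - b ≠ 0 := sub_ne_zero.mpr (Ne.symm hne)
    have hT : (!![1, 0; s, 1] : Matrix (Fin 2) (Fin 2) ℂ) * !![1, 0; -s, 1] = 1 := by
      rw [Matrix.one_fin_two]; simp
    have hsc : s * b + κ = c * s := by
      rw [hs]
      field_simp
      ring
    have h1 : HasLogField (linSubst !![1, 0; -s, 1] f) !![b, 0; 0, c] :=
      h.linSubst hT (by simp [hsc])
    exact IsQuasiHomogeneous.of_linSubst hT (isQuasiHomogeneous_of_diagonal
      (squarefree_linSubst hT hf) (linSubst_mem _ hf2) h1 hbc hne)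

theorem isQuasiHomogeneous_of_hasLogField {f : 𝒪} (hf : Squarefree f) (hf2 : f ∈ 𝔪 ^ 2)
    {M : Matrix (Fin 2) (Fin 2) ℂ} (h : HasLogField f M) (hM : M 0 0 + M 1 1 ≠ 0) :
    IsQuasiHomogeneous f := by
  rw [M.eta_fin_two] at h
  by_cases h01 : M 0 1 = 0
  · rw [h01] at h
    exact isQuasiHomogeneous_of_triangular hf hf2 h hM
  · obtain ⟨z, hz⟩ := IsAlgClosed.exists_pow_nat_eq
      ((M 0 0 - M 1 1) ^ 2 + 4 * M 0 1 * M 1 0) two_pos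
    set t : ℂ := (M 0 0 + M 1 1 + z) / 2 with ht
    have hchar : t * t - (M 0 0 + M 1 1) * t + (M 0 0 * M 1 1 - M 0 1 * M 1 0) = 0 := by
      rw [ht]
      linear_combination hz / 4
    -- The first row is a left eigenvector of `M` for the eigenvalue `t`, so conjugation by this
    -- matrix makes `M` lower triangular with the same trace.
    have hT : !![t - M 1 1, M 0 1; 1, 0] * !![0, 1; (M 0 1)⁻¹, -(t - M 1 1) * (M 0 1)⁻¹] = 1 := by
      rw [Matrix.one_fin_two]
      simp [h01]
      field_simp
      ring
    have h1 : HasLogField (linSubst !![0, 1; (M 0 1)⁻¹, -(t - M 1 1) * (M 0 1)⁻¹] f)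
        !![t, 0; 1, M 0 0 + M 1 1 - t] := by
      refine h.linSubst hT ?_
      rw [Matrix.mul_fin_two, Matrix.mul_fin_two]
      congr 1
      ext i j
      fin_cases i <;> fin_cases j <;> simp
      · linear_combination -hchar
      · ring
    refine IsQuasiHomogeneous.of_linSubst hT (isQuasiHomogeneous_of_triangular
      (squarefree_linSubst hT hf) (linSubst_mem _ hf2) h1 ?_)
    rwa [add_sub_cancel]

/-- A reduced plane curve germ with a logarithmic vector field of divergence `1` is
quasi-homogeneous. -/
theorem isQuasiHomogeneous_of_divergence {f b c a : 𝒪} (hf : Squarefree f) (hf𝔪 : f ∈ 𝔪)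
    (hdiv : partialD 0 b + partialD 1 c = 1)
    (hlog : b * partialD 0 f + c * partialD 1 f = a * f) : IsQuasiHomogeneous f := by
  by_cases hf2 : f ∈ 𝔪 ^ 2
  · let η : Derivation ℂ 𝒪 𝒪 := b • partialD 0 + c • partialD 1
    have hη0 : η (coord 0) = b := by simp [η, partialD_coord_ne]
    have hη1 : η (coord 1) = c := by simp [η, partialD_coord_ne]
    have hηf : η f = a * f := hlog
    let M : Matrix (Fin 2) (Fin 2) ℂ := Matrix.of fun i j => evalHom (partialD j (η (coord i)))
    refine isQuasiHomogeneous_of_hasLogField hf hf2 (M := M)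
      ⟨η, a, hηf, fun i => sub_linear_mem (apply_coord_mem_of_log hf hf2 hηf i)⟩ ?_
    -- The trace of the linear part is the divergence at the origin.
    change evalHom (partialD 0 (η (coord 0))) + evalHom (partialD 1 (η (coord 1))) ≠ 0
    rw [hη0, hη1, ← map_add, hdiv, map_one]
    exact one_ne_zero
  · exact isQuasiHomogeneous_of_notMem hf𝔪 hf2

end PlaneCurve

theorem mainTheorem4 (f : PlaneCurve.𝒪) (hf₀ : PlaneCurve.eval₀ f = 0) (hf : Squarefree f)
    (hqh : ¬ PlaneCurve.IsQuasiHomogeneous f) :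
    Nontrivial (CategoryTheory.Abelian.Ext (ModuleCat.of PlaneCurve.𝒟 (PlaneCurve.TildeMLog f))
      (ModuleCat.of PlaneCurve.𝒟 PlaneCurve.𝒪) 2) := by
  by_contra h
  rw [not_nontrivial_iff_subsingleton] at h
  obtain ⟨b, c, a, hdiv, hlog⟩ := PlaneCurve.exists_divergence_eq_one hf h
  exact hqh (PlaneCurve.isQuasiHomogeneous_of_divergence hf hf₀ hdiv hlog)
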